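/- **Setting.** Let $\Phi^t:\Omega\to\Omega$, $t\in\mathbb R$, be a continuous flow on a metric space with an invariant ergodic Borel probability measure $\mu$ carried by a compact set $X$, and let $M\supseteq X$ be a compact $C^1$ manifold (possibly with boundary) in $\Omega$ with $\Phi^t(M)\subseteq M$ for $t\ge 0$, such that the maps $\Phi^t|_M$, $t\ge 0$, are $C^1$ and generated by a continuous vector field on $M$. Let $F:\Omega\to Y$ be continuous with values in a Banach space, $F|_M$ of class $C^1$, and let $h:[0,\infty)\to(0,\infty)$ be $C^1$ and bounded with bounded derivative. Write $d(x,x')=\|F(x)-F(x')\|$, fix $T>0$, and put $$k_T=h(d_T^2),\quad d_T^2(x,x')=\frac1T\int_0^T d^2(\Phi^tx,\Phi^tx')\,dt,\qquad k_{T,\Delta t}=h(d_{T,\Delta t}^2),\quad d_{T,\Delta t}^2(x,x')=\frac1Q\sum_{q=0}^{Q-1}d^2(\Phi^{q\Delta t}x,\Phi^{q\Delta t}x'),\quad \Delta t=\frac TQ .$$ Let $K_Tf=\int k_T(\cdot,y)f(y)\,d\mu(y)$ on $L^2(\mu)$, $U^tf=f\circ\Phi^t$ the Koopman group on $L^2(\mu)$,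 and $V$ its generator. Inner products are conjugate-linear in the first argument. Eigenvalues are listed in decreasing order with multiplicity, with indices $0,1,2,\dots$. Let $\phi,\psi$ be real, mutually orthogonal, unit-norm eigenfunctions of $K_T$ whose eigenvalues $\lambda$ and $\nu$ are the $l$-th and the $j$-th one, $j<l$ (so $\lambda\le\nu$), with $\lambda>0$; assume that $\lambda,\nu$ are simple if distinct, and twofold degenerate if equal. Set $$z=\tfrac1{\sqrt2}(\phi+i\psi),\quad \alpha_t=\langle z,U^tz\rangle,\quad \omega=\langle\psi,V\phi\rangle,\quad \zeta=\tfrac1{\sqrt2}\int k_T(\cdot,y)\Big(\frac{\phi(y)}{\lambda}+i\frac{\psi(y)}{\nu}\Big)d\mu(y).$$ **Data.** Let $x_0\in M$, and let $\Delta t=T/Q\to0$ along a sequence such that, for every $\Delta t$ in it, the sampling measures $\mu_N=\frac1N\sum_{n<N}\delta_{x_n}$, $x_n=\Phi^{n\Delta t}(x_0)$, converge weakly to $\mu$ as $N\to\infty$. Identify $L^2(\mu_N)$ with $\mathbb C^N$ via $f_n=f(x_n)$, with $\langle f,g\rangle_N=\frac1N\sum_nf_n^*g_n$; let $K_{T,\Delta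 t,N}f=\frac1N\sum_nk_{T,\Delta t}(\cdot,x_n)f_n$, let $U_N^q$ be the $q$-step shift, $(U_N^qf)_n=f_{n+q}$ if $n+q\le N-1$ and $0$ otherwise, and $V_{\Delta t,N}=(U_N^1-\mathrm{Id})/\Delta t$. For all $\Delta t$ and all $N>l$, choose in any way real, mutually orthogonal, unit-norm eigenvectors $\phi_{\Delta t,N},\psi_{\Delta t,N}$ of $K_{T,\Delta t,N}$ whose eigenvalues $\lambda_{\Delta t,N},\nu_{\Delta t,N}$ are the $l$-th and the $j$-th one. For real vectors $f,g\in\mathbb C^N$ put $z(f,g)=(f+ig)/\sqrt2$ and $$\zeta_{\Delta t,N}(f,g)=\tfrac1{\sqrt2}\int k_{T,\Delta t}(\cdot,y)\Big(\frac{f(y)}{\lambda_{\Delta t,N}}+i\frac{g(y)}{\nu_{\Delta t,N}}\Big)d\mu_N(y),\quad \alpha_{q,\Delta t,N}(f,g)=\langle z(f,g),U_N^qz(f,g)\rangle_N,\quad \omega_{\Delta t,N}(f,g)=\langle g,V_{\Delta t,N}f\rangle_N .$$ **Claim.** For all sufficiently small $\Delta t$ and then all sufficiently large $N$, $\lambda_{\Delta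 t,N}$ and $\nu_{\Delta t,N}$ are positive. Moreover $\phi\in D(V)$, and there are signs $s=s_{\Delta t,N}\in\{1,-1\}$ and unimodular complex numbers $c=c_{\Delta t,N}$, with $c\in\{1,-1\}$ if $\lambda\ne\nu$, such that, abbreviating $\phi'=\phi_{\Delta t,N}$, $\psi'=s\,\psi_{\Delta t,N}$, the following hold. In each iterated limit the inner limit exists for all sufficiently small $\Delta t$. 1. $\displaystyle\lim_{\Delta t\to0}\lim_{N\to\infty}\big\|c\,\zeta_{\Delta t,N}(\phi',\psi')-\zeta\big\|_{C(M)}=0$. 2. For all sufficiently small $\Delta t$ the limit $a_{q,\Delta t}=\lim_{N\to\infty}\alpha_{q,\Delta t,N}(\phi',\psi')$ exists for every $q\in\mathbb N_0$, and $\sup_{q}|a_{q,\Delta t}-\alpha_{q\Delta t}|\to0$ as $\Delta t\to0$. 3. With the rotated real vectors $\tilde\phi,\tilde\psi$ given by $\tilde\phi+i\tilde\psi=c(\phi'+i\psi')$ (which are $c\phi',c\psi'$ if $c=\pm1$), $$\lim_{\Delta t\to0}\lim_{N\to\infty}\omega_{\Delta t,N}(\tilde\phi,\tilde\psi)=\omega,\qquad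 \lim_{\Delta t\to0}\limsup_{N\to\infty}\big|\omega_{\Delta t,N}(\phi',\psi')-\omega\big|=0 .$$ Thus, when $\lambda\neq\nu$, the convergence holds for data-driven eigenvectors with suitably chosen signs; when $\lambda=\nu$, it holds up to the choice of the orthonormal basis of the span of the two eigenvectors. In particular, if the two data-driven eigenvalues also coincide, $\tilde\phi,\tilde\psi$ are again eigenvectors. -/

import Mathlib

open MeasureTheory Filter Topology Set
open scoped ENNReal BoundedContinuousFunction Manifold

noncomputable section

namespace DelayCoherence

/-! ### The measure-preserving flow, its Koopman group and the generator -/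

section Flow

variable {Ω : Type*} [MetricSpace Ω] [MeasurableSpace Ω]

/-- `μ` is invariant and ergodic under the continuous flow `Φ`. -/
structure IsErgodicFlow (Φ : Flow ℝ Ω) (μ : Measure Ω) : Prop where
  measurePreserving : ∀ t : ℝ, MeasurePreserving (Φ t) μ μ
  ergodic : ∀ s : Set Ω, MeasurableSet s → (∀ t : ℝ, Φ t ⁻¹' s = s) → μ s = 0 ∨ μ sᶜ = 0

/-- The Koopman operator `U^t f = f ∘ Φ^t` on `L²(μ)`. -/
def koopman {Φ : Flow ℝ Ω} {μ : Measure Ω} (hΦ : IsErgodicFlow Φ μ) (t : ℝ) :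
    Lp ℂ 2 μ →ₗᵢ[ℂ] Lp ℂ 2 μ :=
  Lp.compMeasurePreservingₗᵢ ℂ (Φ t) (hΦ.measurePreserving t)

/-- The generator `V` of the Koopman group: `V f = d/dt U^t f` at `t = 0`, with domain the set of
all `f` for which this derivative exists in `L²(μ)`. -/
def koopmanGenerator {Φ : Flow ℝ Ω} {μ : Measure Ω} (hΦ : IsErgodicFlow Φ μ) :
    Lp ℂ 2 μ →ₗ.[ℂ] Lp ℂ 2 μ where
  domain :=
    { carrier := {f | DifferentiableAt ℝ (fun t : ℝ => koopman hΦ t f) 0}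
      add_mem' := by
        intro f g hf hg
        simpa only [mem_ofPred_eq, map_add] using DifferentiableAt.fun_add hf hg
      zero_mem' := by
        simp only [mem_ofPred_eq, map_zero]
        exact differentiableAt_const _
      smul_mem' := by
        intro c f hf
        simpa only [mem_ofPred_eq, map_smul] using DifferentiableAt.fun_const_smul hf c }
  toFun :=
    { toFun := fun f => deriv (fun t : ℝ => koopman hΦ t (f : Lp ℂ 2 μ)) 0
      map_add' := by
        intro f g
        simp only [Submodule.coe_add, map_add]
        exact deriv_fun_add f.2 g.2
      map_smul' := by
        intro c f
        simp only [Submodule.coe_smul, map_smul, RingHom.id_apply]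
        exact deriv_fun_const_smul c f.2 }

/-- The forward orbit `t ↦ Φ^t(x)`, `t ≥ 0`, as a curve in the forward-invariant set `M`
(extended by the constant value `x` to `t < 0`). -/
def forwardOrbit (Φ : Flow ℝ Ω) {M : Set Ω} (hM : ∀ t : ℝ, 0 ≤ t → MapsTo (Φ t) M M)
    (x : M) (t : ℝ) : M :=
  ⟨Φ (max t 0) x, hM _ (le_max_right t 0) x.2⟩

/-- The sampled state `x_n = Φ^{n Δt}(x₀)`. -/
def sample (Φ : Flow ℝ Ω) (x₀ : Ω) (Δt : ℝ) (n : ℕ) : Ω := Φ (n * Δt) x₀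

/-- The sampling measures `μ_N = N⁻¹ ∑_{n < N} δ_{x_n}` of the orbit of `x₀` with sampling
interval `Δt` converge weakly to `μ`. -/
def SamplesConverge (Φ : Flow ℝ Ω) (μ : Measure Ω) (x₀ : Ω) (Δt : ℝ) : Prop :=
  ∀ f : Ω →ᵇ ℝ, Tendsto
    (fun N : ℕ => (N : ℝ)⁻¹ * ∑ n ∈ Finset.range N, f (sample Φ x₀ Δt n)) atTop
    (𝓝 (∫ x, f x ∂μ))

end Flow

/-! ### Delay-coordinate distances and kernels -/

/-- A kernel shape function `h : [0, ∞) → (0, ∞)`: positive, `C¹`, bounded, with bounded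
derivative. (The values on negative arguments are irrelevant.) -/
structure ShapeFunction where
  toFun : ℝ → ℝ
  pos : ∀ u, 0 ≤ u → 0 < toFun u
  contDiffOn : ContDiffOn ℝ 1 toFun (Ici 0)
  bounded : ∃ C, ∀ u, 0 ≤ u → toFun u ≤ C
  deriv_bounded : ∃ C, ∀ u, 0 ≤ u → |derivWithin toFun (Ici 0) u| ≤ C

section Kernel

variable {Ω : Type*} [MetricSpace Ω] {Y : Type*} [NormedAddCommGroup Y]

/-- `d²(x, x') = ‖F x - F x'‖²`. -/
def sqDist (F : C(Ω, Y)) (p : Ω × Ω) : ℝ := ‖F p.1 - F p.2‖ ^ 2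

/-- `d_T²(x, x') = T⁻¹ ∫₀ᵀ d²(Φ^t x, Φ^t x') dt`. -/
def delaySqDist (Φ : Flow ℝ Ω) (F : C(Ω, Y)) (T : ℝ) (p : Ω × Ω) : ℝ :=
  T⁻¹ * ∫ t in (0 : ℝ)..T, sqDist F (Φ t p.1, Φ t p.2)

/-- `d_{T,Δt}²(x, x') = Q⁻¹ ∑_{q < Q} d²(Φ^{q Δt} x, Φ^{q Δt} x')`, with `Δt = T / Q`. -/
def delaySqDistDisc (Φ : Flow ℝ Ω) (F : C(Ω, Y)) (T : ℝ) (Q : ℕ) (p : Ω × Ω) : ℝ :=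
  (Q : ℝ)⁻¹ * ∑ q ∈ Finset.range Q, sqDist F (Φ (q * (T / Q)) p.1, Φ (q * (T / Q)) p.2)

theorem continuous_sqDist (F : C(Ω, Y)) : Continuous (sqDist F) := by
  unfold sqDist
  fun_prop

theorem sqDist_nonneg (F : C(Ω, Y)) (p : Ω × Ω) : 0 ≤ sqDist F p := by
  unfold sqDist
  positivity

theorem continuous_delaySqDist (Φ : Flow ℝ Ω) (F : C(Ω, Y)) (T : ℝ) :
    Continuous (delaySqDist Φ F T) := by
  unfold delaySqDist
  refine continuous_const.mul
    (intervalIntegral.continuous_parametric_intervalIntegral_of_continuous' ?_ 0 T)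
  exact (continuous_sqDist F).comp
    ((Φ.continuous continuous_snd (continuous_fst.comp continuous_fst)).prodMk
      (Φ.continuous continuous_snd (continuous_snd.comp continuous_fst)))

theorem delaySqDist_nonneg (Φ : Flow ℝ Ω) (F : C(Ω, Y)) (T : ℝ) (p : Ω × Ω) :
    0 ≤ delaySqDist Φ F T p := by
  unfold delaySqDist
  rcases le_total 0 T with hT | hT
  · exact mul_nonneg (inv_nonneg.2 hT)
      (intervalIntegral.integral_nonneg hT fun t _ => sqDist_nonneg F _)
  · rw [intervalIntegral.integral_symm]
    refine mul_nonneg_of_nonpos_of_nonpos (inv_nonpos.2 hT) (neg_nonpos.2 ?_)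
    exact intervalIntegral.integral_nonneg hT fun t _ => sqDist_nonneg F _

theorem continuous_delaySqDistDisc (Φ : Flow ℝ Ω) (F : C(Ω, Y)) (T : ℝ) (Q : ℕ) :
    Continuous (delaySqDistDisc Φ F T Q) := by
  unfold delaySqDistDisc
  refine continuous_const.mul (continuous_finsetSum _ fun q _ => ?_)
  exact (continuous_sqDist F).comp
    ((Φ.continuous continuous_const continuous_fst).prodMk
      (Φ.continuous continuous_const continuous_snd))

theorem delaySqDistDisc_nonneg (Φ : Flow ℝ Ω) (F : C(Ω, Y)) (T : ℝ) (Q : ℕ) (p : Ω × Ω) :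
    0 ≤ delaySqDistDisc Φ F T Q p :=
  mul_nonneg (by positivity) (Finset.sum_nonneg fun q _ => sqDist_nonneg F _)

/-- The kernel `h ∘ D` for a continuous `D : Ω × Ω → [0, ∞)`, as a bounded continuous function. -/
def radialKernel (h : ShapeFunction) (D : Ω × Ω → ℝ) (hc : Continuous D) (h0 : ∀ p, 0 ≤ D p) :
    (Ω × Ω) →ᵇ ℝ :=
  BoundedContinuousFunction.ofNormedAddCommGroup (fun p => h.toFun (D p))
    (h.contDiffOn.continuousOn.comp_continuous hc h0) h.bounded.choose
    (fun p => by
      rw [Real.norm_of_nonneg (h.pos _ (h0 p)).le]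
      exact h.bounded.choose_spec _ (h0 p))

/-- `k_T = h ∘ d_T²`. -/
def kernel (h : ShapeFunction) (Φ : Flow ℝ Ω) (F : C(Ω, Y)) (T : ℝ) : (Ω × Ω) →ᵇ ℝ :=
  radialKernel h (delaySqDist Φ F T) (continuous_delaySqDist Φ F T) (delaySqDist_nonneg Φ F T)

/-- `k_{T,Δt} = h ∘ d_{T,Δt}²`, with `Δt = T / Q`. -/
def kernelDisc (h : ShapeFunction) (Φ : Flow ℝ Ω) (F : C(Ω, Y)) (T : ℝ) (Q : ℕ) :
    (Ω × Ω) →ᵇ ℝ :=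
  radialKernel h (delaySqDistDisc Φ F T Q) (continuous_delaySqDistDisc Φ F T Q)
    (delaySqDistDisc_nonneg Φ F T Q)

end Kernel

/-! ### Integral operators on `L²(μ)` -/

section IntegralOperator

variable {Ω : Type*} [MetricSpace Ω] [MeasurableSpace Ω] [BorelSpace Ω]
  (μ : Measure Ω) [IsFiniteMeasure μ]

theorem integrable_kernel_mul (k : (Ω × Ω) →ᵇ ℝ) (f : Lp ℂ 2 μ) (x : Ω) :
    Integrable (fun y => (k (x, y) : ℂ) * f y) μ := by
  have hf : Integrable f μ := (Lp.memLp f).integrable (by norm_num)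
  refine hf.bdd_mul (c := ‖k‖) ?_ (ae_of_all _ fun y => ?_)
  · exact (by fun_prop : Continuous fun y => (k (x, y) : ℂ)).aestronglyMeasurable
  · simpa using k.norm_coe_le_norm (x, y)

theorem memLp_kernel_integral (k : (Ω × Ω) →ᵇ ℝ) (f : Lp ℂ 2 μ) :
    MemLp (fun x => ∫ y, (k (x, y) : ℂ) * f y ∂μ) 2 μ := by
  have hf : Integrable f μ := (Lp.memLp f).integrable (by norm_num)
  have hb : ∀ x y, ‖(k (x, y) : ℂ) * f y‖ ≤ ‖k‖ * ‖f y‖ := fun x y => by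
    rw [norm_mul]
    refine mul_le_mul_of_nonneg_right ?_ (norm_nonneg _)
    simpa using k.norm_coe_le_norm (x, y)
  have hc : Continuous fun x => ∫ y, (k (x, y) : ℂ) * f y ∂μ := by
    refine continuous_of_dominated (bound := fun y => ‖k‖ * ‖f y‖)
      (fun x => (integrable_kernel_mul μ k f x).aestronglyMeasurable)
      (fun x => ae_of_all _ (hb x)) (hf.norm.const_mul _) (ae_of_all _ fun y => ?_)
    fun_prop
  refine MemLp.of_bound hc.aestronglyMeasurable (∫ y, ‖k‖ * ‖f y‖ ∂μ) (ae_of_all _ fun x => ?_)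
  exact (norm_integral_le_integral_norm _).trans
    (integral_mono (integrable_kernel_mul μ k f x).norm (hf.norm.const_mul _) (hb x))

/-- The integral operator `K f = ∫ k(·, y) f(y) dμ(y)` on `L²(μ)`. -/
def integralOp (k : (Ω × Ω) →ᵇ ℝ) : Lp ℂ 2 μ →ₗ[ℂ] Lp ℂ 2 μ where
  toFun f := (memLp_kernel_integral μ k f).toLp _
  map_add' f g := by
    rw [← MemLp.toLp_add]
    refine MemLp.toLp_congr _ _ (ae_of_all _ fun x => ?_)
    rw [Pi.add_apply, ← integral_add (integrable_kernel_mul μ k f x)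
      (integrable_kernel_mul μ k g x)]
    refine integral_congr_ae ?_
    filter_upwards [Lp.coeFn_add f g] with y hy
    rw [hy, Pi.add_apply, mul_add]
  map_smul' c f := by
    rw [RingHom.id_apply, ← MemLp.toLp_const_smul]
    refine MemLp.toLp_congr _ _ (ae_of_all _ fun x => ?_)
    rw [Pi.smul_apply, ← integral_smul]
    refine integral_congr_ae ?_
    filter_upwards [Lp.coeFn_smul c f] with y hy
    rw [hy, Pi.smul_apply, smul_eq_mul, smul_eq_mul]
    ring

/-- `z = (φ + i ψ) / √2` in `L²(μ)`. -/
def zL2 {μ : Measure Ω} (φ ψ : Lp ℂ 2 μ) : Lp ℂ 2 μ :=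
  ((1 / √2 : ℝ) : ℂ) • (φ + Complex.I • ψ)

/-- The autocorrelation function `α_t = ⟨z, U^t z⟩` of `z = (φ + i ψ) / √2`. -/
def autocorr {μ : Measure Ω} {Φ : Flow ℝ Ω} (hΦ : IsErgodicFlow Φ μ) (φ ψ : Lp ℂ 2 μ) (t : ℝ) :
    ℂ :=
  inner ℂ (zL2 φ ψ) (koopman hΦ t (zL2 φ ψ))

/-- The coherent feature `ζ = 2^{-1/2} ∫ k(·, y) (φ(y) / lam + i ψ(y) / nu) dμ(y)`. -/
def feature {μ : Measure Ω} (k : (Ω × Ω) →ᵇ ℝ) (lam nu : ℝ) (φ ψ : Lp ℂ 2 μ) (x : Ω) : ℂ :=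
  ((1 / √2 : ℝ) : ℂ) * ∫ y, (k (x, y) : ℂ) * (φ y / (lam : ℂ) + Complex.I * (ψ y / (nu : ℂ))) ∂μ

end IntegralOperator

/-! ### Eigenvalues counted with multiplicity -/

/-- `r` is the `j`-th eigenvalue (`j = 0, 1, …`) of `A` when the real eigenvalues are listed in
decreasing order with multiplicity: at most `j` eigenvalues are `> r`, more than `j` are `≥ r`. -/
def IsNthEigenvalue {E : Type*} [AddCommGroup E] [Module ℂ E] (A : Module.End ℂ E)
    (j : ℕ) (r : ℝ) : Prop :=
  Module.finrank ℂ (⨆ u : {u : ℝ // r < u}, A.eigenspace ((u : ℝ) : ℂ) : Submodule ℂ E) ≤ j ∧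
  j < Module.finrank ℂ (⨆ u : {u : ℝ // r ≤ u}, A.eigenspace ((u : ℝ) : ℂ) : Submodule ℂ E)

/-- `φ`, `ψ` are mutually orthogonal, unit-norm, real eigenfunctions of `K` on `L²(μ)`, with
eigenvalues `lam` and `nu`, which are the `l`-th and the `j`-th one. -/
structure IsEigenPair {Ω : Type*} [MeasurableSpace Ω] {μ : Measure Ω}
    (K : Lp ℂ 2 μ →ₗ[ℂ] Lp ℂ 2 μ) (j l : ℕ) (lam nu : ℝ) (φ ψ : Lp ℂ 2 μ) : Prop where
  nth_lam : IsNthEigenvalue K l lam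
  nth_nu : IsNthEigenvalue K j nu
  eig_φ : K φ = (lam : ℂ) • φ
  eig_ψ : K ψ = (nu : ℂ) • ψ
  real_φ : ∀ᵐ x ∂μ, (φ x).im = 0
  real_ψ : ∀ᵐ x ∂μ, (ψ x).im = 0
  norm_φ : ‖φ‖ = 1
  norm_ψ : ‖ψ‖ = 1
  orthogonal : inner ℂ φ ψ = 0

/-! ### The data-driven objects

The Hilbert space `L²(μ_N)` of the sampling measure is represented by `ℂ^N`, where `f` corresponds
to the vector `(f(x_0), …, f(x_{N-1}))`. -/

section Data

variable {Ω : Type*} [MetricSpace Ω]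

/-- `⟨f, g⟩_N = N⁻¹ ∑_n f(x_n)^* g(x_n)`. -/
def innerN {N : ℕ} (f g : Fin N → ℂ) : ℂ :=
  (N : ℂ)⁻¹ * ∑ n, (starRingEnd ℂ) (f n) * g n

/-- The operator `f ↦ N⁻¹ ∑_n k(·, x_n) f(x_n)` on `L²(μ_N)`, for the states `x_n = x n`. -/
def dataOp (k : (Ω × Ω) →ᵇ ℝ) (x : ℕ → Ω) (N : ℕ) : Module.End ℂ (Fin N → ℂ) :=
  Matrix.toLin' (Matrix.of fun m n : Fin N => (N : ℂ)⁻¹ * (k (x m, x n) : ℂ))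

/-- The `q`-step shift operator: `U^q_N f(x_n) = f(x_{n+q})` if `n + q ≤ N - 1`, and `0` else. -/
def shift {N : ℕ} (q : ℕ) (f : Fin N → ℂ) (n : Fin N) : ℂ :=
  if hn : (n : ℕ) + q < N then f ⟨n + q, hn⟩ else 0

/-- The finite-difference operator `V_{Δt,N} = (U_N - Id) / Δt`. -/
def finiteDiff {N : ℕ} (Δt : ℝ) (f : Fin N → ℂ) (n : Fin N) : ℂ :=
  (shift 1 f n - f n) / (Δt : ℂ)

/-- `z_{Δt,N} = (φ + i ψ) / √2` in `L²(μ_N)`. -/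
def zN {N : ℕ} (φ ψ : Fin N → ℂ) (n : Fin N) : ℂ :=
  ((1 / √2 : ℝ) : ℂ) * (φ n + Complex.I * ψ n)

/-- The empirical autocorrelation `α_{q,Δt,N} = ⟨z, U^q_N z⟩_N` of `z = (φ + i ψ) / √2`. -/
def autocorrN {N : ℕ} (φ ψ : Fin N → ℂ) (q : ℕ) : ℂ :=
  innerN (zN φ ψ) (shift q (zN φ ψ))

/-- The empirical frequency `ω_{Δt,N} = ⟨ψ, V_{Δt,N} φ⟩_N`. -/
def freqN {N : ℕ} (Δt : ℝ) (φ ψ : Fin N → ℂ) : ℂ :=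
  innerN ψ (finiteDiff Δt φ)

/-- The data-driven coherent feature
`ζ_{Δt,N} = 2^{-1/2} ∫ k(·, y) (φ(y) / lam + i ψ(y) / nu) dμ_N(y)`. -/
def featureN (k : (Ω × Ω) →ᵇ ℝ) (x : ℕ → Ω) {N : ℕ} (lam nu : ℝ) (φ ψ : Fin N → ℂ) (y : Ω) : ℂ :=
  ((1 / √2 : ℝ) : ℂ) * ((N : ℂ)⁻¹ * ∑ n : Fin N,
    (k (y, x n) : ℂ) * (φ n / (lam : ℂ) + Complex.I * (ψ n / (nu : ℂ))))

/-- `φ`, `ψ` are mutually orthogonal, unit-norm, real eigenvectors in `L²(μ_N)` of `K`, with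
eigenvalues `lam` and `nu`, which are the `l`-th and the `j`-th one. -/
structure IsDataEigenPair {N : ℕ} (K : Module.End ℂ (Fin N → ℂ)) (j l : ℕ) (lam nu : ℝ)
    (φ ψ : Fin N → ℂ) : Prop where
  nth_lam : IsNthEigenvalue K l lam
  nth_nu : IsNthEigenvalue K j nu
  eig_φ : K φ = (lam : ℂ) • φ
  eig_ψ : K ψ = (nu : ℂ) • ψ
  real_φ : ∀ n, (φ n).im = 0
  real_ψ : ∀ n, (ψ n).im = 0
  norm_φ : innerN φ φ = 1
  norm_ψ : innerN ψ ψ = 1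
  orthogonal : innerN φ ψ = 0

/-- First component of the pair `(φ, ψ)` rotated by the unit complex number `c`:
`c (φ + i ψ) = rotFst c φ ψ + i rotSnd c φ ψ`. -/
def rotFst {N : ℕ} (c : ℂ) (φ ψ : Fin N → ℂ) : Fin N → ℂ :=
  fun n => (c.re : ℂ) * φ n - (c.im : ℂ) * ψ n

/-- Second component of the pair `(φ, ψ)` rotated by the unit complex number `c`. -/
def rotSnd {N : ℕ} (c : ℂ) (φ ψ : Fin N → ℂ) : Fin N → ℂ :=
  fun n => (c.im : ℂ) * φ n + (c.re : ℂ) * ψ n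

end Data

/-- The iterated limit `lim_k lim_N a k N = L`; the inner limits exist for all large `k`. -/
def IteratedLim {E : Type*} [TopologicalSpace E] (a : ℕ → ℕ → E) (L : E) : Prop :=
  ∃ b : ℕ → E, (∀ᶠ k in atTop, Tendsto (a k) atTop (𝓝 (b k))) ∧ Tendsto b atTop (𝓝 L)

end DelayCoherence

end

/-!
The empirical operators on `ℂ^N`, the discretized integral operators and the limit operator live on
different Hilbert spaces, but all of them factor as `R ∘ S` through the same Banach space
`B = C(M, ℂ)`: `S` integrates against the kernel, `R` restricts a continuous function to the
sampled states or to `L²(μ)`. Eigenvectors with nonzero eigenvalue `r` therefore extend to the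
continuous eigenfunctions `r⁻¹ S v`, and uniform convergence on `M` makes sense for all of them.

Both limits, `N → ∞` for fixed `Δt` and `Δt → 0` afterwards, are instances of one notion of
convergence, `SpectralConv`: the inner products `⟨R f, R g⟩` converge (by weak convergence of the
sampling measures in the first limit, and trivially in the second, where `R` is fixed), `S R f`
converges in `B`, and the `S` are collectively compact, which is the Arzelà–Ascoli theorem since the
kernels are uniformly continuous in the first variable on `M`. Under this notion the number of eigenvalues `> r` is lower semicontinuous by the min-max
principle (`SpectralConv.eventually_hasOrthoEig`), and limits of eigenvectors are eigenvectors
(`SpectralConv.hasOrthoEig_limit`), so the `l`-th eigenvalue converges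
(`SpectralConv.exists_tendsto_eigenvalue`). Limits are taken along ultrafilters instead of
subsequences.

If `lam` and `nu` have total multiplicity two, any two real orthonormal pairs of eigenfunctions
differ by an element of `O(2)`. On `f + i g` it acts as a sign change of `g` followed by a
multiplication by a unit complex number (`EigPair.exists_rotation`). Choosing these so as to minimize
the distance to the limit gives `c (f + i s g) → φ + i ψ` in `C(M, ℂ)`
(`SpectralConv.exists_aligned`), and composing the two stages gives the iterated limit
(`exists_aligned_iterated`). The convergence of the features is this statement; the
autocorrelations do not see the phase `c`, and converge with an error that is independent of the lag
because the Koopman operators are isometries.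

For the frequencies, the kernels are Lipschitz along orbits, uniformly in `Δt`
(`exists_kernel_estimates`); the norm of `Y` need not be differentiable, so no better regularity is
available. It suffices: a function that is Lipschitz along orbits belongs to the domain of the
generator by Rademacher's theorem (`exists_hasDerivAt_koopman`), the difference quotients of the
approximating eigenfunctions are bounded, and antisymmetry moves the difference quotient onto the
fixed limit function (`tendsto_inner_difference`). Without the rotation by `c`, the frequency is a
combination of the four values of the bilinear form of the generator on the span of `φ` and `ψ`;
this form is real and antisymmetric, hence rotation invariant (`norm_freqN_sub_le`).
-/

set_option linter.unusedSectionVars false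

noncomputable section

namespace DelayCoherence

/-! ### Eigenvalue counts of compact symmetric operators -/

section Counting

variable {E : Type*} [NormedAddCommGroup E] [InnerProductSpace ℂ E]

/-- `A` has `m` orthonormal eigenvectors whose eigenvalues are real and satisfy `P`. For a compact
symmetric operator and `P = (r < ·)`, `r > 0`, this says that at least `m` eigenvalues exceed `r`,
counted with multiplicity. -/
def HasOrthoEig (A : E →ₗ[ℂ] E) (m : ℕ) (P : ℝ → Prop) : Prop :=
  ∃ e : Fin m → E, Orthonormal ℂ e ∧ ∀ i, ∃ u : ℝ, P u ∧ A (e i) = (u : ℂ) • e i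

theorem HasOrthoEig.imp {A : E →ₗ[ℂ] E} {m : ℕ} {P P' : ℝ → Prop} (h : HasOrthoEig A m P)
    (hP : ∀ u, P u → P' u) : HasOrthoEig A m P' := by
  obtain ⟨e, he, hu⟩ := h
  exact ⟨e, he, fun i => (hu i).imp fun u hu => ⟨hP u hu.1, hu.2⟩⟩

theorem HasOrthoEig.mono {A : E →ₗ[ℂ] E} {m n : ℕ} {P : ℝ → Prop} (h : HasOrthoEig A m P)
    (hn : n ≤ m) : HasOrthoEig A n P := by
  obtain ⟨e, he, hu⟩ := h
  exact ⟨e ∘ Fin.castLE hn, he.comp _ (Fin.castLE_injective hn), fun i => hu _⟩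

/-- The sum of the eigenspaces of `A` for the real eigenvalues satisfying `P`. -/
def eigSum (A : E →ₗ[ℂ] E) (P : ℝ → Prop) : Submodule ℂ E :=
  ⨆ u : {u : ℝ // P u}, Module.End.eigenspace A ((u : ℝ) : ℂ)

theorem mem_eigSum {A : E →ₗ[ℂ] E} {P : ℝ → Prop} {u : ℝ} (hu : P u) {x : E}
    (hx : A x = (u : ℂ) • x) : x ∈ eigSum A P :=
  Submodule.mem_iSup_of_mem (p := fun u : {u : ℝ // P u} => Module.End.eigenspace A ((u : ℝ) : ℂ))
    ⟨u, hu⟩ (Module.End.mem_eigenspace_iff.2 hx)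

theorem inner_eq_zero_of_eig {A : E →ₗ[ℂ] E} (hA : A.IsSymmetric) {u v : ℝ} (huv : u ≠ v)
    {x y : E} (hx : A x = (u : ℂ) • x) (hy : A y = (v : ℂ) • y) : inner ℂ x y = 0 := by
  have h := hA x y
  rw [hx, hy, inner_smul_left, inner_smul_right, Complex.conj_ofReal] at h
  have : ((u : ℂ) - v) * inner ℂ x y = 0 := by rw [sub_mul, h, sub_self]
  refine (mul_eq_zero.1 this).resolve_left ?_
  exact sub_ne_zero.2 (by exact_mod_cast huv)

theorem eigSum_isOrtho {A : E →ₗ[ℂ] E} (hA : A.IsSymmetric) {P P' : ℝ → Prop}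
    (h : ∀ u, P u → ¬ P' u) : eigSum A P ⟂ eigSum A P' := by
  simp only [eigSum, Submodule.isOrtho_iSup_left, Submodule.isOrtho_iSup_right]
  rintro ⟨v, hv⟩ ⟨u, hu⟩
  rw [Submodule.isOrtho_iff_inner_eq]
  intro x hx y hy
  rw [Module.End.mem_eigenspace_iff] at hx hy
  refine inner_eq_zero_of_eig hA (fun huv => ?_) hx hy
  dsimp only at huv
  subst huv
  exact h _ ‹_› ‹_›

/-- Spectral resolution of a vector in a sum of eigenspaces. -/
theorem exists_resolution {A : E →ₗ[ℂ] E} (hA : A.IsSymmetric) {P : ℝ → Prop} {w : E}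
    (hw : w ∈ eigSum A P) : ∃ (s : Finset ℝ) (c : ℝ → ℝ), (∀ u ∈ s, P u) ∧ (∀ u, 0 ≤ c u) ∧
      ‖w‖ ^ 2 = ∑ u ∈ s, c u ∧ (inner ℂ w (A w)).re = ∑ u ∈ s, u * c u ∧
      ‖A w‖ ^ 2 = ∑ u ∈ s, u ^ 2 * c u := by
  classical
  obtain ⟨f, hf, hfw⟩ := (Submodule.mem_iSup_iff_exists_finsupp _ _).1 hw
  have hf' : ∀ u, A (f u) = ((u : ℝ) : ℂ) • f u := fun u => Module.End.mem_eigenspace_iff.1 (hf u)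
  have hS : ∀ g g' : {u : ℝ // P u} → ℝ, inner ℂ (∑ u ∈ f.support, ((g u : ℂ)) • f u)
      (∑ u ∈ f.support, ((g' u : ℂ)) • f u)
      = ((∑ u ∈ f.support, g u * g' u * ‖f u‖ ^ 2 : ℝ) : ℂ) := by
    intro g g'
    rw [sum_inner]
    push_cast
    refine Finset.sum_congr rfl fun u hu => ?_
    rw [inner_sum, Finset.sum_eq_single_of_mem u hu]
    · rw [inner_smul_left, inner_smul_right, Complex.conj_ofReal,
        inner_self_eq_norm_sq_to_K]
      simp only [Complex.coe_algebraMap]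
      ring
    · intro v hv hvu
      rw [inner_smul_left, inner_smul_right,
        inner_eq_zero_of_eig hA (fun h => hvu (Subtype.ext h.symm)) (hf' u) (hf' v)]
      simp
  have h1 : w = ∑ u ∈ f.support, (((1 : ℝ) : ℂ)) • f u := by
    simp only [Complex.ofReal_one, one_smul]; exact hfw.symm
  have h2 : A w = ∑ u ∈ f.support, (((u : ℝ) : ℂ)) • f u := by
    rw [← hfw, Finsupp.sum, map_sum]
    exact Finset.sum_congr rfl fun u _ => hf' u
  have hmap : ∀ g : ℝ → ℝ → ℝ, ∑ u ∈ f.support.map (Function.Embedding.subtype _),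
      g u (if h : P u then ‖f ⟨u, h⟩‖ ^ 2 else 0)
      = ∑ u ∈ f.support, g u (‖f u‖ ^ 2) := by
    intro g
    rw [Finset.sum_map]
    refine Finset.sum_congr rfl fun u _ => ?_
    simp [u.2]
  have hn : ∀ x : E, ‖x‖ ^ 2 = (inner ℂ x x).re := fun x => by
    rw [← inner_self_eq_norm_sq (𝕜 := ℂ)]; rfl
  refine ⟨f.support.map (Function.Embedding.subtype _),
    fun u => if h : P u then ‖f ⟨u, h⟩‖ ^ 2 else 0, ?_, ?_, ?_, ?_, ?_⟩
  · intro u hu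
    obtain ⟨v, -, rfl⟩ := Finset.mem_map.1 hu
    exact v.2
  · intro u
    dsimp only
    split_ifs <;> positivity
  · rw [hmap (fun _ x => x), hn, h1, hS, Complex.ofReal_re]
    simp
  · rw [hmap (fun u x => u * x), h2]
    nth_rewrite 1 [h1]
    rw [hS, Complex.ofReal_re]
    simp
  · rw [hmap (fun u x => u ^ 2 * x), hn, h2, hS, Complex.ofReal_re]
    exact Finset.sum_congr rfl fun u _ => by ring

/-- The sum of the eigenspaces is invariant, and the eigenvector basis of the restriction consists
of eigenvectors with eigenvalues satisfying `P`, because other eigenvectors are orthogonal to the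
sum. -/
theorem hasOrthoEig_of_le_finrank {A : E →ₗ[ℂ] E} (hA : A.IsSymmetric) {m : ℕ} {P : ℝ → Prop}
    (hm : m ≤ Module.finrank ℂ (eigSum A P)) : HasOrthoEig A m P := by
  rcases Nat.eq_zero_or_pos m with rfl | hpos
  · exact ⟨Fin.elim0, ⟨fun i => i.elim0, fun i => i.elim0⟩, fun i => i.elim0⟩
  have hfin : FiniteDimensional ℂ (eigSum A P) := Module.finite_of_finrank_pos (hpos.trans_le hm)
  have hinv : ∀ x ∈ eigSum A P, A x ∈ eigSum A P := by
    intro x hx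
    refine Submodule.iSup_induction _ (motive := fun x => A x ∈ eigSum A P) hx ?_ (by simp) ?_
    · rintro ⟨u, hu⟩ x hx
      rw [Module.End.mem_eigenspace_iff] at hx
      rw [hx]
      exact Submodule.smul_mem _ _ (mem_eigSum hu hx)
    · intro x y hx hy
      rw [map_add]
      exact Submodule.add_mem _ hx hy
  obtain ⟨b, ev, hb⟩ : ∃ (b : OrthonormalBasis (Fin (Module.finrank ℂ (eigSum A P))) ℂ (eigSum A P))
      (ev : Fin (Module.finrank ℂ (eigSum A P)) → ℝ), ∀ i, A (b i : E) = (ev i : ℂ) • (b i : E) :=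
    ⟨(hA.restrict_invariant hinv).eigenvectorBasis rfl, _, fun i =>
      congrArg Subtype.val ((hA.restrict_invariant hinv).apply_eigenvectorBasis rfl i)⟩
  have hbo : Orthonormal ℂ fun i => (b i : E) :=
    b.orthonormal.comp_linearIsometry (eigSum A P).subtypeₗᵢ
  refine HasOrthoEig.mono ⟨fun i => (b i : E), hbo, fun i => ⟨ev i, ?_, hb i⟩⟩ hm
  by_contra hP
  have hmem : (b i : E) ∈ eigSum A (fun u => u = ev i) :=
    mem_eigSum (P := fun u => u = ev i) rfl (hb i)
  have hort : eigSum A P ⟂ eigSum A (fun u => u = ev i) :=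
    eigSum_isOrtho hA (by rintro u hu rfl; exact hP hu)
  have h0 := Submodule.isOrtho_iff_inner_eq.1 hort _ (b i).2 _ hmem
  rw [inner_self_eq_zero] at h0
  have : ‖(b i : E)‖ = 1 := hbo.1 i
  rw [h0, norm_zero] at this
  exact zero_ne_one this

theorem HasOrthoEig.le_finrank {A : E →ₗ[ℂ] E} {m : ℕ} {P : ℝ → Prop}
    (h : HasOrthoEig A m P) [FiniteDimensional ℂ (eigSum A P)] :
    m ≤ Module.finrank ℂ (eigSum A P) := by
  obtain ⟨e, he, hu⟩ := h
  choose u hPu hu using hu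
  have hli : LinearIndependent ℂ fun i => (⟨e i, mem_eigSum (hPu i) (hu i)⟩ : eigSum A P) := by
    refine LinearIndependent.of_comp (eigSum A P).subtype ?_
    exact he.linearIndependent
  simpa using hli.fintype_card_le_finrank

/-- A compact operator has finite total multiplicity above a positive level: it is bounded below by
`r` on the closure of the sum of these eigenspaces, whose unit ball is therefore compact. -/
theorem finiteDimensional_eigSum [CompleteSpace E] {A : E →L[ℂ] E} (hA : (A : E →ₗ[ℂ] E).IsSymmetric)
    (hc : IsCompactOperator A) {r : ℝ} (hr : 0 < r) {P : ℝ → Prop} (hP : ∀ u, P u → r ≤ u) :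
    FiniteDimensional ℂ (eigSum (A : E →ₗ[ℂ] E) P) := by
  set W := (eigSum (A : E →ₗ[ℂ] E) P).topologicalClosure with hW
  have hb : ∀ w ∈ W, r * ‖w‖ ≤ ‖A w‖ := by
    have hcl : IsClosed {w : E | r * ‖w‖ ≤ ‖A w‖} := isClosed_le (by fun_prop) (by fun_prop)
    refine fun w hw => closure_minimal (fun x hx => ?_) hcl hw
    obtain ⟨s, c, hs, hc0, h1, -, h3⟩ := exists_resolution hA hx
    refine le_of_sq_le_sq ?_ (norm_nonneg _)
    rw [mul_pow, h1, ← ContinuousLinearMap.coe_coe, h3, Finset.mul_sum]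
    refine Finset.sum_le_sum fun u hu => mul_le_mul_of_nonneg_right ?_ (hc0 u)
    exact pow_le_pow_left₀ hr.le (hP u (hs u hu)) 2
  have hWc : IsClosed (W : Set E) := Submodule.isClosed_topologicalClosure _
  have : CompleteSpace W := hWc.completeSpace_coe
  let B : W →L[ℂ] E := A.comp W.subtypeL
  have hanti : AntilipschitzWith (Real.toNNReal r⁻¹) B := by
    refine B.antilipschitz_of_bound fun w => ?_
    rw [Real.coe_toNNReal _ (by positivity), inv_mul_eq_div, le_div_iff₀ hr, mul_comm]
    exact hb w w.2
  have hemb := hanti.isClosedEmbedding B.uniformContinuous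
  obtain ⟨K, hK, hKb⟩ := IsCompactOperator.image_closedBall_subset_compact (f := (A : E →ₗ[ℂ] E)) hc 1
  have hcpt : IsCompact (Metric.closedBall (0 : W) 1) := by
    refine (hemb.isCompact_preimage hK).of_isClosed_subset Metric.isClosed_closedBall ?_
    intro w hw
    refine hKb ⟨w, ?_, rfl⟩
    simpa using hw
  have : FiniteDimensional ℂ W := FiniteDimensional.of_isCompact_closedBall ℂ one_pos hcpt
  exact Submodule.finiteDimensional_of_le (Submodule.le_topologicalClosure _)

/-- By the spectral theorem, the orthogonal complement of the eigenspaces above `r` lies in the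
closure of the sum of the remaining ones. The eigenspace of `0` and negative eigenvalues need no
separate treatment. -/
theorem re_inner_le_of_mem_eigSum_orthogonal [CompleteSpace E] {A : E →L[ℂ] E}
    (hA : (A : E →ₗ[ℂ] E).IsSymmetric) (hc : IsCompactOperator A) {r : ℝ}
    [FiniteDimensional ℂ (eigSum (A : E →ₗ[ℂ] E) (r < ·))] {w : E}
    (hw : w ∈ (eigSum (A : E →ₗ[ℂ] E) (r < ·))ᗮ) : (inner ℂ w (A w)).re ≤ r * ‖w‖ ^ 2 := by
  set P := eigSum (A : E →ₗ[ℂ] E) (r < ·) with hP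
  set N := eigSum (A : E →ₗ[ℂ] E) (· ≤ r) with hN
  have hPN : P ⟂ N := eigSum_isOrtho hA fun u hu => not_le.2 hu
  have htop : (P ⊔ N)ᗮ = ⊥ := by
    rw [eq_bot_iff, ← A.orthogonalComplement_iSup_eigenspaces_eq_bot hc hA]
    refine Submodule.orthogonal_le (iSup_le fun z => ?_)
    intro x hx
    by_cases hx0 : x = 0
    · rw [hx0]; exact Submodule.zero_mem _
    have hz : Module.End.HasEigenvalue (A : E →ₗ[ℂ] E) z :=
      Module.End.hasEigenvalue_of_hasEigenvector ⟨hx, hx0⟩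
    have hzr : ((z.re : ℝ) : ℂ) = z := Complex.conj_eq_iff_re.1 (hA.conj_eigenvalue_eq_self hz)
    have hx' : (A : E →ₗ[ℂ] E) x = ((z.re : ℝ) : ℂ) • x := by
      rw [hzr]; exact Module.End.mem_eigenspace_iff.1 hx
    rcases lt_or_ge r z.re with h | h
    · exact Submodule.mem_sup_left (mem_eigSum (P := (r < ·)) h hx')
    · exact Submodule.mem_sup_right (mem_eigSum (P := (· ≤ r)) h hx')
  have hwN : w ∈ N.topologicalClosure := by
    rw [← Submodule.orthogonal_orthogonal_eq_closure, Submodule.mem_orthogonal]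
    intro y hy
    obtain ⟨p, hp, q, hq, rfl⟩ := P.exists_add_mem_mem_orthogonal y
    have hpN : p ∈ Nᗮ := hPN.le hp
    have hqN : q ∈ Nᗮ := by simpa using Submodule.sub_mem _ hy hpN
    have : q ∈ (P ⊔ N)ᗮ := by
      rw [← Submodule.inf_orthogonal]
      exact ⟨hq, hqN⟩
    rw [htop, Submodule.mem_bot] at this
    rw [this, add_zero]
    exact (Submodule.mem_orthogonal _ _).1 hw p hp
  have hcl : IsClosed {w : E | (inner ℂ w (A w)).re ≤ r * ‖w‖ ^ 2} :=
    isClosed_le (by fun_prop) (by fun_prop)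
  refine closure_minimal (fun x hx => ?_) hcl hwN
  obtain ⟨s, c, hs, hc0, h1, h2, -⟩ := exists_resolution hA hx
  change (inner ℂ x ((A : E →ₗ[ℂ] E) x)).re ≤ r * ‖x‖ ^ 2
  rw [h1, h2, Finset.mul_sum]
  exact Finset.sum_le_sum fun u hu => mul_le_mul_of_nonneg_right (hs u hu) (hc0 u)

/-- The min-max principle: if the quadratic form of `A` exceeds `r > 0` on an `m`-dimensional
space, then at least `m` eigenvalues of `A` exceed `r`. -/
theorem hasOrthoEig_of_form [CompleteSpace E] {A : E →L[ℂ] E}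
    (hA : (A : E →ₗ[ℂ] E).IsSymmetric) (hc : IsCompactOperator A) {r : ℝ} (hr : 0 < r) {m : ℕ}
    (J : EuclideanSpace ℂ (Fin m) →ₗ[ℂ] E)
    (hJ : ∀ x, x ≠ 0 → r * ‖J x‖ ^ 2 < (inner ℂ (J x) (A (J x))).re) :
    HasOrthoEig (A : E →ₗ[ℂ] E) m (r < ·) := by
  have : FiniteDimensional ℂ (eigSum (A : E →ₗ[ℂ] E) (r < ·)) :=
    finiteDimensional_eigSum hA hc hr fun u hu => le_of_lt hu
  refine hasOrthoEig_of_le_finrank hA ?_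
  by_contra! hlt
  let p : EuclideanSpace ℂ (Fin m) →ₗ[ℂ] eigSum (A : E →ₗ[ℂ] E) (r < ·) :=
    ((eigSum (A : E →ₗ[ℂ] E) (r < ·)).orthogonalProjectionOnto : E →ₗ[ℂ] _) ∘ₗ J
  have hker : LinearMap.ker p ≠ ⊥ := LinearMap.ker_ne_bot_of_finrank_lt (by simpa using hlt)
  obtain ⟨x, hx, hx0⟩ := (Submodule.ne_bot_iff _).1 hker
  refine absurd (hJ x hx0) (not_lt.2 (re_inner_le_of_mem_eigSum_orthogonal hA hc ?_))
  rw [← Submodule.orthogonalProjectionOnto_eq_zero_iff]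
  exact hx

/-- `r` is the `j`-th eigenvalue of `A` (counted from `0`, in decreasing order with multiplicity),
expressed through orthonormal eigenvectors. In contrast to `IsNthEigenvalue`, which refers to
dimensions, this passes directly to limits of operators. -/
def IsNthOrtho (A : E →ₗ[ℂ] E) (j : ℕ) (r : ℝ) : Prop :=
  ¬ HasOrthoEig A (j + 1) (r < ·) ∧ HasOrthoEig A (j + 1) (r ≤ ·)

theorem IsNthOrtho.eq {A : E →ₗ[ℂ] E} {j : ℕ} {r r' : ℝ} (h : IsNthOrtho A j r)
    (h' : IsNthOrtho A j r') : r = r' := by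
  rcases lt_trichotomy r r' with hlt | heq | hlt
  · exact absurd (h'.2.imp fun u hu => hlt.trans_le hu) h.1
  · exact heq
  · exact absurd (h.2.imp fun u hu => hlt.trans_le hu) h'.1

theorem IsNthOrtho.anti {A : E →ₗ[ℂ] E} {j l : ℕ} {r r' : ℝ} (h : IsNthOrtho A l r)
    (h' : IsNthOrtho A j r') (hjl : j ≤ l) : r ≤ r' :=
  not_lt.1 fun hlt => h'.1 ((h.2.mono (by omega)).imp fun _ hu => hlt.trans_le hu)

/-- The strict count in `IsNthEigenvalue` forces the span of the eigenspaces to be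
finite-dimensional, so that no junk value of `finrank` interferes. -/
theorem IsNthEigenvalue.isNthOrtho {A : E →ₗ[ℂ] E} (hA : A.IsSymmetric) {j : ℕ} {r : ℝ}
    (h : IsNthEigenvalue A j r) : IsNthOrtho A j r := by
  have h1 : FiniteDimensional ℂ (eigSum A (r ≤ ·)) :=
    Module.finite_of_finrank_pos (Nat.zero_lt_of_lt h.2)
  have h2 : eigSum A (r < ·) ≤ eigSum A (r ≤ ·) :=
    iSup_le fun u => le_iSup (fun u : {u : ℝ // r ≤ u} => Module.End.eigenspace A ((u : ℝ) : ℂ))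
      ⟨u, u.2.le⟩
  have := Submodule.finiteDimensional_of_le h2
  exact ⟨fun hm => absurd hm.le_finrank (not_le.2 (Nat.lt_succ_of_le h.1)),
    hasOrthoEig_of_le_finrank hA h.2⟩

end Counting

/-! ### Spectral convergence of factorized operators -/

section Convergence

variable {ι : Type*} {B : Type*} [NormedAddCommGroup B] [NormedSpace ℂ B]
  {H : ι → Type*} [∀ i, NormedAddCommGroup (H i)] [∀ i, InnerProductSpace ℂ (H i)]
  {H₀ : Type*} [NormedAddCommGroup H₀] [InnerProductSpace ℂ H₀]

/-- Convergence of the operators `R i ∘ S i` on varying Hilbert spaces `H i` to `R₀ ∘ S₀` on `H₀`.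
All operators factor through the same Banach space `B`, in which eigenvectors of different operators
can be compared. `compact` is a collective compactness of the `S i`; ultrafilters replace
subsequences. -/
structure SpectralConv (L : Filter ι) (R : ∀ i, B →L[ℂ] H i) (S : ∀ i, H i →L[ℂ] B)
    (R₀ : B →L[ℂ] H₀) (S₀ : H₀ →L[ℂ] B) (C : ℝ) : Prop where
  inner_R : ∀ f g, Tendsto (fun i => inner ℂ (R i f) (R i g)) L (𝓝 (inner ℂ (R₀ f) (R₀ g)))
  norm_R : ∀ i f, ‖R i f‖ ≤ ‖f‖
  norm_S : ∀ i v, ‖S i v‖ ≤ C * ‖v‖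
  compact : ∀ w : (i : ι) → H i, (∀ i, ‖w i‖ ≤ 1) → ∀ U : Ultrafilter ι, ↑U ≤ L →
    ∃ p, Tendsto (fun i => S i (w i)) U (𝓝 p)
  consistent : ∀ f, Tendsto (fun i => S i (R i f)) L (𝓝 (S₀ (R₀ f)))

namespace SpectralConv

variable {L : Filter ι} {R : ∀ i, B →L[ℂ] H i} {S : ∀ i, H i →L[ℂ] B}
    {R₀ : B →L[ℂ] H₀} {S₀ : H₀ →L[ℂ] B} {C : ℝ}

theorem tendsto_inner (hS : SpectralConv L R S R₀ S₀ C) {F : Filter ι} (hF : F ≤ L)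
    {f g : ι → B} {f₀ g₀ : B} (hf : Tendsto f F (𝓝 f₀)) (hg : Tendsto g F (𝓝 g₀)) :
    Tendsto (fun i => inner ℂ (R i (f i)) (R i (g i))) F (𝓝 (inner ℂ (R₀ f₀) (R₀ g₀))) := by
  have h1 := (hS.inner_R f₀ g₀).mono_left hF
  have h2 : Tendsto (fun i => ‖f i - f₀‖ * ‖g i‖ + ‖f₀‖ * ‖g i - g₀‖) F (𝓝 0) := by
    have := ((hf.sub_const f₀).norm.mul hg.norm).add ((hg.sub_const g₀).norm.const_mul ‖f₀‖)
    simpa using this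
  have h3 : Tendsto (fun i => inner ℂ (R i (f i)) (R i (g i)) - inner ℂ (R i f₀) (R i g₀)) F
      (𝓝 0) := by
    refine squeeze_zero_norm (fun i => ?_) h2
    have : inner ℂ (R i (f i)) (R i (g i)) - inner ℂ (R i f₀) (R i g₀)
        = inner ℂ (R i (f i - f₀)) (R i (g i)) + inner ℂ (R i f₀) (R i (g i - g₀)) := by
      rw [map_sub, map_sub, inner_sub_left, inner_sub_right]
      ring
    rw [this]
    refine (norm_add_le _ _).trans (add_le_add ?_ ?_)
    · exact (norm_inner_le_norm _ _).trans
        (mul_le_mul (hS.norm_R i _) (hS.norm_R i _) (norm_nonneg _) (norm_nonneg _))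
    · exact (norm_inner_le_norm _ _).trans
        (mul_le_mul (hS.norm_R i _) (hS.norm_R i _) (norm_nonneg _) (norm_nonneg _))
  simpa using h3.add h1

theorem tendsto_apply (hS : SpectralConv L R S R₀ S₀ C) (hC : 0 ≤ C) {F : Filter ι} (hF : F ≤ L)
    {f : ι → B} {f₀ : B} (hf : Tendsto f F (𝓝 f₀)) :
    Tendsto (fun i => S i (R i (f i))) F (𝓝 (S₀ (R₀ f₀))) := by
  have h1 := (hS.consistent f₀).mono_left hF
  have h2 : Tendsto (fun i => C * ‖f i - f₀‖) F (𝓝 0) := by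
    simpa using (hf.sub_const f₀).norm.const_mul C
  have h3 : Tendsto (fun i => S i (R i (f i)) - S i (R i f₀)) F (𝓝 0) := by
    refine squeeze_zero_norm (fun i => ?_) h2
    rw [← map_sub, ← map_sub]
    exact (hS.norm_S i _).trans (mul_le_mul_of_nonneg_left (hS.norm_R i _) hC)
  simpa using h3.add h1

theorem exists_tendsto (hS : SpectralConv L R S R₀ S₀ C) {U : Ultrafilter ι} (hU : ↑U ≤ L)
    {w : (i : ι) → H i} (hw : ∀ᶠ i in U, ‖w i‖ ≤ 1) :
    ∃ p, Tendsto (fun i => S i (w i)) U (𝓝 p) := by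
  classical
  obtain ⟨p, hp⟩ := hS.compact (fun i => if ‖w i‖ ≤ 1 then w i else 0)
    (fun i => by split_ifs with h <;> simp [h]) U hU
  refine ⟨p, hp.congr' ?_⟩
  filter_upwards [hw] with i hi
  rw [if_pos hi]

/-- Limits, in `B`, of normalized eigenvectors for eigenvalues staying away from `0` are
eigenvectors. -/
theorem exists_eigenvector_limit (hS : SpectralConv L R S R₀ S₀ C) (hC : 0 ≤ C)
    {U : Ultrafilter ι} (hU : ↑U ≤ L) {w : (i : ι) → H i} {r : ι → ℝ} {r₀ : ℝ}
    (hw : ∀ᶠ i in U, ‖w i‖ = 1 ∧ R i (S i (w i)) = (r i : ℂ) • w i)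
    (hr : Tendsto r U (𝓝 r₀)) (hr₀ : r₀ ≠ 0) :
    ∃ f, Tendsto (fun i => ((r i : ℂ))⁻¹ • S i (w i)) U (𝓝 f) ∧ S₀ (R₀ f) = (r₀ : ℂ) • f ∧
      ∀ᶠ i in U, R i (((r i : ℂ))⁻¹ • S i (w i)) = w i := by
  obtain ⟨p, hp⟩ := hS.exists_tendsto hU (hw.mono fun i hi => hi.1.le)
  have hr₀' : (r₀ : ℂ) ≠ 0 := by exact_mod_cast hr₀
  have hrc : Tendsto (fun i => (r i : ℂ)) U (𝓝 (r₀ : ℂ)) :=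
    (Complex.continuous_ofReal.tendsto r₀).comp hr
  have hf := (hrc.inv₀ hr₀').smul hp
  have hne : ∀ᶠ i in U, R i (((r i : ℂ))⁻¹ • S i (w i)) = w i := by
    filter_upwards [hw, hr.eventually_ne hr₀] with i hi hne
    have : (r i : ℂ) ≠ 0 := by exact_mod_cast hne
    rw [map_smul, hi.2, inv_smul_smul₀ this]
  refine ⟨_, hf, ?_, hne⟩
  have h1 := hS.tendsto_apply hC hU hf
  have h2 : Tendsto (fun i => S i (R i (((r i : ℂ))⁻¹ • S i (w i)))) U (𝓝 p) := by
    refine hp.congr' ?_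
    filter_upwards [hne] with i hi
    rw [hi]
  rw [tendsto_nhds_unique h1 h2, smul_inv_smul₀ hr₀']

/-- Lower semicontinuity of the number of eigenvalues above a positive level. -/
theorem eventually_hasOrthoEig [∀ i, CompleteSpace (H i)] (hS : SpectralConv L R S R₀ S₀ C)
    (hC : 0 ≤ C)
    (hsym : ∀ i, ((R i).comp (S i) : H i →ₗ[ℂ] H i).IsSymmetric)
    (hcpt : ∀ i, IsCompactOperator ((R i).comp (S i))) {m : ℕ} {r : ℝ} (hr : 0 < r)
    (h : HasOrthoEig (R₀.comp S₀ : H₀ →ₗ[ℂ] H₀) m (r < ·)) :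
    ∀ᶠ i in L, HasOrthoEig ((R i).comp (S i) : H i →ₗ[ℂ] H i) m (r < ·) := by
  obtain ⟨e, he, hu⟩ := h
  choose u hru hu using hu
  have hu' : ∀ j, R₀ (S₀ (e j)) = (u j : ℂ) • e j := hu
  have hu0 : ∀ j, (u j : ℂ) ≠ 0 := fun j => by exact_mod_cast (hr.trans (hru j)).ne'
  let f : Fin m → B := fun j => ((u j : ℂ))⁻¹ • S₀ (e j)
  have hRf : ∀ j, R₀ (f j) = e j := fun j => by
    simp only [f]
    rw [map_smul, hu', inv_smul_smul₀ (hu0 j)]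
  let J : EuclideanSpace ℂ (Fin m) →ₗ[ℂ] B :=
    (Fintype.linearCombination ℂ f) ∘ₗ (WithLp.linearEquiv 2 ℂ (Fin m → ℂ)).toLinearMap
  have hJ : ∀ x, J x = ∑ j, x j • f j := fun x => by
    simp [J, Fintype.linearCombination_apply]
  have hJc : Continuous J := J.continuous_of_finiteDimensional
  refine mem_iff_ultrafilter.2 fun U hUL => ?_
  by_contra hcon
  -- otherwise unit coefficient vectors violating the form bound exist along some ultrafilter
  have hUx : ∀ᶠ i in (U : Filter ι), ∃ x : EuclideanSpace ℂ (Fin m), ‖x‖ = 1 ∧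
      (inner ℂ (R i (J x)) (R i (S i (R i (J x))))).re ≤ r * ‖R i (J x)‖ ^ 2 := by
    refine (Ultrafilter.eventually_not.2 hcon).mono fun i hi => ?_
    by_contra hx
    push Not at hx
    refine hi (hasOrthoEig_of_form (hsym i) (hcpt i) hr ((R i : B →ₗ[ℂ] H i) ∘ₗ J) ?_)
    intro x hx0
    have hxn : (‖x‖ : ℂ) ≠ 0 := by exact_mod_cast norm_ne_zero_iff.2 hx0
    have h1 := hx (((‖x‖ : ℂ))⁻¹ • x) (by
      rw [norm_smul, norm_inv, Complex.norm_real, norm_norm,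
        inv_mul_cancel₀ (norm_ne_zero_iff.2 hx0)])
    simp only [map_smul, norm_smul, inner_smul_left, inner_smul_right, norm_inv,
      Complex.norm_real, norm_norm, ← Complex.ofReal_inv, Complex.conj_ofReal,
      Complex.re_ofReal_mul] at h1
    have hpos : 0 < ‖x‖⁻¹ ^ 2 := by
      have := norm_pos_iff.2 hx0
      positivity
    have h2 : ‖x‖⁻¹ ^ 2 * (r * ‖R i (J x)‖ ^ 2)
        < ‖x‖⁻¹ ^ 2 * (inner ℂ (R i (J x)) (R i (S i (R i (J x))))).re := by
      calc _ = r * (‖x‖⁻¹ * ‖R i (J x)‖) ^ 2 := by ring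
        _ < _ := h1
        _ = _ := by ring
    exact lt_of_mul_lt_mul_left h2 hpos.le
  obtain ⟨x, hx⟩ : ∃ x : ι → EuclideanSpace ℂ (Fin m), ∀ᶠ i in U, ‖x i‖ = 1 ∧
      (inner ℂ (R i (J (x i))) (R i (S i (R i (J (x i)))))).re ≤ r * ‖R i (J (x i))‖ ^ 2 := by
    classical
    refine ⟨fun i => if h : ∃ x : EuclideanSpace ℂ (Fin m), ‖x‖ = 1 ∧
      (inner ℂ (R i (J x)) (R i (S i (R i (J x))))).re ≤ r * ‖R i (J x)‖ ^ 2
        then h.choose else 0, ?_⟩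
    filter_upwards [hUx] with i hi
    rw [dif_pos hi]
    exact hi.choose_spec
  obtain ⟨y, hy, hxy⟩ : ∃ y ∈ Metric.sphere (0 : EuclideanSpace ℂ (Fin m)) 1,
      Tendsto x U (𝓝 y) :=
    (isCompact_sphere _ _).ultrafilter_le_nhds (U.map x) (by
      rw [le_principal_iff]
      change ∀ᶠ i in (U : Filter ι), x i ∈ Metric.sphere 0 1
      filter_upwards [hx] with i hi
      simpa using hi.1)
  have hJx : Tendsto (fun i => J (x i)) U (𝓝 (J y)) := (hJc.tendsto y).comp hxy
  have l1 := hS.tendsto_inner hUL hJx (hS.tendsto_apply hC hUL hJx)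
  have l2 := hS.tendsto_inner hUL hJx hJx
  have hlim : (inner ℂ (R₀ (J y)) (R₀ (S₀ (R₀ (J y))))).re
      ≤ r * (inner ℂ (R₀ (J y)) (R₀ (J y))).re := by
    refine le_of_tendsto_of_tendsto ((Complex.continuous_re.tendsto _).comp l1)
      (((Complex.continuous_re.tendsto _).comp l2).const_mul r) ?_
    filter_upwards [hx] with i hi
    refine hi.2.trans (le_of_eq ?_)
    simp only [Function.comp]
    rw [← inner_self_eq_norm_sq (𝕜 := ℂ)]
    rfl
  have hRJ : R₀ (J y) = ∑ j, y j • e j := by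
    rw [hJ, map_sum]
    exact Finset.sum_congr rfl fun j _ => by rw [map_smul, hRf]
  have hKJ : R₀ (S₀ (R₀ (J y))) = ∑ j, (y j * u j) • e j := by
    rw [hRJ, map_sum, map_sum]
    exact Finset.sum_congr rfl fun j _ => by rw [map_smul, map_smul, hu', smul_smul]
  rw [hKJ, hRJ, he.inner_sum, he.inner_sum, Complex.re_sum, Complex.re_sum, Finset.mul_sum] at hlim
  have hterm : ∀ j, ((starRingEnd ℂ) (y j) * (y j * u j)).re = u j * ‖y j‖ ^ 2 := fun j => by
    rw [← mul_assoc, Complex.conj_mul', mul_comm, ← Complex.ofReal_pow, Complex.re_ofReal_mul,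
      Complex.ofReal_re]
  have hterm' : ∀ j, ((starRingEnd ℂ) (y j) * y j).re = ‖y j‖ ^ 2 := fun j => by
    rw [Complex.conj_mul', ← Complex.ofReal_pow, Complex.ofReal_re]
  simp only [hterm, hterm'] at hlim
  obtain ⟨j, hj⟩ : ∃ j, y j ≠ 0 := by
    by_contra! h0
    have : y = 0 := by ext j; simpa using h0 j
    simp [this] at hy
  refine absurd hlim (not_le.2 (Finset.sum_lt_sum (fun j _ => ?_) ⟨j, Finset.mem_univ j, ?_⟩))
  · exact mul_le_mul_of_nonneg_right (hru j).le (by positivity)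
  · have := norm_pos_iff.2 hj
    exact mul_lt_mul_of_pos_right (hru j) (by positivity)

/-- Upper semicontinuity: orthonormal systems of eigenvectors pass to the limit, for eigenvalues
accumulating away from `0`. -/
theorem hasOrthoEig_limit (hS : SpectralConv L R S R₀ S₀ C) (hC : 0 ≤ C)
    {U : Ultrafilter ι} (hU : ↑U ≤ L) {m : ℕ} {P : ι → ℝ → Prop} {P₀ : ℝ → Prop}
    (h : ∀ᶠ i in U, HasOrthoEig ((R i).comp (S i) : H i →ₗ[ℂ] H i) m (P i))
    (hP : ∀ u : ι → ℝ, (∀ᶠ i in U, P i (u i) ∧ u i ≤ C) →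
      ∃ u₀, u₀ ≠ 0 ∧ P₀ u₀ ∧ Tendsto u U (𝓝 u₀)) :
    HasOrthoEig (R₀.comp S₀ : H₀ →ₗ[ℂ] H₀) m P₀ := by
  classical
  obtain ⟨e, u, he⟩ : ∃ (e : (i : ι) → Fin m → H i) (u : (i : ι) → Fin m → ℝ), ∀ᶠ i in U,
      Orthonormal ℂ (e i) ∧ ∀ j, P i (u i j) ∧ R i (S i (e i j)) = (u i j : ℂ) • e i j := by
    have : ∀ i, ∃ (e : Fin m → H i) (u : Fin m → ℝ),
        HasOrthoEig ((R i).comp (S i) : H i →ₗ[ℂ] H i) m (P i) →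
        Orthonormal ℂ e ∧ ∀ j, P i (u j) ∧ R i (S i (e j)) = (u j : ℂ) • e j := by
      intro i
      by_cases hi : HasOrthoEig ((R i).comp (S i) : H i →ₗ[ℂ] H i) m (P i)
      · obtain ⟨e, he, hu⟩ := hi
        choose u hu using hu
        exact ⟨e, u, fun _ => ⟨he, hu⟩⟩
      · exact ⟨0, 0, fun h => absurd h hi⟩
    choose e u he using this
    exact ⟨e, u, h.mono fun i hi => he i hi⟩
  have hlim : ∀ j, ∃ u₀, u₀ ≠ 0 ∧ P₀ u₀ ∧ Tendsto (fun i => u i j) U (𝓝 u₀) := by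
    intro j
    refine hP _ (he.mono fun i hi => ⟨(hi.2 j).1, ?_⟩)
    have h1 : ‖R i (S i (e i j))‖ ≤ C := by
      refine (hS.norm_R i _).trans ((hS.norm_S i _).trans ?_)
      rw [hi.1.1 j, mul_one]
    rw [(hi.2 j).2, norm_smul, hi.1.1 j, mul_one, Complex.norm_real] at h1
    exact (le_abs_self _).trans h1
  choose u₀ hu0 hPu hu using hlim
  choose f hf hfe hfw using fun j => hS.exists_eigenvector_limit hC hU
    (he.mono fun i hi => ⟨hi.1.1 j, (hi.2 j).2⟩) (hu j) (hu0 j)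
  refine ⟨fun j => R₀ (f j), ?_, fun j => ⟨u₀ j, hPu j, ?_⟩⟩
  · rw [orthonormal_iff_ite]
    intro j k
    refine tendsto_nhds_unique (hS.tendsto_inner hU (hf j) (hf k)) (tendsto_const_nhds.congr' ?_)
    filter_upwards [he, hfw j, hfw k] with i hi hj hk
    rw [hj, hk, orthonormal_iff_ite.1 hi.1]
  · change R₀ (S₀ (R₀ (f j))) = _
    rw [hfe j, map_smul]

/-- The `l`-th eigenvalues converge, provided that the limit has more than `l` eigenvalues above
some positive level. The existence of the `l`-th eigenvalue of the limit is part of the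
conclusion. -/
theorem exists_tendsto_eigenvalue [∀ i, CompleteSpace (H i)] [L.NeBot]
    (hS : SpectralConv L R S R₀ S₀ C) (hC : 0 ≤ C)
    (hsym : ∀ i, ((R i).comp (S i) : H i →ₗ[ℂ] H i).IsSymmetric)
    (hcpt : ∀ i, IsCompactOperator ((R i).comp (S i))) {l : ℕ} {r₀ : ℝ} (hr₀ : 0 < r₀)
    (h₀ : HasOrthoEig (R₀.comp S₀ : H₀ →ₗ[ℂ] H₀) (l + 1) (r₀ < ·)) {r : ι → ℝ}
    (hr : ∀ᶠ i in L, IsNthOrtho ((R i).comp (S i) : H i →ₗ[ℂ] H i) l (r i)) :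
    ∃ r', r₀ ≤ r' ∧ IsNthOrtho (R₀.comp S₀ : H₀ →ₗ[ℂ] H₀) l r' ∧ Tendsto r L (𝓝 r') := by
  have hlow : ∀ᶠ i in L, r i ∈ Icc r₀ C := by
    filter_upwards [hr, hS.eventually_hasOrthoEig hC hsym hcpt hr₀ h₀] with i hi hi'
    refine ⟨?_, ?_⟩
    · by_contra! hlt
      exact hi.1 (hi'.imp fun u hu => hlt.trans hu)
    · obtain ⟨e, he, hu⟩ := hi.2
      obtain ⟨u, hru, hu⟩ := hu 0
      have h1 : ‖R i (S i (e 0))‖ ≤ C := by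
        refine (hS.norm_R i _).trans ((hS.norm_S i _).trans ?_)
        rw [he.1 0, mul_one]
      have hu' : R i (S i (e 0)) = (u : ℂ) • e 0 := hu
      rw [hu', norm_smul, he.1 0, mul_one, Complex.norm_real] at h1
      exact hru.trans ((le_abs_self _).trans h1)
  -- the limit along any ultrafilter is the `l`-th eigenvalue of the limit operator, so that all these
  -- limits agree
  have key : ∀ U : Ultrafilter ι, ↑U ≤ L → ∃ r', r₀ ≤ r' ∧
      IsNthOrtho (R₀.comp S₀ : H₀ →ₗ[ℂ] H₀) l r' ∧ Tendsto r U (𝓝 r') := by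
    intro U hU
    obtain ⟨r', hr', hlim⟩ := isCompact_Icc.ultrafilter_le_nhds (U.map r)
      (le_principal_iff.2 (hU hlow))
    replace hlim : Tendsto r U (𝓝 r') := hlim
    refine ⟨r', hr'.1, ⟨fun hgt => ?_, ?_⟩, hlim⟩
    · -- finitely many eigenvalues above `r'` stay above some `r'' > r'`
      obtain ⟨e, he, hu⟩ := hgt
      choose u hru hu using hu
      obtain ⟨r'', h1, h2⟩ : ∃ r'', r' < r'' ∧ ∀ j, r'' < u j := by
        obtain ⟨j₀, -, hj₀⟩ := Finset.exists_min_image Finset.univ u ⟨0, Finset.mem_univ _⟩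
        obtain ⟨x, hx1, hx2⟩ := exists_between (hru j₀)
        exact ⟨x, hx1, fun j => hx2.trans_le (hj₀ j (Finset.mem_univ j))⟩
      have h3 := hS.eventually_hasOrthoEig hC hsym hcpt ((hr₀.trans_le hr'.1).trans h1)
        (m := l + 1) ⟨e, he, fun j => ⟨u j, h2 j, hu j⟩⟩
      have h4 : ∀ᶠ i in (U : Filter ι), r i < r'' := hlim.eventually_lt_const h1
      obtain ⟨i, hi1, hi2, hi3⟩ := ((h3.filter_mono hU).and ((hr.filter_mono hU).and h4)).exists
      exact hi2.1 (hi1.imp fun v hv => hi3.trans hv)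
    · refine hS.hasOrthoEig_limit hC hU (P := fun i => (r i ≤ ·))
        ((hr.filter_mono hU).mono fun i hi => hi.2) ?_
      intro u hu
      obtain ⟨u₀, hu₀, hulim⟩ := isCompact_Icc.ultrafilter_le_nhds (U.map u)
        (s := Icc r₀ C) (le_principal_iff.2 (by
          change ∀ᶠ i in (U : Filter ι), u i ∈ Icc r₀ C
          filter_upwards [hu, hlow.filter_mono hU] with i hi hi'
          exact ⟨hi'.1.trans hi.1, hi.2⟩))
      refine ⟨u₀, (hr₀.trans_le hu₀.1).ne', ?_, hulim⟩
      exact le_of_tendsto_of_tendsto hlim hulim (hu.mono fun i hi => hi.1)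
  obtain ⟨r', h1, h2, h3⟩ := key (Ultrafilter.of L) (Ultrafilter.of_le L)
  refine ⟨r', h1, h2, tendsto_iff_ultrafilter _ _ _ |>.2 fun U hU => ?_⟩
  obtain ⟨r'', -, h2', h3'⟩ := key U hU
  rw [h2.eq h2']
  exact h3'

end SpectralConv

end Convergence

/-! ### Convergence of pairs of eigenfunctions up to rotation -/

section Pairs

/-- `f`, `g` are orthonormal eigenfunctions of the operator `S ∘ R`, lying in the set `Re` of real
functions; orthonormality refers to the Hilbert space in which `R` takes its values. -/
structure EigPair {B H : Type*} [NormedAddCommGroup B] [NormedSpace ℂ B] [NormedAddCommGroup H]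
    [InnerProductSpace ℂ H] (R : B →L[ℂ] H) (S : H →L[ℂ] B) (Re : Set B) (lam nu : ℝ) (f g : B) :
    Prop where
  eig_f : S (R f) = (lam : ℂ) • f
  eig_g : S (R g) = (nu : ℂ) • g
  real_f : f ∈ Re
  real_g : g ∈ Re
  norm_f : ‖R f‖ = 1
  norm_g : ‖R g‖ = 1
  orthogonal : inner ℂ (R f) (R g) = 0

variable {B H : Type*} [NormedAddCommGroup B] [NormedSpace ℂ B] [NormedAddCommGroup H]
    [InnerProductSpace ℂ H]

/-- If no three orthonormal eigenvectors have eigenvalues in `{lam, nu}`, then two orthonormal ones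
span all of them. -/
theorem eq_combination_of_not_hasOrthoEig {A : H →ₗ[ℂ] H} (hA : A.IsSymmetric) {lam nu : ℝ}
    (hno : ¬ HasOrthoEig A 3 (fun u => u = lam ∨ u = nu)) {e₁ e₂ : H} (h₁ : A e₁ = (lam : ℂ) • e₁)
    (h₂ : A e₂ = (nu : ℂ) • e₂) (hn₁ : ‖e₁‖ = 1) (hn₂ : ‖e₂‖ = 1) (ho : inner ℂ e₁ e₂ = 0)
    {u : ℝ} (hu : u = lam ∨ u = nu) {x : H} (hx : A x = (u : ℂ) • x) :
    x = (inner ℂ e₁ x) • e₁ + (inner ℂ e₂ x) • e₂ := by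
  have ho' : inner ℂ e₂ e₁ = 0 := inner_eq_zero_symm.1 ho
  have hn₁' : inner ℂ e₁ e₁ = 1 := by rw [inner_self_eq_norm_sq_to_K, hn₁]; simp
  have hn₂' : inner ℂ e₂ e₂ = 1 := by rw [inner_self_eq_norm_sq_to_K, hn₂]; simp
  set d := x - ((inner ℂ e₁ x) • e₁ + (inner ℂ e₂ x) • e₂) with hd
  have hd₁ : inner ℂ e₁ d = 0 := by
    simp only [hd, inner_sub_right, inner_add_right, inner_smul_right, hn₁', ho]; ring
  have hd₂ : inner ℂ e₂ d = 0 := by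
    simp only [hd, inner_sub_right, inner_add_right, inner_smul_right, hn₂', ho']; ring
  have ha : (inner ℂ e₁ x) • ((lam : ℂ) • e₁) = (u : ℂ) • ((inner ℂ e₁ x) • e₁) := by
    by_cases h : lam = u
    · rw [h, smul_comm]
    · rw [inner_eq_zero_of_eig hA h h₁ hx]; simp
  have hb : (inner ℂ e₂ x) • ((nu : ℂ) • e₂) = (u : ℂ) • ((inner ℂ e₂ x) • e₂) := by
    by_cases h : nu = u
    · rw [h, smul_comm]
    · rw [inner_eq_zero_of_eig hA h h₂ hx]; simp
  have hAd : A d = (u : ℂ) • d := by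
    rw [hd, map_sub, map_add, map_smul, map_smul, h₁, h₂, hx, ha, hb, smul_sub, smul_add]
  by_contra hne
  have hd0 : d ≠ 0 := fun h => hne (sub_eq_zero.1 h)
  refine hno ⟨![e₁, e₂, ((‖d‖ : ℂ))⁻¹ • d], ?_, ?_⟩
  · have hdn : ‖((‖d‖ : ℂ))⁻¹ • d‖ = 1 := by
      rw [norm_smul, norm_inv, Complex.norm_real, norm_norm,
        inv_mul_cancel₀ (norm_ne_zero_iff.2 hd0)]
    have hd₁' : inner ℂ d e₁ = 0 := inner_eq_zero_symm.1 hd₁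
    have hd₂' : inner ℂ d e₂ = 0 := inner_eq_zero_symm.1 hd₂
    rw [orthonormal_iff_ite]
    intro i j
    fin_cases i <;> fin_cases j <;>
      simp [ho, ho', hn₁, hn₂, hd₁, hd₂, hd₁', hd₂', hdn, inner_smul_left, inner_smul_right]
  · intro i
    fin_cases i
    · exact ⟨lam, Or.inl rfl, h₁⟩
    · exact ⟨nu, Or.inr rfl, h₂⟩
    · refine ⟨u, hu, ?_⟩
      change A (((‖d‖ : ℂ))⁻¹ • d) = (u : ℂ) • (((‖d‖ : ℂ))⁻¹ • d)
      rw [map_smul, hAd, smul_comm]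

/-- Two real orthonormal bases of a plane differ by an element of `O(2)`: this is a sign and a
rotation, and the rotation multiplies `f + i g` by a phase. -/
theorem EigPair.exists_rotation {R : B →L[ℂ] H} {S : H →L[ℂ] B} {Re : Set B} {lam nu : ℝ}
    (hsym : (R.comp S : H →ₗ[ℂ] H).IsSymmetric) (hlam : lam ≠ 0) (hnu : nu ≠ 0)
    (hno : ¬ HasOrthoEig (R.comp S : H →ₗ[ℂ] H) 3 (fun u => u = lam ∨ u = nu))
    (hRe : ∀ f ∈ Re, ∀ g ∈ Re, (inner ℂ (R f) (R g)).im = 0) {f g f₀ g₀ : B}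
    (h : EigPair R S Re lam nu f g) (h₀ : EigPair R S Re lam nu f₀ g₀) :
    ∃ (s : ℝ) (c : ℂ), (s = 1 ∨ s = -1) ∧ ‖c‖ = 1 ∧ (lam ≠ nu → c = 1 ∨ c = -1) ∧
      c • (f + Complex.I • ((s : ℂ) • g)) = f₀ + Complex.I • g₀ := by
  have hf : (R.comp S : H →ₗ[ℂ] H) (R f) = (lam : ℂ) • R f := by
    change R (S (R f)) = _
    rw [h.eig_f, map_smul]
  have hg : (R.comp S : H →ₗ[ℂ] H) (R g) = (nu : ℂ) • R g := by
    change R (S (R g)) = _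
    rw [h.eig_g, map_smul]
  have hf₀ : (R.comp S : H →ₗ[ℂ] H) (R f₀) = (lam : ℂ) • R f₀ := by
    change R (S (R f₀)) = _
    rw [h₀.eig_f, map_smul]
  have hg₀ : (R.comp S : H →ₗ[ℂ] H) (R g₀) = (nu : ℂ) • R g₀ := by
    change R (S (R g₀)) = _
    rw [h₀.eig_g, map_smul]
  have hx := eq_combination_of_not_hasOrthoEig hsym hno hf₀ hg₀ h₀.norm_f h₀.norm_g h₀.orthogonal
    (Or.inl rfl) hf
  have hy := eq_combination_of_not_hasOrthoEig hsym hno hf₀ hg₀ h₀.norm_f h₀.norm_g h₀.orthogonal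
    (Or.inr rfl) hg
  obtain ⟨a, ha⟩ : ∃ a : ℝ, inner ℂ (R f₀) (R f) = (a : ℂ) :=
    ⟨_, Complex.ext (Complex.ofReal_re _).symm (hRe _ h₀.real_f _ h.real_f)⟩
  obtain ⟨b, hb⟩ : ∃ b : ℝ, inner ℂ (R g₀) (R f) = (b : ℂ) :=
    ⟨_, Complex.ext (Complex.ofReal_re _).symm (hRe _ h₀.real_g _ h.real_f)⟩
  obtain ⟨a', ha'⟩ : ∃ a : ℝ, inner ℂ (R f₀) (R g) = (a : ℂ) :=
    ⟨_, Complex.ext (Complex.ofReal_re _).symm (hRe _ h₀.real_f _ h.real_g)⟩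
  obtain ⟨b', hb'⟩ : ∃ b : ℝ, inner ℂ (R g₀) (R g) = (b : ℂ) :=
    ⟨_, Complex.ext (Complex.ofReal_re _).symm (hRe _ h₀.real_g _ h.real_g)⟩
  have hbz : lam ≠ nu → b = 0 := fun hne => by
    have := inner_eq_zero_of_eig hsym hne.symm hg₀ hf
    rw [hb] at this
    exact_mod_cast this
  have haz : lam ≠ nu → a' = 0 := fun hne => by
    have := inner_eq_zero_of_eig hsym hne hf₀ hg
    rw [ha'] at this
    exact_mod_cast this
  rw [ha, hb] at hx
  rw [ha', hb'] at hy
  have ho' : inner ℂ (R g₀) (R f₀) = 0 := inner_eq_zero_symm.1 h₀.orthogonal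
  have hn₁' : inner ℂ (R f₀) (R f₀) = 1 := by rw [inner_self_eq_norm_sq_to_K, h₀.norm_f]; simp
  have hn₂' : inner ℂ (R g₀) (R g₀) = 1 := by rw [inner_self_eq_norm_sq_to_K, h₀.norm_g]; simp
  have hin : ∀ p q p' q' : ℝ, inner ℂ ((p : ℂ) • R f₀ + (q : ℂ) • R g₀)
      ((p' : ℂ) • R f₀ + (q' : ℂ) • R g₀) = ((p * p' + q * q' : ℝ) : ℂ) := by
    intro p q p' q'
    simp only [inner_add_left, inner_add_right, inner_smul_left, inner_smul_right, h₀.orthogonal,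
      ho', hn₁', hn₂', Complex.conj_ofReal]
    push_cast
    ring
  have e1 : a * a + b * b = 1 := by
    have := inner_self_eq_norm_sq_to_K (𝕜 := ℂ) (R f)
    rw [h.norm_f, hx, hin] at this
    simp only [Complex.coe_algebraMap, Complex.ofReal_one, one_pow] at this
    exact_mod_cast this
  have e2 : a' * a' + b' * b' = 1 := by
    have := inner_self_eq_norm_sq_to_K (𝕜 := ℂ) (R g)
    rw [h.norm_g, hy, hin] at this
    simp only [Complex.coe_algebraMap, Complex.ofReal_one, one_pow] at this
    exact_mod_cast this
  have e3 : a * a' + b * b' = 0 := by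
    have := h.orthogonal
    rw [hx, hy, hin] at this
    exact_mod_cast this
  have hlam' : (lam : ℂ) ≠ 0 := by exact_mod_cast hlam
  have hnu' : (nu : ℂ) ≠ 0 := by exact_mod_cast hnu
  have hfB : f = (a : ℂ) • f₀ + (b : ℂ) • g₀ := by
    have h1 : (lam : ℂ) • f = (lam : ℂ) • ((a : ℂ) • f₀ + (b : ℂ) • g₀) := by
      rw [← h.eig_f, hx, map_add, map_smul, map_smul, h₀.eig_f, h₀.eig_g, smul_add,
        smul_comm (lam : ℂ) (a : ℂ), smul_comm (lam : ℂ) (b : ℂ)]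
      by_cases hne : lam = nu
      · rw [hne]
      · rw [hbz hne]; simp
    exact smul_right_injective _ hlam' h1
  have hgB : g = (a' : ℂ) • f₀ + (b' : ℂ) • g₀ := by
    have h1 : (nu : ℂ) • g = (nu : ℂ) • ((a' : ℂ) • f₀ + (b' : ℂ) • g₀) := by
      rw [← h.eig_g, hy, map_add, map_smul, map_smul, h₀.eig_f, h₀.eig_g, smul_add,
        smul_comm (nu : ℂ) (a' : ℂ), smul_comm (nu : ℂ) (b' : ℂ)]
      by_cases hne : lam = nu
      · rw [hne]
      · rw [haz hne]; simp
    exact smul_right_injective _ hnu' h1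
  -- the sign is the determinant of the change of basis
  set s := a * b' - a' * b with hs
  have s1 : s * b' = a := by
    rw [hs]; linear_combination a * e2 - a' * e3
  have s2 : s * a' = -b := by
    rw [hs]; linear_combination -b * e2 + b' * e3
  have s3 : (s - 1) * (s + 1) = 0 := by
    linear_combination e2 * (a * a + b * b) + e1 - e3 * (a * a' + b * b')
  refine ⟨s, (a : ℂ) + b * Complex.I, ?_, ?_, ?_, ?_⟩
  · rcases mul_eq_zero.1 s3 with h | h
    · left; linarith
    · right; linarith
  · rw [Complex.norm_add_mul_I, Real.sqrt_eq_one]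
    linarith
  · intro hne
    have hb0 := hbz hne
    have : (a - 1) * (a + 1) = 0 := by rw [hb0] at e1; linarith
    rcases mul_eq_zero.1 this with h | h
    · left
      have : a = 1 := by linarith
      simp [hb0, this]
    · right
      have : a = -1 := by linarith
      simp [hb0, this]
  · have s1' : (s : ℂ) * b' = a := by exact_mod_cast s1
    have s2' : (s : ℂ) * a' = -b := by exact_mod_cast s2
    have e1' : (a : ℂ) * a + b * b = 1 := by exact_mod_cast e1
    rw [hfB, hgB]
    match_scalars
    · linear_combination e1' + (a + b * Complex.I) * Complex.I * s2' - b * b * Complex.I_sq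
    · linear_combination Complex.I * e1' + (a + b * Complex.I) * Complex.I * s1'
        + a * b * Complex.I_sq

variable {ι : Type*} {Hi : ι → Type*} [∀ i, NormedAddCommGroup (Hi i)]
  [∀ i, InnerProductSpace ℂ (Hi i)] {L : Filter ι} {R : ∀ i, B →L[ℂ] Hi i}
  {S : ∀ i, Hi i →L[ℂ] B} {R₀ : B →L[ℂ] H} {S₀ : H →L[ℂ] B} {C : ℝ}

/-- Pairs of eigenfunctions have limits along ultrafilters, which are again pairs of eigenfunctions.
The limits are taken in `B`, so that realness passes to them. -/
theorem SpectralConv.exists_pair_limit (hS : SpectralConv L R S R₀ S₀ C) (hC : 0 ≤ C) {Re : Set B}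
    (hRc : IsClosed Re) {lam nu : ι → ℝ} {lam₀ nu₀ : ℝ} {f g : ι → B} {U : Ultrafilter ι}
    (hU : ↑U ≤ L) (h : ∀ᶠ i in U, EigPair (R i) (S i) Re (lam i) (nu i) (f i) (g i))
    (hlam : Tendsto lam U (𝓝 lam₀)) (hnu : Tendsto nu U (𝓝 nu₀)) (hlam₀ : lam₀ ≠ 0)
    (hnu₀ : nu₀ ≠ 0) :
    ∃ f₀ g₀, Tendsto f U (𝓝 f₀) ∧ Tendsto g U (𝓝 g₀) ∧ EigPair R₀ S₀ Re lam₀ nu₀ f₀ g₀ := by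
  obtain ⟨f₀, hf, hfe, -⟩ := hS.exists_eigenvector_limit hC hU (w := fun i => R i (f i))
    (h.mono fun i hi => ⟨hi.norm_f, by rw [hi.eig_f, map_smul]⟩) hlam hlam₀
  obtain ⟨g₀, hg, hge, -⟩ := hS.exists_eigenvector_limit hC hU (w := fun i => R i (g i))
    (h.mono fun i hi => ⟨hi.norm_g, by rw [hi.eig_g, map_smul]⟩) hnu hnu₀
  have hf' : Tendsto f U (𝓝 f₀) := by
    refine hf.congr' ?_
    filter_upwards [h, hlam.eventually_ne hlam₀] with i hi hne
    rw [hi.eig_f, inv_smul_smul₀ (by exact_mod_cast hne)]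
  have hg' : Tendsto g U (𝓝 g₀) := by
    refine hg.congr' ?_
    filter_upwards [h, hnu.eventually_ne hnu₀] with i hi hne
    rw [hi.eig_g, inv_smul_smul₀ (by exact_mod_cast hne)]
  have hnorm : ∀ (p : ι → B) (p₀ : B), Tendsto p U (𝓝 p₀) → (∀ᶠ i in U, ‖R i (p i)‖ = 1) →
      ‖R₀ p₀‖ = 1 := by
    intro p p₀ hp hp1
    have h1 : inner ℂ (R₀ p₀) (R₀ p₀) = 1 := by
      refine tendsto_nhds_unique (hS.tendsto_inner hU hp hp) (tendsto_const_nhds.congr' ?_)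
      filter_upwards [hp1] with i hi
      rw [inner_self_eq_norm_sq_to_K, hi]
      simp
    have h2 : ‖R₀ p₀‖ ^ 2 = 1 := by
      rw [← inner_self_eq_norm_sq (𝕜 := ℂ), h1]
      simp
    exact (pow_eq_one_iff_of_nonneg (norm_nonneg _) two_ne_zero).1 h2
  refine ⟨f₀, g₀, hf', hg', hfe, hge, hRc.mem_of_tendsto hf' (h.mono fun i hi => hi.real_f),
    hRc.mem_of_tendsto hg' (h.mono fun i hi => hi.real_g),
    hnorm f f₀ hf' (h.mono fun i hi => hi.norm_f), hnorm g g₀ hg' (h.mono fun i hi => hi.norm_g),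
    ?_⟩
  refine tendsto_nhds_unique (hS.tendsto_inner hU hf' hg') (tendsto_const_nhds.congr' ?_)
  filter_upwards [h] with i hi
  rw [hi.orthogonal]

/-- Pairs of eigenfunctions converge after a sign change and a rotation. The sign and the phase are
chosen to minimize the distance to the limit. -/
theorem SpectralConv.exists_aligned (hS : SpectralConv L R S R₀ S₀ C) (hC : 0 ≤ C) {Re : Set B}
    (hRc : IsClosed Re) (hRe : ∀ f ∈ Re, ∀ g ∈ Re, (inner ℂ (R₀ f) (R₀ g)).im = 0)
    (hsym : (R₀.comp S₀ : H →ₗ[ℂ] H).IsSymmetric) {lam nu : ι → ℝ} {lam₀ nu₀ : ℝ}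
    (hno : ¬ HasOrthoEig (R₀.comp S₀ : H →ₗ[ℂ] H) 3 (fun u => u = lam₀ ∨ u = nu₀)) {f g : ι → B}
    (h : ∀ᶠ i in L, EigPair (R i) (S i) Re (lam i) (nu i) (f i) (g i))
    (hlam : Tendsto lam L (𝓝 lam₀)) (hnu : Tendsto nu L (𝓝 nu₀)) (hlam₀ : lam₀ ≠ 0)
    (hnu₀ : nu₀ ≠ 0) {f₀ g₀ : B} (h₀ : EigPair R₀ S₀ Re lam₀ nu₀ f₀ g₀) :
    ∃ (s : ι → ℝ) (c : ι → ℂ), (∀ i, s i = 1 ∨ s i = -1) ∧ (∀ i, ‖c i‖ = 1) ∧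
      (lam₀ ≠ nu₀ → ∀ i, c i = 1 ∨ c i = -1) ∧
      Tendsto (fun i => c i • (f i + Complex.I • ((s i : ℂ) • g i))) L
        (𝓝 (f₀ + Complex.I • g₀)) := by
  let A : Set (ℝ × ℂ) := ({1, -1} : Set ℝ) ×ˢ
    (Metric.sphere (0 : ℂ) 1 ∩ {c | lam₀ ≠ nu₀ → c ∈ ({1, -1} : Set ℂ)})
  have hA : IsCompact A := by
    refine (Set.toFinite _).isCompact.prod ((isCompact_sphere _ _).inter_right ?_)
    by_cases hne : lam₀ = nu₀
    · simp [hne]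
    · simp only [ne_eq, hne, not_false_eq_true, forall_const, ofPred_mem_eq]
      exact (Set.toFinite _).isClosed
  have hAne : A.Nonempty := ⟨(1, 1), by simp [A]⟩
  -- the minimizers do not depend on the ultrafilter, while the rotation found by
  -- `EigPair.exists_rotation` below does
  have hmin : ∀ i, ∃ p ∈ A, ∀ q ∈ A,
      ‖p.2 • (f i + Complex.I • ((p.1 : ℂ) • g i)) - (f₀ + Complex.I • g₀)‖ ≤
      ‖q.2 • (f i + Complex.I • ((q.1 : ℂ) • g i)) - (f₀ + Complex.I • g₀)‖ := fun i =>
    hA.exists_isMinOn hAne (f := fun q : ℝ × ℂ =>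
      ‖q.2 • (f i + Complex.I • ((q.1 : ℂ) • g i)) - (f₀ + Complex.I • g₀)‖) (by fun_prop)
  choose p hpA hp using hmin
  refine ⟨fun i => (p i).1, fun i => (p i).2, fun i => (hpA i).1, fun i => ?_,
    fun hne i => (hpA i).2.2 hne, ?_⟩
  · simpa using (hpA i).2.1
  rw [tendsto_iff_norm_sub_tendsto_zero, tendsto_iff_ultrafilter]
  intro U hU
  obtain ⟨f', g', hf', hg', hfg⟩ := hS.exists_pair_limit hC hRc hU (h.filter_mono hU)
    (hlam.mono_left hU) (hnu.mono_left hU) hlam₀ hnu₀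
  obtain ⟨s, c, hs, hc, hc', hsc⟩ := hfg.exists_rotation hsym hlam₀ hnu₀ hno hRe h₀
  have hq : (s, c) ∈ A := ⟨hs, by simpa using hc, hc'⟩
  refine squeeze_zero (fun i => norm_nonneg _) (fun i => hp i _ hq) ?_
  rw [← tendsto_iff_norm_sub_tendsto_zero, ← hsc]
  exact (hf'.add ((hg'.const_smul _).const_smul _)).const_smul _

end Pairs

/-! ### Compactness of integral operators in the space of continuous functions -/

section Compactness

variable {K : Type*} [TopologicalSpace K] [CompactSpace K]

/-- The Arzelà–Ascoli theorem for a pointwise modulus of continuity. -/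
theorem isCompact_setOf_modulus (C : ℝ) (ω : K → K → ℝ) (hω : ∀ x, Tendsto (ω x) (𝓝 x) (𝓝 0)) :
    IsCompact {f : C(K, ℂ) | (∀ x, ‖f x‖ ≤ C) ∧ ∀ x x', ‖f x - f x'‖ ≤ ω x x'} := by
  set A : Set C(K, ℂ) := {f | (∀ x, ‖f x‖ ≤ C) ∧ ∀ x x', ‖f x - f x'‖ ≤ ω x x'} with hA
  have hcl : IsClosed A := by
    have h1 : A = (⋂ x, {f : C(K, ℂ) | ‖f x‖ ≤ C}) ∩ ⋂ x, ⋂ x', {f | ‖f x - f x'‖ ≤ ω x x'} := by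
      ext f; simp [hA]
    rw [h1]
    refine (isClosed_iInter fun x => ?_).inter (isClosed_iInter fun x => isClosed_iInter fun x' => ?_)
    · exact isClosed_le (continuous_eval_const x).norm continuous_const
    · exact isClosed_le ((continuous_eval_const x).sub
        (continuous_eval_const x')).norm continuous_const
  let e := ContinuousMap.isometryEquivBoundedOfCompact K ℂ
  have hcl' : IsClosed (e.symm ⁻¹' A) := hcl.preimage e.symm.continuous
  have hcpt : IsCompact (e.symm ⁻¹' A) := by
    rw [← hcl'.closure_eq]
    refine BoundedContinuousFunction.arzela_ascoli (Metric.closedBall (0 : ℂ) C)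
      (isCompact_closedBall _ _) _ (fun f x hf => ?_) ?_
    · rw [mem_closedBall_zero_iff]
      exact hf.1 x
    · intro x
      rw [Metric.equicontinuousAt_iff_right]
      intro ε hε
      filter_upwards [(hω x).eventually_lt_const hε] with x' hx' f
      exact (dist_eq_norm _ _).trans_lt ((f.2.2 x x').trans_lt hx')
  have : A = e ⁻¹' (e.symm ⁻¹' A) := by
    ext f; simp
  rw [this]
  exact e.toHomeomorph.isClosedEmbedding.isCompact_preimage hcpt

end Compactness

section Operators

variable {Ω : Type*} [MetricSpace Ω]

/-- A common modulus of continuity of the functions `k(·, y)`, `y ∈ M`. -/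
def kernelModulus (k : (Ω × Ω) →ᵇ ℝ) (M : Set Ω) [CompactSpace M] (x x' : M) : ℝ :=
  ‖(ContinuousMap.curry ⟨fun p : M × M => k (p.1, p.2), by fun_prop⟩ : C(M, C(M, ℝ))) x
    - (ContinuousMap.curry ⟨fun p : M × M => k (p.1, p.2), by fun_prop⟩ : C(M, C(M, ℝ))) x'‖

theorem tendsto_kernelModulus (k : (Ω × Ω) →ᵇ ℝ) (M : Set Ω) [CompactSpace M] (x : M) :
    Tendsto (kernelModulus k M x) (𝓝 x) (𝓝 0) := by
  have : Continuous (kernelModulus k M x) := by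
    unfold kernelModulus
    exact (continuous_const.sub (ContinuousMap.continuous _)).norm
  simpa [kernelModulus] using this.tendsto x

theorem abs_sub_le_kernelModulus (k : (Ω × Ω) →ᵇ ℝ) (M : Set Ω) [CompactSpace M] (x x' : M)
    {y : Ω} (hy : y ∈ M) : |k (x, y) - k (x', y)| ≤ kernelModulus k M x x' :=
  ((ContinuousMap.curry ⟨fun p : M × M => k (p.1, p.2), by fun_prop⟩ : C(M, C(M, ℝ))) x
    - (ContinuousMap.curry ⟨fun p : M × M => k (p.1, p.2), by fun_prop⟩ : C(M, C(M, ℝ)))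
      x').norm_coe_le_norm ⟨y, hy⟩

theorem kernelModulus_nonneg (k : (Ω × Ω) →ᵇ ℝ) (M : Set Ω) [CompactSpace M] (x x' : M) :
    0 ≤ kernelModulus k M x x' := norm_nonneg _

variable [MeasurableSpace Ω] [BorelSpace Ω]

theorem measurableSet_of_compactSpace (M : Set Ω) [CompactSpace M] : MeasurableSet M :=
  (isCompact_iff_compactSpace.2 ‹_›).isClosed.measurableSet

open Classical in
/-- Extension by zero of a function on `M`. -/
def zeroExt {M : Set Ω} (f : M → ℂ) (x : Ω) : ℂ := if h : x ∈ M then f ⟨x, h⟩ else 0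

theorem zeroExt_of_mem {M : Set Ω} (f : M → ℂ) {x : Ω} (h : x ∈ M) : zeroExt f x = f ⟨x, h⟩ :=
  dif_pos h

theorem measurable_zeroExt {M : Set Ω} [CompactSpace M] (f : C(M, ℂ)) : Measurable (zeroExt f) := by
  classical
  have h := (MeasurableEmbedding.subtype_coe (measurableSet_of_compactSpace M)).measurable_extend
    f.continuous.measurable (measurable_const (a := (0 : ℂ)))
  convert h using 1
  ext x
  by_cases hx : x ∈ M
  · rw [zeroExt_of_mem f hx]
    exact (Subtype.val_injective.extend_apply f _ ⟨x, hx⟩).symm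
  · rw [zeroExt, dif_neg hx, Function.extend_apply']
    simpa using hx

theorem norm_zeroExt_le {M : Set Ω} [CompactSpace M] (f : C(M, ℂ)) (x : Ω) :
    ‖zeroExt f x‖ ≤ ‖f‖ := by
  unfold zeroExt
  split_ifs
  · exact f.norm_coe_le_norm _
  · simp

variable (μ : Measure Ω) [IsProbabilityMeasure μ]

theorem memLp_zeroExt {M : Set Ω} [CompactSpace M] (f : C(M, ℂ)) : MemLp (zeroExt f) 2 μ :=
  MemLp.of_bound (measurable_zeroExt f).aestronglyMeasurable ‖f‖ (ae_of_all _ (norm_zeroExt_le f))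

/-- A continuous function on `M`, extended by zero, as an element of `L²(μ)`. -/
def restrictL2 (M : Set Ω) [CompactSpace M] : C(M, ℂ) →L[ℂ] Lp ℂ 2 μ :=
  LinearMap.mkContinuous
    { toFun := fun f => (memLp_zeroExt μ f).toLp _
      map_add' := fun f g => by
        rw [← MemLp.toLp_add]
        refine MemLp.toLp_congr _ _ (ae_of_all _ fun x => ?_)
        by_cases hx : x ∈ M <;> simp [zeroExt, hx]
      map_smul' := fun c f => by
        rw [RingHom.id_apply, ← MemLp.toLp_const_smul]
        refine MemLp.toLp_congr _ _ (ae_of_all _ fun x => ?_)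
        by_cases hx : x ∈ M <;> simp [zeroExt, hx] } 1 fun f => by
    rw [one_mul]
    refine (Lp.norm_le_of_ae_bound (norm_nonneg f) (C := ‖f‖) ?_).trans ?_
    · filter_upwards [(memLp_zeroExt μ f).coeFn_toLp] with x hx
      change ‖((memLp_zeroExt μ f).toLp _ : Ω → ℂ) x‖ ≤ _
      rw [hx]
      exact norm_zeroExt_le f x
    · simp [measureUnivNNReal]

theorem coeFn_restrictL2 {M : Set Ω} [CompactSpace M] (f : C(M, ℂ)) :
    (restrictL2 μ M f : Ω → ℂ) =ᵐ[μ] zeroExt f :=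
  (memLp_zeroExt μ f).coeFn_toLp

theorem norm_restrictL2_le {M : Set Ω} [CompactSpace M] (f : C(M, ℂ)) :
    ‖restrictL2 μ M f‖ ≤ ‖f‖ := by
  simpa using (LinearMap.mkContinuous_norm_le _ zero_le_one _ : ‖restrictL2 μ M‖ ≤ 1) |> fun h =>
    (restrictL2 μ M).le_of_opNorm_le h f

theorem integral_norm_le_norm (v : Lp ℂ 2 μ) : ∫ x, ‖v x‖ ∂μ ≤ ‖v‖ := by
  rw [Lp.norm_def, integral_norm_eq_lintegral_enorm (Lp.aestronglyMeasurable v),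
    ← eLpNorm_one_eq_lintegral_enorm]
  exact ENNReal.toReal_mono (Lp.eLpNorm_ne_top v)
    (eLpNorm_le_eLpNorm_of_exponent_le (by norm_num) (Lp.aestronglyMeasurable v))

/-- Two kernels and two points at once: this bounds the modulus of continuity and the variation
along orbits of `∫ k(·, y) v(y) dμ(y)`, as well as its dependence on the kernel. -/
theorem norm_kernel_integral_sub_le {M : Set Ω} (hM : μ Mᶜ = 0) (k k' : (Ω × Ω) →ᵇ ℝ) {x x' : Ω}
    {δ : ℝ} (hδ : ∀ y ∈ M, |k (x, y) - k' (x', y)| ≤ δ) (v : Lp ℂ 2 μ) :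
    ‖∫ y, (k (x, y) : ℂ) * v y ∂μ - ∫ y, (k' (x', y) : ℂ) * v y ∂μ‖ ≤ δ * ‖v‖ := by
  have hM' : ∀ᵐ y ∂μ, y ∈ M := by rw [ae_iff]; exact hM
  have hδ0 : 0 ≤ δ := by
    obtain ⟨y, hy⟩ := hM'.exists
    exact (abs_nonneg _).trans (hδ y hy)
  rw [← integral_sub (integrable_kernel_mul μ k v x) (integrable_kernel_mul μ k' v x')]
  have hf : Integrable v μ := (Lp.memLp v).integrable (by norm_num)
  calc _ ≤ ∫ y, ‖(k (x, y) : ℂ) * v y - (k' (x', y) : ℂ) * v y‖ ∂μ := norm_integral_le_integral_norm _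
    _ ≤ ∫ y, δ * ‖v y‖ ∂μ := by
      refine integral_mono_ae ((integrable_kernel_mul μ k v x).sub
        (integrable_kernel_mul μ k' v x')).norm (hf.norm.const_mul δ) ?_
      filter_upwards [hM'] with y hy
      rw [← sub_mul, norm_mul, ← Complex.ofReal_sub, Complex.norm_real, Real.norm_eq_abs]
      exact mul_le_mul_of_nonneg_right (hδ y hy) (norm_nonneg _)
    _ = δ * ∫ y, ‖v y‖ ∂μ := integral_const_mul _ _
    _ ≤ δ * ‖v‖ := mul_le_mul_of_nonneg_left (integral_norm_le_norm μ v) hδ0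

theorem continuous_kernel_integral (k : (Ω × Ω) →ᵇ ℝ) (f : Lp ℂ 2 μ) :
    Continuous fun x => ∫ y, (k (x, y) : ℂ) * f y ∂μ := by
  have hf : Integrable f μ := (Lp.memLp f).integrable (by norm_num)
  refine continuous_of_dominated (bound := fun y => ‖k‖ * ‖f y‖)
    (fun x => (integrable_kernel_mul μ k f x).aestronglyMeasurable)
    (fun x => ae_of_all _ fun y => ?_) (hf.norm.const_mul _) (ae_of_all _ fun y => ?_)
  · rw [norm_mul]
    refine mul_le_mul_of_nonneg_right ?_ (norm_nonneg _)
    simpa using k.norm_coe_le_norm (x, y)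
  · fun_prop

theorem norm_kernel_integral_le (k : (Ω × Ω) →ᵇ ℝ) (v : Lp ℂ 2 μ) (x : Ω) :
    ‖∫ y, (k (x, y) : ℂ) * v y ∂μ‖ ≤ ‖k‖ * ‖v‖ := by
  have := norm_kernel_integral_sub_le μ (M := univ) (by simp) k 0 (x := x) (x' := x) (δ := ‖k‖)
    (fun y _ => by simpa using k.norm_coe_le_norm (x, y)) v
  simpa using this

/-- The integral operator `v ↦ ∫ k(·, y) v(y) dμ(y)` from `L²(μ)` to the continuous functions on
`M`. -/
def kernelInt (k : (Ω × Ω) →ᵇ ℝ) (M : Set Ω) [CompactSpace M] : Lp ℂ 2 μ →L[ℂ] C(M, ℂ) :=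
  LinearMap.mkContinuous
    { toFun := fun v => ⟨fun x : M => ∫ y, (k (x, y) : ℂ) * v y ∂μ,
        (continuous_kernel_integral μ k v).comp continuous_subtype_val⟩
      map_add' := fun f g => by
        ext x
        simp only [ContinuousMap.coe_mk, ContinuousMap.add_apply]
        rw [← integral_add (integrable_kernel_mul μ k f x) (integrable_kernel_mul μ k g x)]
        refine integral_congr_ae ?_
        filter_upwards [Lp.coeFn_add f g] with y hy
        rw [hy, Pi.add_apply, mul_add]
      map_smul' := fun c f => by
        ext x
        simp only [ContinuousMap.coe_mk, ContinuousMap.smul_apply, RingHom.id_apply]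
        rw [← integral_smul]
        refine integral_congr_ae ?_
        filter_upwards [Lp.coeFn_smul c f] with y hy
        rw [hy, Pi.smul_apply, smul_eq_mul, smul_eq_mul]
        ring } ‖k‖ fun v => by
    rw [ContinuousMap.norm_le _ (by positivity)]
    exact fun x => norm_kernel_integral_le μ k v x

theorem kernelInt_apply (k : (Ω × Ω) →ᵇ ℝ) (M : Set Ω) [CompactSpace M] (v : Lp ℂ 2 μ) (x : M) :
    kernelInt μ k M v x = ∫ y, (k (x, y) : ℂ) * v y ∂μ := rfl

theorem norm_kernelInt_le (k : (Ω × Ω) →ᵇ ℝ) (M : Set Ω) [CompactSpace M] (v : Lp ℂ 2 μ) :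
    ‖kernelInt μ k M v‖ ≤ ‖k‖ * ‖v‖ :=
  (ContinuousMap.norm_le _ (by positivity)).2 fun x => norm_kernel_integral_le μ k v x

/-- The image of the unit ball lies in a compact set. -/
theorem kernelInt_mem (k : (Ω × Ω) →ᵇ ℝ) {M : Set Ω} [CompactSpace M] (hM : μ Mᶜ = 0)
    {v : Lp ℂ 2 μ} (hv : ‖v‖ ≤ 1) : kernelInt μ k M v ∈ {f : C(M, ℂ) | (∀ x, ‖f x‖ ≤ ‖k‖) ∧
      ∀ x x', ‖f x - f x'‖ ≤ kernelModulus k M x x'} :=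
  ⟨fun x => (norm_kernel_integral_le μ k v x).trans (mul_le_of_le_one_right (norm_nonneg _) hv),
    fun x x' => (norm_kernel_integral_sub_le μ hM k k
      (fun _ hy => abs_sub_le_kernelModulus k M x x' hy) v).trans
      (mul_le_of_le_one_right (kernelModulus_nonneg k M x x') hv)⟩

theorem isCompactOperator_kernelInt (k : (Ω × Ω) →ᵇ ℝ) {M : Set Ω} [CompactSpace M]
    (hM : μ Mᶜ = 0) : IsCompactOperator (kernelInt μ k M) :=
  ⟨_, isCompact_setOf_modulus ‖k‖ (kernelModulus k M) (tendsto_kernelModulus k M), by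
    filter_upwards [Metric.closedBall_mem_nhds (0 : Lp ℂ 2 μ) one_pos] with v hv
    exact kernelInt_mem μ k hM (by simpa using hv)⟩

/-- The integral operator on `L²(μ)` factors through the continuous functions on `M`. -/
theorem restrictL2_kernelInt (k : (Ω × Ω) →ᵇ ℝ) {M : Set Ω} [CompactSpace M] (hM : μ Mᶜ = 0) :
    ((restrictL2 μ M).comp (kernelInt μ k M) : Lp ℂ 2 μ →ₗ[ℂ] Lp ℂ 2 μ) = integralOp μ k := by
  ext1 v
  have hM' : ∀ᵐ y ∂μ, y ∈ M := by rw [ae_iff]; exact hM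
  change (memLp_zeroExt μ (kernelInt μ k M v)).toLp _ = (memLp_kernel_integral μ k v).toLp _
  refine MemLp.toLp_congr _ _ ?_
  filter_upwards [hM'] with x hx
  rw [zeroExt_of_mem _ hx]
  rfl

theorem integral_eq_integral_subtype {G : Type*} [NormedAddCommGroup G] [NormedSpace ℝ G]
    {M : Set Ω} [CompactSpace M] (hM : μ Mᶜ = 0)
    (f : Ω → G) : ∫ x, f x ∂μ = ∫ x : M, f x ∂(μ.comap Subtype.val) := by
  rw [integral_subtype_comap (measurableSet_of_compactSpace M), Measure.restrict_eq_self_of_ae_mem]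
  rw [ae_iff]; exact hM

/-- Fubini's theorem is applied on `M × M`, where the kernel is jointly measurable; `Ω` need not be
separable. -/
theorem isSymmetric_integralOp (k : (Ω × Ω) →ᵇ ℝ) (hk : ∀ x y, k (x, y) = k (y, x)) {M : Set Ω}
    [CompactSpace M] (hM : μ Mᶜ = 0) : (integralOp μ k).IsSymmetric := by
  intro f g
  have hcoe : ∀ v : Lp ℂ 2 μ, (integralOp μ k v : Ω → ℂ) =ᵐ[μ]
      fun x => ∫ y, (k (x, y) : ℂ) * v y ∂μ := fun v => (memLp_kernel_integral μ k v).coeFn_toLp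
  have hemb := MeasurableEmbedding.subtype_coe (measurableSet_of_compactSpace M)
  have hint : ∀ v : Lp ℂ 2 μ, Integrable (fun x : M => v x) (μ.comap Subtype.val) := fun v => by
    have h1 : Integrable v μ := (Lp.memLp v).integrable (by norm_num)
    have h2 := (hemb.integrableOn_iff_comap (s := M) (μ := μ) (f := v) (by simp)).1
      h1.integrableOn
    rw [Subtype.coe_preimage_self, integrableOn_univ] at h2
    exact h2
  have hfin : IsFiniteMeasure (μ.comap (Subtype.val : M → Ω)) := by
    constructor
    rw [comap_subtype_coe_apply (measurableSet_of_compactSpace M)]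
    exact measure_lt_top _ _
  rw [L2.inner_def, L2.inner_def]
  calc ∫ x, inner ℂ (integralOp μ k f x) (g x) ∂μ
      = ∫ x, inner ℂ (∫ y, (k (x, y) : ℂ) * f y ∂μ) (g x) ∂μ := by
        refine integral_congr_ae ?_
        filter_upwards [hcoe f] with x hx
        rw [hx]
    _ = ∫ x : M, ∫ y : M, (k (x, y) : ℂ) * (starRingEnd ℂ (f y) * g x) ∂(μ.comap Subtype.val)
          ∂(μ.comap Subtype.val) := by
        rw [integral_eq_integral_subtype μ hM]
        refine integral_congr_ae (ae_of_all _ fun x => ?_)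
        dsimp only
        rw [integral_eq_integral_subtype μ hM, RCLike.inner_apply, ← integral_conj,
          mul_comm, ← integral_mul_const]
        refine integral_congr_ae (ae_of_all _ fun y => ?_)
        simp only [map_mul, Complex.conj_ofReal]
        ring
    _ = ∫ y : M, ∫ x : M, (k (x, y) : ℂ) * (starRingEnd ℂ (f y) * g x) ∂(μ.comap Subtype.val)
          ∂(μ.comap Subtype.val) := by
        refine integral_integral_swap ?_
        have h3 := ((hint g).mul_prod (Complex.conjCLE.toContinuousLinearMap.integrable_comp (hint f)))
        refine Integrable.bdd_mul (c := ‖k‖) (g := fun p : M × M => starRingEnd ℂ (f p.2) * g p.1)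
          (by simpa [mul_comm] using h3) ?_ (ae_of_all _ fun p => ?_)
        · have : Continuous fun p : M × M => (k (p.1, p.2) : ℂ) := by fun_prop
          exact this.aestronglyMeasurable
        · simpa using k.norm_coe_le_norm (p.1, p.2)
    _ = ∫ x, inner ℂ (f x) (∫ y, (k (x, y) : ℂ) * g y ∂μ) ∂μ := by
        rw [integral_eq_integral_subtype μ hM]
        refine integral_congr_ae (ae_of_all _ fun y => ?_)
        dsimp only
        rw [integral_eq_integral_subtype μ hM, RCLike.inner_apply, ← integral_mul_const]
        refine integral_congr_ae (ae_of_all _ fun x => ?_)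
        simp only [hk y x]
        ring
    _ = _ := by
        refine integral_congr_ae ?_
        filter_upwards [hcoe g] with x hx
        rw [hx]

end Operators

/-! ### The data-driven operators -/

section DataOperators

variable {Ω : Type*} [MetricSpace Ω]

theorem inv_sqrt_mul_inv_sqrt (N : ℕ) :
    (((√(N : ℝ))⁻¹ : ℝ) : ℂ) * (((√(N : ℝ))⁻¹ : ℝ) : ℂ) = (N : ℂ)⁻¹ := by
  rw [← Complex.ofReal_mul, ← mul_inv, Real.mul_self_sqrt (Nat.cast_nonneg N)]
  simp

/-- The vector `N^{-1/2} v`: with this scaling the Euclidean inner product is `innerN`. -/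
def scaled {N : ℕ} (v : Fin N → ℂ) : EuclideanSpace ℂ (Fin N) :=
  WithLp.toLp 2 fun n => (((√(N : ℝ))⁻¹ : ℝ) : ℂ) * v n

theorem inner_scaled {N : ℕ} (v w : Fin N → ℂ) : inner ℂ (scaled v) (scaled w) = innerN v w := by
  simp only [PiLp.inner_apply, scaled, RCLike.inner_apply, innerN, map_mul, Complex.conj_ofReal]
  rw [← inv_sqrt_mul_inv_sqrt, Finset.mul_sum]
  exact Finset.sum_congr rfl fun n _ => by ring

theorem norm_scaled_le {N : ℕ} {v : Fin N → ℂ} {C : ℝ} (hC : 0 ≤ C) (hv : ∀ n, ‖v n‖ ≤ C) :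
    ‖scaled v‖ ≤ C := by
  rw [EuclideanSpace.norm_eq]
  refine Real.sqrt_le_iff.2 ⟨hC, ?_⟩
  calc ∑ n, ‖(scaled v) n‖ ^ 2 = ∑ n, (N : ℝ)⁻¹ * ‖v n‖ ^ 2 := by
        refine Finset.sum_congr rfl fun n _ => ?_
        simp only [scaled, norm_mul, Complex.norm_real, mul_pow, Real.norm_eq_abs, sq_abs, inv_pow,
          Real.sq_sqrt (Nat.cast_nonneg N)]
    _ ≤ ∑ n : Fin N, (N : ℝ)⁻¹ * C ^ 2 := by
        refine Finset.sum_le_sum fun n _ => ?_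
        have := hv n
        gcongr
    _ = ((N : ℝ) * (N : ℝ)⁻¹) * C ^ 2 := by simp [mul_assoc]
    _ ≤ C ^ 2 := mul_le_of_le_one_left (by positivity) mul_inv_le_one

/-- The restriction of a continuous function on `M` to the sampled states, as an element of
`L²(μ_N)`. -/
def sampleRestrict {M : Set Ω} [CompactSpace M] (x : ℕ → M) (N : ℕ) :
    C(M, ℂ) →L[ℂ] EuclideanSpace ℂ (Fin N) :=
  LinearMap.mkContinuous
    { toFun := fun f => scaled fun n => f (x n)
      map_add' := fun f g => by ext n; simp [scaled, mul_add]
      map_smul' := fun c f => by ext n; simp [scaled]; ring } 1 fun f => by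
    rw [one_mul]
    exact norm_scaled_le (norm_nonneg _) fun _ => f.norm_coe_le_norm _

theorem sampleRestrict_apply {M : Set Ω} [CompactSpace M] (x : ℕ → M) (N : ℕ) (f : C(M, ℂ)) :
    sampleRestrict x N f = scaled fun n => f (x n) := rfl

theorem norm_sampleRestrict_le {M : Set Ω} [CompactSpace M] (x : ℕ → M) (N : ℕ) (f : C(M, ℂ)) :
    ‖sampleRestrict x N f‖ ≤ ‖f‖ :=
  norm_scaled_le (norm_nonneg _) fun _ => f.norm_coe_le_norm _

/-- The Cauchy–Schwarz inequality in `L²(μ_N)`. -/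
theorem norm_inv_sqrt_sum_le {N : ℕ} {a : Fin N → ℂ} {δ : ℝ} (hδ : 0 ≤ δ) (ha : ∀ n, ‖a n‖ ≤ δ)
    (w : EuclideanSpace ℂ (Fin N)) :
    ‖(((√(N : ℝ))⁻¹ : ℝ) : ℂ) * ∑ n, a n * w n‖ ≤ δ * ‖w‖ := by
  have h1 : ‖∑ n, a n * w n‖ ≤ δ * ∑ n, ‖w n‖ := by
    rw [Finset.mul_sum]
    refine (norm_sum_le _ _).trans (Finset.sum_le_sum fun n _ => ?_)
    rw [norm_mul]
    exact mul_le_mul_of_nonneg_right (ha n) (norm_nonneg _)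
  have h2 : ∑ n, ‖w n‖ ≤ √(N : ℝ) * ‖w‖ := by
    rw [EuclideanSpace.norm_eq, ← Real.sqrt_mul (Nat.cast_nonneg N)]
    refine Real.le_sqrt_of_sq_le ?_
    simpa using sq_sum_le_card_mul_sum_sq (s := Finset.univ) (f := fun n => ‖w n‖)
  rw [norm_mul, Complex.norm_real, Real.norm_eq_abs, abs_of_nonneg (by positivity)]
  calc (√(N : ℝ))⁻¹ * ‖∑ n, a n * w n‖ ≤ (√(N : ℝ))⁻¹ * (δ * (√(N : ℝ) * ‖w‖)) := by
        gcongr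
        exact h1.trans (by gcongr)
    _ = (√(N : ℝ) * (√(N : ℝ))⁻¹) * (δ * ‖w‖) := by ring
    _ ≤ δ * ‖w‖ := mul_le_of_le_one_left (by positivity) mul_inv_le_one

/-- The integral operator with respect to the sampling measure, from `L²(μ_N)` to the continuous
functions on `M`. -/
def sampleInt (k : (Ω × Ω) →ᵇ ℝ) {M : Set Ω} [CompactSpace M] (x : ℕ → M) (N : ℕ) :
    EuclideanSpace ℂ (Fin N) →L[ℂ] C(M, ℂ) :=
  LinearMap.mkContinuous
    { toFun := fun w => ⟨fun y : M => (((√(N : ℝ))⁻¹ : ℝ) : ℂ) * ∑ n : Fin N, (k (y, x n) : ℂ) * w n, by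
        fun_prop⟩
      map_add' := fun f g => by
        ext y
        simp [mul_add, Finset.sum_add_distrib]
      map_smul' := fun c f => by
        ext y
        simp only [PiLp.smul_apply, smul_eq_mul, ContinuousMap.coe_mk, RingHom.id_apply,
          ContinuousMap.smul_apply, Finset.mul_sum]
        exact Finset.sum_congr rfl fun n _ => by ring } ‖k‖ fun w => by
    rw [ContinuousMap.norm_le _ (by positivity)]
    exact fun y => norm_inv_sqrt_sum_le (norm_nonneg _)
      (fun n => by simpa using k.norm_coe_le_norm (y, x n)) w

theorem sampleInt_apply (k : (Ω × Ω) →ᵇ ℝ) {M : Set Ω} [CompactSpace M] (x : ℕ → M) (N : ℕ)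
    (w : EuclideanSpace ℂ (Fin N)) (y : M) :
    sampleInt k x N w y = (((√(N : ℝ))⁻¹ : ℝ) : ℂ) * ∑ n : Fin N, (k (y, x n) : ℂ) * w n := rfl

theorem sampleInt_scaled (k : (Ω × Ω) →ᵇ ℝ) {M : Set Ω} [CompactSpace M] (x : ℕ → M) (N : ℕ)
    (v : Fin N → ℂ) (y : M) :
    sampleInt k x N (scaled v) y = (N : ℂ)⁻¹ * ∑ n : Fin N, (k (y, x n) : ℂ) * v n := by
  rw [sampleInt_apply, ← inv_sqrt_mul_inv_sqrt, mul_assoc, Finset.mul_sum, Finset.mul_sum,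
    Finset.mul_sum]
  exact Finset.sum_congr rfl fun n _ => by simp only [scaled]; ring

theorem norm_sampleInt_le (k : (Ω × Ω) →ᵇ ℝ) {M : Set Ω} [CompactSpace M] (x : ℕ → M) (N : ℕ)
    (w : EuclideanSpace ℂ (Fin N)) : ‖sampleInt k x N w‖ ≤ ‖k‖ * ‖w‖ :=
  (ContinuousMap.norm_le _ (by positivity)).2 fun y => norm_inv_sqrt_sum_le (norm_nonneg _)
      (fun n => by simpa using k.norm_coe_le_norm (y, x n)) w

theorem sampleInt_mem (k : (Ω × Ω) →ᵇ ℝ) {M : Set Ω} [CompactSpace M] (x : ℕ → M) (N : ℕ)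
    {w : EuclideanSpace ℂ (Fin N)} (hw : ‖w‖ ≤ 1) :
    sampleInt k x N w ∈ {f : C(M, ℂ) | (∀ x, ‖f x‖ ≤ ‖k‖) ∧
      ∀ x x', ‖f x - f x'‖ ≤ kernelModulus k M x x'} := by
  refine ⟨fun y => ((sampleInt k x N w).norm_coe_le_norm y).trans ((norm_sampleInt_le k x N w).trans
    (mul_le_of_le_one_right (norm_nonneg _) hw)), fun y y' => ?_⟩
  rw [sampleInt_apply, sampleInt_apply, ← mul_sub, ← Finset.sum_sub_distrib]
  simp only [← sub_mul]
  refine (norm_inv_sqrt_sum_le (kernelModulus_nonneg k M y y') (fun n => ?_) w).trans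
    (mul_le_of_le_one_right (kernelModulus_nonneg k M y y') hw)
  rw [← Complex.ofReal_sub, Complex.norm_real]
  exact abs_sub_le_kernelModulus k M y y' (x n).2

/-- The data-driven operator factors through the continuous functions on `M`. -/
theorem sampleRestrict_comp_sampleInt (k : (Ω × Ω) →ᵇ ℝ) {M : Set Ω} [CompactSpace M] (x : ℕ → M)
    (N : ℕ) : ((sampleRestrict x N).comp (sampleInt k x N) :
      EuclideanSpace ℂ (Fin N) →ₗ[ℂ] EuclideanSpace ℂ (Fin N)) =
      (WithLp.linearEquiv 2 ℂ (Fin N → ℂ)).symm.conj (dataOp k (fun n => x n) N) := by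
  ext1 w
  change sampleRestrict x N (sampleInt k x N w) = WithLp.toLp 2 (dataOp k (fun n => x n) N w.ofLp)
  ext m
  simp only [sampleRestrict_apply, scaled, sampleInt_apply, dataOp, Matrix.toLin'_apply,
    Matrix.mulVec, dotProduct, Matrix.of_apply]
  rw [← mul_assoc, inv_sqrt_mul_inv_sqrt, Finset.mul_sum]
  exact Finset.sum_congr rfl fun n _ => by ring

theorem isSymmetric_sample (k : (Ω × Ω) →ᵇ ℝ) (hk : ∀ x y, k (x, y) = k (y, x)) {M : Set Ω}
    [CompactSpace M] (x : ℕ → M) (N : ℕ) : ((sampleRestrict x N).comp (sampleInt k x N) :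
      EuclideanSpace ℂ (Fin N) →ₗ[ℂ] EuclideanSpace ℂ (Fin N)).IsSymmetric := by
  intro v w
  change inner ℂ (sampleRestrict x N (sampleInt k x N v)) w
    = inner ℂ v (sampleRestrict x N (sampleInt k x N w))
  simp only [sampleRestrict_apply, scaled, sampleInt_apply, PiLp.inner_apply, RCLike.inner_apply,
    map_mul, map_sum, Complex.conj_ofReal, Finset.mul_sum, Finset.sum_mul]
  rw [Finset.sum_comm]
  refine Finset.sum_congr rfl fun n _ => Finset.sum_congr rfl fun m _ => ?_
  rw [hk]
  ring

theorem IsNthEigenvalue.conj {E E' : Type*} [AddCommGroup E] [Module ℂ E] [AddCommGroup E']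
    [Module ℂ E'] (e : E ≃ₗ[ℂ] E') {A : Module.End ℂ E} {j : ℕ} {r : ℝ}
    (h : IsNthEigenvalue A j r) : IsNthEigenvalue (e.conj A) j r := by
  have hmap : ∀ u : ℂ, Module.End.eigenspace (e.conj A) u
      = (Module.End.eigenspace A u).map (e : E →ₗ[ℂ] E') := by
    intro u
    ext x
    rw [Submodule.mem_map_equiv, Module.End.mem_eigenspace_iff, Module.End.mem_eigenspace_iff,
      LinearEquiv.conj_apply_apply, ← map_smul e.symm, LinearEquiv.eq_symm_apply]
  unfold IsNthEigenvalue at h ⊢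
  have hsup : ∀ P : ℝ → Prop, (⨆ u : {u : ℝ // P u}, Module.End.eigenspace (e.conj A) ((u : ℝ) : ℂ))
      = (⨆ u : {u : ℝ // P u}, Module.End.eigenspace A ((u : ℝ) : ℂ)).map (e : E →ₗ[ℂ] E') := by
    intro P
    rw [Submodule.map_iSup]
    exact iSup_congr fun u => hmap _
  rw [hsup, hsup, LinearEquiv.finrank_map_eq, LinearEquiv.finrank_map_eq]
  exact h

theorem IsNthEigenvalue.isNthOrtho_sample {k : (Ω × Ω) →ᵇ ℝ} (hk : ∀ x y, k (x, y) = k (y, x)) {M : Set Ω}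
    [CompactSpace M] (x : ℕ → M) {N j : ℕ} {r : ℝ}
    (h : IsNthEigenvalue (dataOp k (fun n => x n) N) j r) :
    IsNthOrtho ((sampleRestrict x N).comp (sampleInt k x N) :
      EuclideanSpace ℂ (Fin N) →ₗ[ℂ] EuclideanSpace ℂ (Fin N)) j r := by
  refine IsNthEigenvalue.isNthOrtho (isSymmetric_sample k hk x N) ?_
  rw [sampleRestrict_comp_sampleInt]
  exact h.conj _

end DataOperators

/-! ### The limit of many samples -/

section SampleLimit

variable {Ω : Type*} [MetricSpace Ω] [MeasurableSpace Ω] [BorelSpace Ω] (μ : Measure Ω)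
  [IsProbabilityMeasure μ] {M : Set Ω} [CompactSpace M]

/-- The averages of bounded continuous functions along `x` converge to their `μ`-integrals. -/
def AveragesConverge (x : ℕ → M) : Prop :=
  ∀ f : Ω →ᵇ ℝ, Tendsto (fun N : ℕ => (N : ℝ)⁻¹ * ∑ n ∈ Finset.range N, f (x n)) atTop
    (𝓝 (∫ x, f x ∂μ))

variable {μ}

/-- Continuous functions on the compact set `M` extend to `Ω` by the Tietze theorem. -/
theorem AveragesConverge.tendsto_real (hM : μ Mᶜ = 0) {x : ℕ → M} (hx : AveragesConverge μ x)
    (g : C(M, ℝ)) : Tendsto (fun N : ℕ => (N : ℝ)⁻¹ * ∑ n ∈ Finset.range N, g (x n)) atTop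
      (𝓝 (∫ y : M, g y ∂(μ.comap Subtype.val))) := by
  obtain ⟨f, -, hf⟩ := BoundedContinuousFunction.exists_norm_eq_domRestrict_eq_of_closed
    (BoundedContinuousFunction.mkOfCompact g) (isCompact_iff_compactSpace.2 ‹_›).isClosed
  have hfg : ∀ y : M, f y = g y := fun y => DFunLike.congr_fun hf y
  have := hx f
  rw [integral_eq_integral_subtype μ hM] at this
  simpa only [hfg] using this

theorem integral_zeroExt (hM : μ Mᶜ = 0) (g : C(M, ℂ)) :
    ∫ y, zeroExt g y ∂μ = ∫ y : M, g y ∂(μ.comap Subtype.val) := by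
  rw [integral_eq_integral_subtype μ hM]
  exact integral_congr_ae (ae_of_all _ fun y => zeroExt_of_mem g y.2)

theorem AveragesConverge.tendsto (hM : μ Mᶜ = 0) {x : ℕ → M} (hx : AveragesConverge μ x)
    (g : C(M, ℂ)) : Tendsto (fun N : ℕ => (N : ℂ)⁻¹ * ∑ n ∈ Finset.range N, g (x n)) atTop
      (𝓝 (∫ y, zeroExt g y ∂μ)) := by
  have hfin : IsFiniteMeasure (μ.comap (Subtype.val : M → Ω)) := by
    constructor
    rw [comap_subtype_coe_apply (measurableSet_of_compactSpace M)]
    exact measure_lt_top _ _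
  have hre := hx.tendsto_real hM ⟨fun y => (g y).re, by fun_prop⟩
  have him := hx.tendsto_real hM ⟨fun y => (g y).im, by fun_prop⟩
  have hint : Integrable (fun y : M => g y) (μ.comap Subtype.val) :=
    Integrable.of_bound g.continuous.aestronglyMeasurable ‖g‖ (ae_of_all _ g.norm_coe_le_norm)
  have h1 := ((Complex.continuous_ofReal.tendsto _).comp hre).add
    (((Complex.continuous_ofReal.tendsto _).comp him).mul_const Complex.I)
  rw [integral_zeroExt hM, ← integral_re_add_im hint]
  refine h1.congr fun N => ?_
  simp only [Function.comp, ContinuousMap.coe_mk]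
  push_cast
  rw [mul_assoc, ← mul_add, Finset.sum_mul, ← Finset.sum_add_distrib]
  simp only [Complex.re_add_im]

theorem inner_restrictL2 (f g : C(M, ℂ)) :
    inner ℂ (restrictL2 μ M f) (restrictL2 μ M g) = ∫ y, zeroExt (⇑(star f * g)) y ∂μ := by
  rw [L2.inner_def]
  refine integral_congr_ae ?_
  filter_upwards [coeFn_restrictL2 μ f, coeFn_restrictL2 μ g] with y hf hg
  rw [hf, hg, RCLike.inner_apply]
  by_cases hy : y ∈ M
  · simp [zeroExt_of_mem _ hy, mul_comm]
  · simp [zeroExt, hy]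

/-- For a fixed kernel, the data-driven operators converge to the integral operator with the same
kernel as the number of samples grows. -/
theorem spectralConv_sample (hM : μ Mᶜ = 0) {x : ℕ → M} (hx : AveragesConverge μ x)
    (k : (Ω × Ω) →ᵇ ℝ) :
    SpectralConv atTop (fun N => sampleRestrict x N) (fun N => sampleInt k x N)
      (restrictL2 μ M) (kernelInt μ k M) ‖k‖ := by
  have hcomp : ∀ w : (N : ℕ) → EuclideanSpace ℂ (Fin N), ∀ c : ℝ, (∀ N, ‖w N‖ ≤ c) →
      ∀ U : Ultrafilter ℕ, ∃ p, Tendsto (fun N => sampleInt k x N (w N)) U (𝓝 p) := by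
    intro w c hw U
    obtain ⟨p, -, hp⟩ := (isCompact_setOf_modulus ‖k‖ (kernelModulus k M)
      (tendsto_kernelModulus k M)).ultrafilter_le_nhds
      (U.map fun N => sampleInt k x N (((|c| + 1 : ℝ) : ℂ)⁻¹ • w N)) (by
        rw [le_principal_iff, Ultrafilter.coe_map, mem_map]
        refine univ_mem' fun N => sampleInt_mem k x N ?_
        rw [norm_smul, norm_inv, Complex.norm_real, Real.norm_of_nonneg (by positivity),
          inv_mul_le_one₀ (by positivity)]
        exact (hw N).trans ((le_abs_self c).trans (by linarith)))
    refine ⟨((|c| + 1 : ℝ) : ℂ) • p, ?_⟩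
    have hp' : Tendsto (fun N => sampleInt k x N (((|c| + 1 : ℝ) : ℂ)⁻¹ • w N)) U (𝓝 p) := hp
    refine (hp'.const_smul ((|c| + 1 : ℝ) : ℂ)).congr fun N => ?_
    have : ((|c| + 1 : ℝ) : ℂ) ≠ 0 := by
      have : (|c| + 1 : ℝ) ≠ 0 := by positivity
      exact_mod_cast this
    rw [map_smul, smul_inv_smul₀ this]
  refine ⟨fun f g => ?_, fun N f => norm_sampleRestrict_le x N f,
    fun N w => norm_sampleInt_le k x N w, fun w hw U _ => hcomp w 1 hw U, fun f => ?_⟩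
  · rw [inner_restrictL2]
    refine (hx.tendsto hM (star f * g)).congr fun N => ?_
    simp only [sampleRestrict_apply, inner_scaled, innerN]
    rw [Finset.sum_range]
    rfl
  · -- uniform limits along ultrafilters exist by compactness; they are identified pointwise
    rw [tendsto_iff_ultrafilter]
    intro U hU
    obtain ⟨p, hp⟩ := hcomp (fun N => sampleRestrict x N f) ‖f‖
      (fun N => norm_sampleRestrict_le x N f) U
    suffices hpe : kernelInt μ k M (restrictL2 μ M f) = p by rwa [hpe]
    ext y
    have h1 : Tendsto (fun N => sampleInt k x N (sampleRestrict x N f) y) U (𝓝 (p y)) :=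
      ((continuous_eval_const y).tendsto p).comp hp
    refine tendsto_nhds_unique ?_ h1
    have h2 := (hx.tendsto hM (⟨fun z : M => (k (y, z) : ℂ) * f z, by fun_prop⟩)).mono_left hU
    have h3 : kernelInt μ k M (restrictL2 μ M f) y
        = ∫ z, zeroExt (fun z : M => (k (y, z) : ℂ) * f z) z ∂μ := by
      rw [kernelInt_apply]
      refine integral_congr_ae ?_
      filter_upwards [coeFn_restrictL2 μ f] with z hz
      rw [hz]
      by_cases hz : z ∈ M
      · simp [zeroExt_of_mem _ hz]
      · simp [zeroExt, hz]
    rw [h3]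
    refine h2.congr fun N => ?_
    rw [sampleRestrict_apply, sampleInt_scaled, Finset.sum_range]
    rfl

end SampleLimit

/-! ### The limit of small sampling intervals -/

section KernelLimit

variable {Ω : Type*} [MetricSpace Ω] [MeasurableSpace Ω] [BorelSpace Ω] (μ : Measure Ω)
  [IsProbabilityMeasure μ] {M : Set Ω} [CompactSpace M]

theorem norm_kernelInt_sub_le (hM : μ Mᶜ = 0) {k k' : (Ω × Ω) →ᵇ ℝ} {δ : ℝ} (hδ0 : 0 ≤ δ)
    (hδ : ∀ x ∈ M, ∀ y ∈ M, |k (x, y) - k' (x, y)| ≤ δ) (v : Lp ℂ 2 μ) :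
    ‖kernelInt μ k M v - kernelInt μ k' M v‖ ≤ δ * ‖v‖ :=
  (ContinuousMap.norm_le _ (by positivity)).2 fun x =>
    norm_kernel_integral_sub_le μ hM k k' (hδ x x.2) v

/-- If the kernels converge uniformly on `M × M`, then the integral operators with respect to the
fixed measure `μ` converge. -/
theorem spectralConv_kernel (hM : μ Mᶜ = 0) {ks : ℕ → (Ω × Ω) →ᵇ ℝ} {k : (Ω × Ω) →ᵇ ℝ} {C : ℝ}
    (hC : ∀ i, ‖ks i‖ ≤ C) {δ : ℕ → ℝ} (hδ0 : ∀ i, 0 ≤ δ i)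
    (hδ : ∀ i, ∀ x ∈ M, ∀ y ∈ M, |ks i (x, y) - k (x, y)| ≤ δ i) (hδl : Tendsto δ atTop (𝓝 0)) :
    SpectralConv atTop (fun _ => restrictL2 μ M) (fun i => kernelInt μ (ks i) M)
      (restrictL2 μ M) (kernelInt μ k M) C := by
  refine ⟨fun f g => tendsto_const_nhds, fun _ f => norm_restrictL2_le μ f,
    fun i v => (norm_kernelInt_le μ (ks i) M v).trans
      (mul_le_mul_of_nonneg_right (hC i) (norm_nonneg _)), fun w hw U hU => ?_, fun f => ?_⟩
  · obtain ⟨p, -, hp⟩ := (isCompact_setOf_modulus ‖k‖ (kernelModulus k M)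
      (tendsto_kernelModulus k M)).ultrafilter_le_nhds
      (U.map fun N => kernelInt μ k M (w N)) (by
        rw [le_principal_iff, Ultrafilter.coe_map, mem_map]
        exact univ_mem' fun N => kernelInt_mem μ k hM (hw N))
    have hp' : Tendsto (fun N => kernelInt μ k M (w N)) U (𝓝 p) := hp
    refine ⟨p, ?_⟩
    have h1 : Tendsto (fun i => kernelInt μ (ks i) M (w i) - kernelInt μ k M (w i)) U (𝓝 0) := by
      refine squeeze_zero_norm (fun i => ?_) (hδl.mono_left hU)
      exact (norm_kernelInt_sub_le μ hM (hδ0 i) (hδ i) (w i)).trans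
        (mul_le_of_le_one_right (hδ0 i) (hw i))
    simpa using h1.add hp'
  · rw [tendsto_iff_norm_sub_tendsto_zero]
    refine squeeze_zero (fun i => norm_nonneg _) (fun i => norm_kernelInt_sub_le μ hM (hδ0 i) (hδ i) _) ?_
    simpa using hδl.mul_const _

end KernelLimit

/-! ### Lipschitz estimates for the delay-coordinate kernels -/

section KernelEstimates

/-- On a compact manifold, a `C¹` observable is uniformly Lipschitz in time along the orbits of a
flow generated by a continuous vector field. -/
theorem exists_observable_lipschitz {Ω : Type*} [MetricSpace Ω]
    {Y : Type*} [NormedAddCommGroup Y] [NormedSpace ℝ Y]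
    {E : Type*} [NormedAddCommGroup E] [NormedSpace ℝ E]
    {H : Type*} [TopologicalSpace H] (I : ModelWithCorners ℝ E H) (Φ : Flow ℝ Ω)
    (M : Set Ω) [ChartedSpace H M] [IsManifold I 1 M] [CompactSpace M]
    (hM : ∀ t : ℝ, 0 ≤ t → MapsTo (Φ t) M M)
    (v : (x : M) → TangentSpace I x)
    (hv : Continuous (fun x : M => (⟨x, v x⟩ : TangentBundle I M)))
    (hvΦ : ∀ x : M, IsMIntegralCurveOn (I := I) (forwardOrbit Φ hM x) v (Ici 0))
    (F : C(Ω, Y)) (hF : ContMDiff I 𝓘(ℝ, Y) 1 (fun x : M => F x)) :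
    ∃ L, 0 ≤ L ∧ ∀ x ∈ M, ∀ t, 0 ≤ t → ‖F (Φ t x) - F x‖ ≤ L * t := by
  let w : M → Y := fun x => mfderiv I 𝓘(ℝ, Y) (fun x : M => F x) x (v x)
  have hcont : Continuous w := by
    have h1 : Continuous fun x : M =>
        tangentMap I 𝓘(ℝ, Y) (fun x : M => F x) (⟨x, v x⟩ : TangentBundle I M) :=
      (hF.continuous_tangentMap le_rfl).comp hv
    exact continuous_snd.comp ((tangentBundleModelSpaceHomeomorph 𝓘(ℝ, Y)).continuous.comp h1)
  obtain ⟨L, hL⟩ := (isCompact_range hcont).isBounded.exists_norm_le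
  have hL' : ∀ x : M, ‖w x‖ ≤ |L| := fun x => (hL _ ⟨x, rfl⟩).trans (le_abs_self L)
  refine ⟨|L|, abs_nonneg L, fun x hx t ht => ?_⟩
  have hder : ∀ s ∈ Ici (0 : ℝ), HasDerivWithinAt (fun s => F (forwardOrbit Φ hM ⟨x, hx⟩ s))
      (w (forwardOrbit Φ hM ⟨x, hx⟩ s)) (Ici 0) s := by
    intro s hs
    have h1 := hvΦ ⟨x, hx⟩ s hs
    have h2 := (hF.mdifferentiableAt one_ne_zero
      (x := forwardOrbit Φ hM ⟨x, hx⟩ s)).hasMFDerivAt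
    let A : ℝ →L[ℝ] Y := (mfderiv I 𝓘(ℝ, Y) (fun x : M => F x) (forwardOrbit Φ hM ⟨x, hx⟩ s)).comp
      ((1 : ℝ →L[ℝ] ℝ).smulRight (v (forwardOrbit Φ hM ⟨x, hx⟩ s)))
    have h3 : HasFDerivWithinAt (fun s => F (forwardOrbit Φ hM ⟨x, hx⟩ s)) A (Ici 0) s :=
      hasMFDerivWithinAt_iff_hasFDerivWithinAt.1 (h2.comp_hasMFDerivWithinAt s h1)
    have h4 : A 1 = w (forwardOrbit Φ hM ⟨x, hx⟩ s) := by
      change mfderiv I 𝓘(ℝ, Y) (fun x : M => F x) (forwardOrbit Φ hM ⟨x, hx⟩ s)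
        ((1 : ℝ) • v (forwardOrbit Φ hM ⟨x, hx⟩ s)) = _
      rw [one_smul]
    rw [← h4]
    exact h3.hasDerivWithinAt
  have h5 := (convex_Ici (0 : ℝ)).norm_image_sub_le_of_norm_hasDerivWithin_le hder
    (fun s _ => hL' _) (mem_Ici.2 le_rfl) (mem_Ici.2 ht)
  have h6 : ∀ s, 0 ≤ s → (forwardOrbit Φ hM ⟨x, hx⟩ s : Ω) = Φ s x := fun s hs => by
    simp [forwardOrbit, max_eq_left hs]
  simpa [h6 t ht, h6 0 le_rfl, abs_of_nonneg ht] using h5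

/-- Left-endpoint Riemann sums of a function that is Lipschitz on `[0, ∞)` converge with an error
that is linear in the step `T / Q`. -/
theorem abs_riemannSum_sub_integral_le {g : ℝ → ℝ} (hg : Continuous g) {K T : ℝ} (hT : 0 < T)
    (hK : 0 ≤ K) (hgl : ∀ s t, 0 ≤ s → s ≤ t → |g t - g s| ≤ K * (t - s)) {Q : ℕ} (hQ : 0 < Q) :
    |(Q : ℝ)⁻¹ * ∑ q ∈ Finset.range Q, g (q * (T / Q)) - T⁻¹ * ∫ t in (0 : ℝ)..T, g t|
      ≤ K * (T / Q) := by
  have hQ' : (0 : ℝ) < Q := by exact_mod_cast hQ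
  set a : ℕ → ℝ := fun q => q * (T / Q) with ha
  have hda : ∀ q, a (q + 1) - a q = T / Q := fun q => by simp only [ha]; push_cast; ring
  have hTQ : 0 < T / Q := by positivity
  have hsum : ∑ q ∈ Finset.range Q, ∫ t in a q..a (q + 1), g t = ∫ t in (0 : ℝ)..T, g t := by
    rw [intervalIntegral.sum_integral_adjacent_intervals fun q _ => hg.intervalIntegrable _ _]
    congr 1
    · simp [ha]
    · simp only [ha]; field_simp
  have hterm : ∀ q, |(T / Q) * g (a q) - ∫ t in a q..a (q + 1), g t| ≤ K * (T / Q) * (T / Q) := by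
    intro q
    have h1 : (T / Q) * g (a q) = ∫ t in a q..a (q + 1), g (a q) := by
      rw [intervalIntegral.integral_const, hda, smul_eq_mul]
    rw [h1, ← intervalIntegral.integral_sub (by simp) (hg.intervalIntegrable _ _)]
    have h2 := intervalIntegral.norm_integral_le_of_norm_le_const (a := a q) (b := a (q + 1))
      (f := fun t => g (a q) - g t) (C := K * (T / Q)) (fun t ht => by
        have hle : a q ≤ a (q + 1) := by linarith [hda q]
        rw [uIoc_of_le hle] at ht
        rw [norm_sub_rev, Real.norm_eq_abs]
        refine (hgl _ _ (by positivity) ht.1.le).trans (mul_le_mul_of_nonneg_left ?_ hK)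
        linarith [hda q, ht.2])
    rwa [hda, abs_of_pos hTQ, Real.norm_eq_abs] at h2
  have hmain : |∑ q ∈ Finset.range Q, ((T / Q) * g (a q) - ∫ t in a q..a (q + 1), g t)|
      ≤ Q * (K * (T / Q) * (T / Q)) := by
    refine (Finset.abs_sum_le_sum_abs _ _).trans ((Finset.sum_le_sum fun q _ => hterm q).trans ?_)
    simp
  rw [Finset.sum_sub_distrib, hsum, ← Finset.mul_sum] at hmain
  have heq : (Q : ℝ)⁻¹ * ∑ q ∈ Finset.range Q, g (a q) - T⁻¹ * ∫ t in (0 : ℝ)..T, g t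
      = T⁻¹ * ((T / Q) * ∑ q ∈ Finset.range Q, g (a q) - ∫ t in (0 : ℝ)..T, g t) := by
    field_simp
  rw [heq, abs_mul, abs_of_pos (inv_pos.2 hT)]
  calc _ ≤ T⁻¹ * (Q * (K * (T / Q) * (T / Q))) := mul_le_mul_of_nonneg_left hmain (by positivity)
    _ = K * (T / Q) := by field_simp

theorem ShapeFunction.exists_lipschitz (h : ShapeFunction) :
    ∃ C, 0 ≤ C ∧ ∀ u u', 0 ≤ u → 0 ≤ u' → |h.toFun u - h.toFun u'| ≤ C * |u - u'| := by
  obtain ⟨C, hC⟩ := h.deriv_bounded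
  refine ⟨|C|, abs_nonneg C, fun u u' hu hu' => ?_⟩
  exact (convex_Ici (0 : ℝ)).norm_image_sub_le_of_norm_derivWithin_le
    (h.contDiffOn.differentiableOn one_ne_zero) (fun x hx => (hC x hx).trans (le_abs_self C))
    (mem_Ici.2 hu') (mem_Ici.2 hu)

variable {Ω : Type*} [MetricSpace Ω] {Y : Type*} [NormedAddCommGroup Y]

theorem sqDist_comm (F : C(Ω, Y)) (x y : Ω) : sqDist F (x, y) = sqDist F (y, x) := by
  simp only [sqDist, norm_sub_rev]

theorem kernel_comm (h : ShapeFunction) (Φ : Flow ℝ Ω) (F : C(Ω, Y)) (T : ℝ) (x y : Ω) :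
    kernel h Φ F T (x, y) = kernel h Φ F T (y, x) := by
  change h.toFun (delaySqDist Φ F T (x, y)) = h.toFun (delaySqDist Φ F T (y, x))
  simp only [delaySqDist, sqDist_comm F (Φ _ x)]

theorem kernelDisc_comm (h : ShapeFunction) (Φ : Flow ℝ Ω) (F : C(Ω, Y)) (T : ℝ) (Q : ℕ) (x y : Ω) :
    kernelDisc h Φ F T Q (x, y) = kernelDisc h Φ F T Q (y, x) := by
  change h.toFun (delaySqDistDisc Φ F T Q (x, y)) = h.toFun (delaySqDistDisc Φ F T Q (y, x))
  simp only [delaySqDistDisc, sqDist_comm F (Φ _ x)]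

theorem norm_kernelDisc_le (h : ShapeFunction) (Φ : Flow ℝ Ω) (F : C(Ω, Y)) (T : ℝ) (Q : ℕ) :
    ‖kernelDisc h Φ F T Q‖ ≤ h.bounded.choose :=
  BoundedContinuousFunction.norm_ofNormedAddCommGroup_le _
    ((h.pos 0 le_rfl).le.trans (h.bounded.choose_spec 0 le_rfl)) fun p => by
      rw [Real.norm_of_nonneg (h.pos _ (delaySqDistDisc_nonneg Φ F T Q p)).le]
      exact h.bounded.choose_spec _ (delaySqDistDisc_nonneg Φ F T Q p)

theorem abs_sqDist_sub_le {F : C(Ω, Y)} {B δ δ' : ℝ} {x y x' y' : Ω} (hx : ‖F x‖ ≤ B)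
    (hy : ‖F y‖ ≤ B) (hx' : ‖F x'‖ ≤ B) (hy' : ‖F y'‖ ≤ B) (h1 : ‖F x - F x'‖ ≤ δ)
    (h2 : ‖F y - F y'‖ ≤ δ') : |sqDist F (x, y) - sqDist F (x', y')| ≤ 4 * B * (δ + δ') := by
  have hB : 0 ≤ B := (norm_nonneg _).trans hx
  have e1 : |‖F x - F y‖ - ‖F x' - F y'‖| ≤ δ + δ' := by
    refine (abs_norm_sub_norm_le _ _).trans ?_
    have : F x - F y - (F x' - F y') = (F x - F x') - (F y - F y') := by abel
    rw [this]
    exact (norm_sub_le _ _).trans (add_le_add h1 h2)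
  have e2 : ‖F x - F y‖ ≤ 2 * B := (norm_sub_le _ _).trans (by linarith)
  have e3 : ‖F x' - F y'‖ ≤ 2 * B := (norm_sub_le _ _).trans (by linarith)
  have : sqDist F (x, y) - sqDist F (x', y')
      = (‖F x - F y‖ + ‖F x' - F y'‖) * (‖F x - F y‖ - ‖F x' - F y'‖) := by
    simp only [sqDist]; ring
  rw [this, abs_mul, abs_of_nonneg (by positivity)]
  exact mul_le_mul (by linarith) e1 (abs_nonneg _) (by positivity)

/-- The kernels are Lipschitz along orbits, uniformly in the sampling interval, and `k_{T,Δt}`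
converges to `k_T` uniformly on `M × M`. The norm of `Y` need not be differentiable, so that the
kernels need not be `C¹`. -/
theorem exists_kernel_estimates (h : ShapeFunction) (Φ : Flow ℝ Ω) (F : C(Ω, Y)) {T : ℝ}
    (hT : 0 < T) {M : Set Ω} [CompactSpace M] (hM : ∀ t : ℝ, 0 ≤ t → MapsTo (Φ t) M M) {L : ℝ}
    (hL0 : 0 ≤ L) (hL : ∀ x ∈ M, ∀ t, 0 ≤ t → ‖F (Φ t x) - F x‖ ≤ L * t) :
    ∃ K, 0 ≤ K ∧
      (∀ x ∈ M, ∀ y ∈ M, ∀ τ, 0 ≤ τ →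
        |kernel h Φ F T (Φ τ x, y) - kernel h Φ F T (x, y)| ≤ K * τ) ∧
      (∀ Q : ℕ, 0 < Q → ∀ x ∈ M, ∀ y ∈ M, ∀ τ, 0 ≤ τ →
        |kernelDisc h Φ F T Q (Φ τ x, y) - kernelDisc h Φ F T Q (x, y)| ≤ K * τ) ∧
      (∀ Q : ℕ, 0 < Q → ∀ x ∈ M, ∀ y ∈ M,
        |kernelDisc h Φ F T Q (x, y) - kernel h Φ F T (x, y)| ≤ K * (T / Q)) := by
  obtain ⟨Ch, hCh0, hCh⟩ := h.exists_lipschitz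
  obtain ⟨B', hB'⟩ := ((isCompact_iff_compactSpace.2 ‹_› : IsCompact M).image
    F.continuous).isBounded.exists_norm_le
  obtain ⟨B, hB0, hB⟩ : ∃ B, 0 ≤ B ∧ ∀ x ∈ M, ‖F x‖ ≤ B :=
    ⟨|B'|, abs_nonneg _, fun x hx => (hB' _ ⟨x, hx, rfl⟩).trans (le_abs_self _)⟩
  have hshift : ∀ x ∈ M, ∀ y ∈ M, ∀ τ, 0 ≤ τ → ∀ t, 0 ≤ t →
      |sqDist F (Φ t (Φ τ x), Φ t y) - sqDist F (Φ t x, Φ t y)| ≤ 8 * B * L * τ := by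
    intro x hx y hy τ hτ t ht
    have hcomm : Φ t (Φ τ x) = Φ τ (Φ t x) := by rw [← Φ.map_add, ← Φ.map_add, add_comm]
    rw [hcomm]
    refine (abs_sqDist_sub_le (hB _ (hM τ hτ (hM t ht hx))) (hB _ (hM t ht hy)) (hB _ (hM t ht hx))
      (hB _ (hM t ht hy)) (hL _ (hM t ht hx) τ hτ) (δ' := 0) (by simp)).trans ?_
    have : 0 ≤ B * L * τ := by positivity
    linarith
  have hTQ : ∀ Q q : ℕ, 0 ≤ (q : ℝ) * (T / Q) := fun Q q => by positivity
  refine ⟨Ch * (8 * B * L), by positivity, ?_, ?_, ?_⟩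
  · intro x hx y hy τ hτ
    refine (hCh _ _ (delaySqDist_nonneg Φ F T _) (delaySqDist_nonneg Φ F T _)).trans ?_
    rw [mul_assoc]
    refine mul_le_mul_of_nonneg_left ?_ hCh0
    simp only [delaySqDist]
    have hint : ∀ p : Ω × Ω, IntervalIntegrable (fun t => sqDist F (Φ t p.1, Φ t p.2)) volume 0 T :=
      fun p => ((continuous_sqDist F).comp ((Φ.continuous continuous_id continuous_const).prodMk
        (Φ.continuous continuous_id continuous_const))).intervalIntegrable _ _
    rw [← mul_sub, ← intervalIntegral.integral_sub (hint (Φ τ x, y)) (hint (x, y)), abs_mul,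
      abs_of_pos (inv_pos.2 hT), inv_mul_le_iff₀ hT]
    have := intervalIntegral.norm_integral_le_of_norm_le_const (a := 0) (b := T)
      (f := fun t => sqDist F (Φ t (Φ τ x), Φ t y) - sqDist F (Φ t x, Φ t y))
      (C := 8 * B * L * τ) (fun t ht => by
        rw [uIoc_of_le hT.le] at ht
        exact hshift x hx y hy τ hτ t ht.1.le)
    rw [sub_zero, abs_of_pos hT, Real.norm_eq_abs] at this
    linarith
  · intro Q hQ x hx y hy τ hτ
    refine (hCh _ _ (delaySqDistDisc_nonneg Φ F T Q _) (delaySqDistDisc_nonneg Φ F T Q _)).trans ?_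
    rw [mul_assoc]
    refine mul_le_mul_of_nonneg_left ?_ hCh0
    have hQ' : (0 : ℝ) < Q := by exact_mod_cast hQ
    simp only [delaySqDistDisc]
    rw [← mul_sub, ← Finset.sum_sub_distrib, abs_mul, abs_of_pos (inv_pos.2 hQ'),
      inv_mul_le_iff₀ hQ']
    refine (Finset.abs_sum_le_sum_abs _ _).trans
      ((Finset.sum_le_sum fun q _ => hshift x hx y hy τ hτ _ (hTQ Q q)).trans ?_)
    simp
  · intro Q hQ x hx y hy
    refine (hCh _ _ (delaySqDistDisc_nonneg Φ F T Q _) (delaySqDist_nonneg Φ F T _)).trans ?_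
    rw [mul_assoc]
    refine mul_le_mul_of_nonneg_left ?_ hCh0
    have hstep : ∀ z ∈ M, ∀ s t, 0 ≤ s → s ≤ t → ‖F (Φ t z) - F (Φ s z)‖ ≤ L * (t - s) := by
      intro z hz s t hs hst
      have : Φ t z = Φ (t - s) (Φ s z) := by rw [← Φ.map_add, sub_add_cancel]
      rw [this]
      exact hL _ (hM s hs hz) _ (sub_nonneg.2 hst)
    refine abs_riemannSum_sub_integral_le (g := fun t => sqDist F (Φ t x, Φ t y))
      ((continuous_sqDist F).comp ((Φ.continuous continuous_id continuous_const).prodMk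
        (Φ.continuous continuous_id continuous_const))) hT (by positivity) ?_ hQ
    intro s t hs hst
    have ht := hs.trans hst
    refine (abs_sqDist_sub_le (hB _ (hM t ht hx)) (hB _ (hM t ht hy)) (hB _ (hM s hs hx))
      (hB _ (hM s hs hy)) (hstep x hx s t hs hst) (hstep y hy s t hs hst)).trans (le_of_eq ?_)
    ring

end KernelEstimates

/-! ### The Koopman group and its generator -/

section Generator

variable {Ω : Type*} [MetricSpace Ω] [MeasurableSpace Ω] {Φ : Flow ℝ Ω} {μ : Measure Ω}

theorem coeFn_koopman (hΦ : IsErgodicFlow Φ μ) (t : ℝ) (f : Lp ℂ 2 μ) :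
    (koopman hΦ t f : Ω → ℂ) =ᵐ[μ] f ∘ Φ t :=
  Lp.coeFn_compMeasurePreserving f (hΦ.measurePreserving t)

theorem koopman_neg_koopman (hΦ : IsErgodicFlow Φ μ) (t : ℝ) (f : Lp ℂ 2 μ) :
    koopman hΦ (-t) (koopman hΦ t f) = f := by
  refine Lp.ext ?_
  filter_upwards [coeFn_koopman hΦ (-t) (koopman hΦ t f),
    (hΦ.measurePreserving (-t)).quasiMeasurePreserving.ae (coeFn_koopman hΦ t f)] with x h1 h2
  rw [h1, Function.comp, h2, Function.comp, ← Φ.map_add, add_neg_cancel, Φ.map_zero_apply]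

theorem koopman_zero (hΦ : IsErgodicFlow Φ μ) (f : Lp ℂ 2 μ) : koopman hΦ 0 f = f := by
  refine Lp.ext ?_
  filter_upwards [coeFn_koopman hΦ 0 f] with x h1
  rw [h1, Function.comp, Φ.map_zero_apply]

theorem inner_koopman (hΦ : IsErgodicFlow Φ μ) (t : ℝ) (g f : Lp ℂ 2 μ) :
    inner ℂ g (koopman hΦ t f) = inner ℂ (koopman hΦ (-t) g) f := by
  rw [← (koopman hΦ (-t)).inner_map_map g, koopman_neg_koopman]

/-- Almost every orbit stays in a forward-invariant set of full measure for all times. -/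
theorem ae_forall_flow_mem (hΦ : IsErgodicFlow Φ μ) {M : Set Ω} (hμM : μ Mᶜ = 0)
    (hM : ∀ t : ℝ, 0 ≤ t → MapsTo (Φ t) M M) : ∀ᵐ x ∂μ, ∀ t : ℝ, Φ t x ∈ M := by
  have hM' : ∀ᵐ y ∂μ, y ∈ M := by rw [ae_iff]; exact hμM
  have h1 : ∀ᵐ x ∂μ, ∀ n : ℕ, Φ (-(n : ℝ)) x ∈ M := by
    rw [ae_all_iff]
    exact fun n => (hΦ.measurePreserving _).quasiMeasurePreserving.ae hM'
  filter_upwards [h1] with x hx t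
  obtain ⟨n, hn⟩ := exists_nat_ge (-t)
  have : Φ t x = Φ (t + n) (Φ (-(n : ℝ)) x) := by rw [← Φ.map_add, add_neg_cancel_right]
  rw [this]
  exact hM _ (by linarith) (hx n)

variable [BorelSpace Ω] [IsProbabilityMeasure μ]

/-- A function that is Lipschitz along orbits lies in the domain of the generator: by Rademacher's
theorem it is differentiable at almost every time of almost every orbit, by Fubini's theorem and
invariance at time `0` of almost every orbit, and the difference quotients converge in `L²(μ)` by
dominated convergence. -/
theorem exists_hasDerivAt_koopman (hΦ : IsErgodicFlow Φ μ) {M : Set Ω} (hμM : μ Mᶜ = 0)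
    (hM : ∀ t : ℝ, 0 ≤ t → MapsTo (Φ t) M M) {p : Ω → ℂ} (hp : Continuous p) {C : ℝ} (hC : 0 ≤ C)
    (hpl : ∀ x ∈ M, ∀ τ, 0 ≤ τ → ‖p (Φ τ x) - p x‖ ≤ C * τ) {f : Lp ℂ 2 μ} (hf : f =ᵐ[μ] p) :
    ∃ χ : Lp ℂ 2 μ, HasDerivAt (fun t : ℝ => koopman hΦ t f) χ 0 := by
  let q : Ω → ℝ → ℂ := fun x t => p (Φ t x)
  have hq : Continuous q.uncurry :=
    hp.comp (Φ.continuous continuous_snd continuous_fst)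
  have hG := ae_forall_flow_mem hΦ hμM hM
  have hlip : ∀ x, (∀ t : ℝ, Φ t x ∈ M) → LipschitzWith (Real.toNNReal C) (q x) := by
    intro x hx
    have key : ∀ s t, s ≤ t → ‖q x t - q x s‖ ≤ C * (t - s) := by
      intro s t hst
      have : Φ t x = Φ (t - s) (Φ s x) := by rw [← Φ.map_add, sub_add_cancel]
      simp only [q]
      rw [this]
      exact hpl _ (hx s) _ (sub_nonneg.2 hst)
    refine LipschitzWith.of_dist_le_mul fun s t => ?_
    rw [Real.coe_toNNReal _ hC, dist_eq_norm, Real.dist_eq]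
    rcases le_total s t with h | h
    · rw [norm_sub_rev, abs_sub_comm, abs_of_nonneg (sub_nonneg.2 h)]
      exact key s t h
    · rw [abs_of_nonneg (sub_nonneg.2 h)]
      exact key t s h
  have hmeas : MeasurableSet {z : Ω × ℝ | DifferentiableAt ℝ (q z.1) z.2} :=
    measurableSet_of_differentiableAt_with_param ℝ hq
  have h1 : ∀ᵐ x ∂μ, ∀ᵐ t : ℝ, DifferentiableAt ℝ (q x) t := by
    filter_upwards [hG] with x hx
    exact (hlip x hx).ae_differentiableAt_real
  have h2 := (Measure.ae_ae_comm (p := fun x t => DifferentiableAt ℝ (q x) t) hmeas).1 h1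
  obtain ⟨t₀, ht₀⟩ := h2.exists
  -- invariance of `μ` under `Φ (-t₀)` moves differentiability from time `t₀` to time `0`
  have h3 : ∀ᵐ x ∂μ, DifferentiableAt ℝ (q x) 0 := by
    filter_upwards [(hΦ.measurePreserving (-t₀)).quasiMeasurePreserving.ae ht₀] with x hx
    have h4 : q x = q (Φ (-t₀) x) ∘ fun t => t + t₀ := by
      ext t
      simp only [q, Function.comp]
      rw [← Φ.map_add, add_neg_cancel_right]
    rw [h4]
    refine DifferentiableAt.comp _ ?_ (by fun_prop)
    rwa [zero_add]
  have hχm : Measurable fun x => deriv (q x) 0 :=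
    (measurable_deriv_with_param hq).comp (measurable_id.prodMk measurable_const)
  have hχb : ∀ᵐ x ∂μ, ‖deriv (q x) 0‖ ≤ C := by
    filter_upwards [hG] with x hx
    simpa [hC] using norm_deriv_le_of_lipschitz (x₀ := 0) (hlip x hx)
  have hχL : MemLp (fun x => deriv (q x) 0) 2 μ := MemLp.of_bound hχm.aestronglyMeasurable C hχb
  refine ⟨hχL.toLp _, ?_⟩
  rw [hasDerivAt_iff_tendsto_slope_zero, tendsto_iff_norm_sub_tendsto_zero]
  have hpt : ∀ t : ℝ, ∀ᵐ x ∂μ, (t⁻¹ • (koopman hΦ (0 + t) f - koopman hΦ 0 f) - hχL.toLp _ :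
      Lp ℂ 2 μ) x = t⁻¹ • (q x t - q x 0) - deriv (q x) 0 := by
    intro t
    rw [zero_add]
    filter_upwards [Lp.coeFn_sub (t⁻¹ • (koopman hΦ t f - koopman hΦ 0 f)) (hχL.toLp _),
      Lp.coeFn_smul t⁻¹ (koopman hΦ t f - koopman hΦ 0 f),
      Lp.coeFn_sub (koopman hΦ t f) (koopman hΦ 0 f), hχL.coeFn_toLp, coeFn_koopman hΦ t f,
      coeFn_koopman hΦ 0 f, (hΦ.measurePreserving t).quasiMeasurePreserving.ae hf,
      (hΦ.measurePreserving 0).quasiMeasurePreserving.ae hf] with x e1 e2 e3 e4 e5 e6 e7 e8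
    rw [e1, Pi.sub_apply, e2, Pi.smul_apply, e3, Pi.sub_apply, e4, e5, e6, Function.comp,
      Function.comp, e7, e8]
  have hlim : Tendsto (fun t : ℝ => ∫ x, inner ℂ (t⁻¹ • (q x t - q x 0) - deriv (q x) 0)
      (t⁻¹ • (q x t - q x 0) - deriv (q x) 0) ∂μ) (𝓝[≠] 0) (𝓝 0) := by
    have hq0 : ∀ t, Measurable fun x => q x t := fun t =>
      (hq.comp (continuous_id.prodMk continuous_const)).measurable
    have h5 := tendsto_integral_filter_of_dominated_convergence (μ := μ) (l := 𝓝[≠] (0 : ℝ))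
      (F := fun t x => inner ℂ (t⁻¹ • (q x t - q x 0) - deriv (q x) 0)
        (t⁻¹ • (q x t - q x 0) - deriv (q x) 0)) (f := fun _ => (0 : ℂ)) (fun _ => (C + C) * (C + C))
      (Eventually.of_forall fun t => ?_) (Eventually.of_forall fun t => ?_)
      (integrable_const _) ?_
    · simpa using h5
    · have h6 : Measurable fun x => q x t - q x 0 := (hq0 t).sub (hq0 0)
      have h7 : Measurable fun x => t⁻¹ • (q x t - q x 0) := h6.const_smul t⁻¹
      have : Measurable fun x => t⁻¹ • (q x t - q x 0) - deriv (q x) 0 := h7.sub hχm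
      exact (this.inner this).aestronglyMeasurable
    · filter_upwards [hG, hχb] with x hx hb
      have hle : ‖t⁻¹ • (q x t - q x 0) - deriv (q x) 0‖ ≤ C + C := by
        refine (norm_sub_le _ _).trans (add_le_add ?_ hb)
        rw [norm_smul, norm_inv, ← dist_eq_norm]
        have := (hlip x hx).dist_le_mul t 0
        rw [Real.coe_toNNReal _ hC, dist_zero_right] at this
        rcases eq_or_ne t 0 with rfl | ht
        · simpa using hC
        · rw [inv_mul_le_iff₀ (norm_pos_iff.2 ht), mul_comm]
          exact this
      exact (norm_inner_le_norm _ _).trans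
        (mul_le_mul hle hle (norm_nonneg _) (by positivity))
    · filter_upwards [h3] with x hx
      have h6 := hasDerivAt_iff_tendsto_slope_zero.1 hx.hasDerivAt
      simp only [zero_add] at h6
      have h7 := h6.sub_const (deriv (q x) 0)
      rw [sub_self] at h7
      simpa using h7.inner h7 (𝕜 := ℂ)
  have h8 : Tendsto (fun t : ℝ => ‖t⁻¹ • (koopman hΦ (0 + t) f - koopman hΦ 0 f)
      - hχL.toLp _‖ ^ 2) (𝓝[≠] 0) (𝓝 0) := by
    have h9 := (Complex.continuous_re.tendsto _).comp hlim
    refine (h9.congr fun t => ?_).trans_eq (by simp)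
    simp only [Function.comp]
    rw [← inner_self_eq_norm_sq (𝕜 := ℂ), L2.inner_def]
    congr 1
    refine integral_congr_ae ?_
    filter_upwards [hpt t] with x hx
    rw [hx]
  have h10 := (Real.continuous_sqrt.tendsto _).comp h8
  simpa [Function.comp_def, Real.sqrt_sq (norm_nonneg _)] using h10

/-- Difference quotients of varying functions may be paired with varying functions in the limit:
the difference quotient is moved to the other, fixed, factor by antisymmetry. -/
theorem tendsto_inner_difference (hΦ : IsErgodicFlow Φ μ) {φ ψ χ η : Lp ℂ 2 μ}
    (hφ : HasDerivAt (fun t : ℝ => koopman hΦ t φ) χ 0)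
    (hψ : HasDerivAt (fun t : ℝ => koopman hΦ t ψ) η 0) {f g : ℕ → Lp ℂ 2 μ} {τ : ℕ → ℝ}
    (hτ : Tendsto τ atTop (𝓝 0)) (hτ0 : ∀ k, τ k ≠ 0) (hf : Tendsto f atTop (𝓝 φ))
    (hg : Tendsto g atTop (𝓝 ψ)) {C : ℝ}
    (hC : ∀ᶠ k in atTop, ‖(τ k)⁻¹ • (koopman hΦ (τ k) (f k) - f k)‖ ≤ C) :
    Tendsto (fun k => inner ℂ (g k) ((τ k)⁻¹ • (koopman hΦ (τ k) (f k) - f k))) atTop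
      (𝓝 (inner ℂ ψ χ)) := by
  have hquot : ∀ {θ ξ : Lp ℂ 2 μ}, HasDerivAt (fun t : ℝ => koopman hΦ t θ) ξ 0 →
      ∀ {σ : ℕ → ℝ}, Tendsto σ atTop (𝓝 0) → (∀ k, σ k ≠ 0) →
      Tendsto (fun k => (σ k)⁻¹ • (koopman hΦ (σ k) θ - θ)) atTop (𝓝 ξ) := by
    intro θ ξ hθ σ hσ hσ0
    have h1 := hasDerivAt_iff_tendsto_slope_zero.1 hθ
    have h2 : Tendsto σ atTop (𝓝[≠] 0) :=
      tendsto_nhdsWithin_iff.2 ⟨hσ, Eventually.of_forall hσ0⟩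
    simpa [Function.comp_def, koopman_zero] using h1.comp h2
  have hadj : ∀ (k : ℕ) (θ : Lp ℂ 2 μ),
      inner ℂ ψ ((τ k)⁻¹ • (koopman hΦ (τ k) θ - θ))
        = -inner ℂ ((-τ k)⁻¹ • (koopman hΦ (-τ k) ψ - ψ)) θ := by
    intro k θ
    have e0 : ∀ (r : ℝ) (b : Lp ℂ 2 μ), r • b = (r : ℂ) • b :=
      fun r b => RCLike.real_smul_eq_coe_smul (K := ℂ) r b
    have e1 : ∀ (r : ℝ) (a b : Lp ℂ 2 μ), inner ℂ a (r • b) = (r : ℂ) * inner ℂ a b := fun r a b => by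
      rw [e0, inner_smul_right]
    have e2 : ∀ (r : ℝ) (a b : Lp ℂ 2 μ), inner ℂ (r • a) b = (r : ℂ) * inner ℂ a b := fun r a b => by
      rw [e0, inner_smul_left, Complex.conj_ofReal]
    rw [e1, e2, inner_sub_right, inner_sub_left, inner_koopman, inv_neg]
    push_cast
    ring
  have hneg : Tendsto (fun k => (-τ k)⁻¹ • (koopman hΦ (-τ k) ψ - ψ)) atTop (𝓝 η) :=
    hquot hψ (by simpa using hτ.neg) (fun k => neg_ne_zero.2 (hτ0 k))
  have hlim : ∀ θ : ℕ → Lp ℂ 2 μ, Tendsto θ atTop (𝓝 φ) →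
      Tendsto (fun k => inner ℂ ψ ((τ k)⁻¹ • (koopman hΦ (τ k) (θ k) - θ k))) atTop
        (𝓝 (-inner ℂ η φ)) := fun θ hθ => by
    simp only [hadj]
    exact (hneg.inner hθ).neg
  have heq : inner ℂ ψ χ = -inner ℂ η φ :=
    tendsto_nhds_unique (tendsto_const_nhds.inner (hquot hφ hτ hτ0))
      (hlim (fun _ => φ) tendsto_const_nhds)
  rw [heq]
  have h1 : Tendsto (fun k => inner ℂ (g k - ψ) ((τ k)⁻¹ • (koopman hΦ (τ k) (f k) - f k))) atTop
      (𝓝 0) := by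
    have h2 : Tendsto (fun k => ‖g k - ψ‖ * C) atTop (𝓝 0) := by
      simpa using (hg.sub_const ψ).norm.mul_const C
    refine squeeze_zero_norm' ?_ h2
    filter_upwards [hC] with k hk
    exact (norm_inner_le_norm _ _).trans (mul_le_mul_of_nonneg_left hk (norm_nonneg _))
  have h3 := h1.add (hlim f hf)
  rw [zero_add] at h3
  refine h3.congr fun k => ?_
  rw [inner_sub_left, sub_add_cancel]

end Generator

/-! ### Empirical correlations -/

section Correlations

variable {Ω : Type*} [MetricSpace Ω] {Φ : Flow ℝ Ω} {M : Set Ω}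

/-- The time-`τ` map, `τ ≥ 0`, on the forward-invariant set `M`. -/
def forwardMap (hM : ∀ t : ℝ, 0 ≤ t → MapsTo (Φ t) M M) {τ : ℝ} (hτ : 0 ≤ τ) : C(M, M) :=
  ⟨fun x => ⟨Φ τ x, hM τ hτ x.2⟩, by
    exact ((Φ.continuous continuous_const continuous_subtype_val).subtype_mk _)⟩

/-- The sampled states as points of `M`. -/
def sampleM (hM : ∀ t : ℝ, 0 ≤ t → MapsTo (Φ t) M M) {x₀ : Ω} (hx₀ : x₀ ∈ M) {τ : ℝ} (hτ : 0 ≤ τ)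
    (n : ℕ) : M := ⟨sample Φ x₀ τ n, hM _ (by positivity) hx₀⟩

theorem sampleM_add (hM : ∀ t : ℝ, 0 ≤ t → MapsTo (Φ t) M M) {x₀ : Ω} (hx₀ : x₀ ∈ M) {τ : ℝ}
    (hτ : 0 ≤ τ) (n q : ℕ) : sampleM hM hx₀ hτ (n + q)
      = forwardMap hM (τ := q * τ) (by positivity) (sampleM hM hx₀ hτ n) := by
  refine Subtype.ext ?_
  change Φ ((n + q : ℕ) * τ) x₀ = Φ (q * τ) (Φ (n * τ) x₀)
  rw [← Φ.map_add]
  congr 1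
  push_cast
  ring

variable [MeasurableSpace Ω] [BorelSpace Ω] {μ : Measure Ω} [IsProbabilityMeasure μ]
  [CompactSpace M]

theorem koopman_restrictL2 (hΦ : IsErgodicFlow Φ μ) (hμM : μ Mᶜ = 0)
    (hM : ∀ t : ℝ, 0 ≤ t → MapsTo (Φ t) M M) {τ : ℝ} (hτ : 0 ≤ τ) (f : C(M, ℂ)) :
    koopman hΦ τ (restrictL2 μ M f) = restrictL2 μ M (f.comp (forwardMap hM hτ)) := by
  have hM' : ∀ᵐ y ∂μ, y ∈ M := by rw [ae_iff]; exact hμM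
  refine Lp.ext ?_
  filter_upwards [hM', coeFn_koopman hΦ τ (restrictL2 μ M f),
    (hΦ.measurePreserving τ).quasiMeasurePreserving.ae (coeFn_restrictL2 μ f),
    coeFn_restrictL2 μ (f.comp (forwardMap hM hτ))] with x hx e1 e2 e3
  rw [e1, Function.comp, e2, e3, zeroExt_of_mem _ hx, zeroExt_of_mem _ (hM τ hτ hx)]
  rfl

/-- The zero padding in the shift affects at most `q` of the `N` entries. -/
theorem norm_innerN_shift_sub_le {N : ℕ} (q : ℕ) (a b : ℕ → ℂ) {A B : ℝ} (ha : ∀ n, ‖a n‖ ≤ A)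
    (hb : ∀ n, ‖b n‖ ≤ B) :
    ‖innerN (fun n : Fin N => a n) (shift q fun n : Fin N => b n)
      - innerN (fun n : Fin N => a n) (fun n : Fin N => b (n + q))‖ ≤ (N : ℝ)⁻¹ * (q * (A * B)) := by
  have hA : 0 ≤ A := (norm_nonneg _).trans (ha 0)
  have hB : 0 ≤ B := (norm_nonneg _).trans (hb 0)
  rw [innerN, innerN, ← mul_sub, ← Finset.sum_sub_distrib, norm_mul, norm_inv, Complex.norm_natCast]
  refine mul_le_mul_of_nonneg_left ?_ (by positivity)
  calc _ ≤ ∑ n : Fin N, if (n : ℕ) + q < N then 0 else A * B := by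
        refine (norm_sum_le _ _).trans (Finset.sum_le_sum fun n _ => ?_)
        simp only [shift]
        split_ifs with h
        · simp
        · rw [mul_zero, zero_sub, norm_neg, norm_mul, RCLike.norm_conj]
          exact mul_le_mul (ha _) (hb _) (norm_nonneg _) hA
    _ = ∑ n ∈ Finset.range N, if n + q < N then 0 else A * B :=
        Fin.sum_univ_eq_sum_range (fun n => if n + q < N then 0 else A * B) N
    _ = ((Finset.range N).filter fun n => ¬ n + q < N).card * (A * B) := by
        rw [Finset.sum_ite, Finset.sum_const_zero, zero_add, Finset.sum_const, nsmul_eq_mul]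
    _ ≤ q * (A * B) := by
        refine mul_le_mul_of_nonneg_right ?_ (by positivity)
        have hsub : (Finset.range N).filter (fun n => ¬ n + q < N) ⊆ Finset.Ico (N - q) N := by
          intro n hn
          simp only [Finset.mem_filter, Finset.mem_range, Finset.mem_Ico] at hn ⊢
          omega
        have hcard := Finset.card_le_card hsub
        rw [Nat.card_Ico] at hcard
        exact_mod_cast hcard.trans (by omega)

/-- Empirical correlations of uniformly convergent observables converge to correlations under the
Koopman group; the zero padding in `shift` is negligible. -/
theorem tendsto_innerN_shift (hΦ : IsErgodicFlow Φ μ) (hμM : μ Mᶜ = 0)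
    (hM : ∀ t : ℝ, 0 ≤ t → MapsTo (Φ t) M M) {x₀ : Ω} (hx₀ : x₀ ∈ M) {τ : ℝ} (hτ : 0 ≤ τ)
    (hconv : SamplesConverge Φ μ x₀ τ) {f g : ℕ → C(M, ℂ)} {f₀ g₀ : C(M, ℂ)}
    (hf : Tendsto f atTop (𝓝 f₀)) (hg : Tendsto g atTop (𝓝 g₀)) (q : ℕ) :
    Tendsto (fun N => innerN (fun n : Fin N => f N (sampleM hM hx₀ hτ n))
      (shift q fun n : Fin N => g N (sampleM hM hx₀ hτ n))) atTop
      (𝓝 (inner ℂ (restrictL2 μ M f₀) (koopman hΦ (q * τ) (restrictL2 μ M g₀)))) := by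
  have hqτ : 0 ≤ q * τ := by positivity
  have hx : AveragesConverge μ (sampleM hM hx₀ hτ) := hconv
  rw [koopman_restrictL2 hΦ hμM hM hqτ]
  have hg' : Tendsto (fun N => (g N).comp (forwardMap hM hqτ)) atTop
      (𝓝 (g₀.comp (forwardMap hM hqτ))) :=
    ((ContinuousMap.continuous_precomp (forwardMap hM hqτ)).tendsto g₀).comp hg
  have h1 := (spectralConv_sample hμM hx 0).tendsto_inner le_rfl hf hg'
  have h2 : Tendsto (fun N : ℕ => (N : ℝ)⁻¹ * (q * (‖f N‖ * ‖g N‖))) atTop (𝓝 0) := by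
    simpa using (tendsto_inv_atTop_nhds_zero_nat (𝕜 := ℝ)).mul ((hf.norm.mul hg.norm).const_mul (q : ℝ))
  have h3 : Tendsto (fun N => innerN (fun n : Fin N => f N (sampleM hM hx₀ hτ n))
      (shift q fun n : Fin N => g N (sampleM hM hx₀ hτ n))
      - innerN (fun n : Fin N => f N (sampleM hM hx₀ hτ n))
        (fun n : Fin N => g N (sampleM hM hx₀ hτ (n + q)))) atTop (𝓝 0) :=
    squeeze_zero_norm (fun N => norm_innerN_shift_sub_le q
      (fun n => f N (sampleM hM hx₀ hτ n)) (fun n => g N (sampleM hM hx₀ hτ n))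
      (fun n => (f N).norm_coe_le_norm _) (fun n => (g N).norm_coe_le_norm _)) h2
  have h4 := h3.add h1
  rw [zero_add] at h4
  refine h4.congr fun N => ?_
  rw [sampleRestrict_apply, sampleRestrict_apply, inner_scaled]
  simp only [ContinuousMap.comp_apply, ← sampleM_add, sub_add_cancel]

end Correlations

/-! ### Iterated limits of pairs of eigenfunctions -/

section Iterated

variable {B H : Type*} [NormedAddCommGroup B] [NormedSpace ℂ B] [NormedAddCommGroup H]
    [InnerProductSpace ℂ H]

theorem EigPair.sign_smul {R : B →L[ℂ] H} {S : H →L[ℂ] B} {Re : Set B} (hneg : ∀ f ∈ Re, -f ∈ Re)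
    {lam nu : ℝ} {f g : B} (h : EigPair R S Re lam nu f g) {s : ℝ} (hs : s = 1 ∨ s = -1) :
    EigPair R S Re lam nu f ((s : ℂ) • g) := by
  rcases hs with rfl | rfl
  · simpa using h
  · have : ((-1 : ℝ) : ℂ) • g = -g := by simp
    rw [this]
    exact ⟨h.eig_f, by rw [map_neg, map_neg, h.eig_g, smul_neg], h.real_f, hneg _ h.real_g,
      h.norm_f, by rw [map_neg, norm_neg, h.norm_g], by rw [map_neg, inner_neg_right, h.orthogonal,
        neg_zero]⟩

/-- Two eigenvalues of the limit operator that are simple if distinct, and twofold degenerate if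
equal, admit no third orthonormal eigenvector. -/
theorem not_hasOrthoEig_three {A : H →ₗ[ℂ] H} {lam nu : ℝ}
    (hsimple : lam ≠ nu → Module.finrank ℂ (Module.End.eigenspace A (lam : ℂ)) = 1 ∧
      Module.finrank ℂ (Module.End.eigenspace A (nu : ℂ)) = 1)
    (hdouble : lam = nu → Module.finrank ℂ (Module.End.eigenspace A (lam : ℂ)) = 2) :
    ¬ HasOrthoEig A 3 (fun u => u = lam ∨ u = nu) := by
  rintro ⟨e, he, hu⟩
  -- an injective family in an eigenspace is no longer than the dimension
  have key : ∀ {m d : ℕ} (i : Fin m → Fin 3) (u : ℝ), Function.Injective i →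
      Module.finrank ℂ (Module.End.eigenspace A (u : ℂ)) = d → d ≠ 0 →
      (∀ a, A (e (i a)) = (u : ℂ) • e (i a)) → m ≤ d := by
    intro m d i u hi hd hd0 ha
    have : FiniteDimensional ℂ (Module.End.eigenspace A (u : ℂ)) :=
      Module.finite_of_finrank_pos (by omega)
    let w : Fin m → Module.End.eigenspace A (u : ℂ) := fun a =>
      ⟨e (i a), Module.End.mem_eigenspace_iff.2 (ha a)⟩
    have hw : LinearIndependent ℂ w := by
      have h1 : LinearIndependent ℂ (e ∘ i) := (he.comp i hi).linearIndependent
      exact LinearIndependent.of_comp (Module.End.eigenspace A (u : ℂ)).subtype h1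
    simpa [hd] using hw.fintype_card_le_finrank
  by_cases hne : lam = nu
  · have := key id lam Function.injective_id (hdouble hne) two_ne_zero fun a => by
      obtain ⟨u, hu1, hu2⟩ := hu a
      have : u = lam := by rcases hu1 with h | h <;> simp [h, hne]
      rwa [this] at hu2
    omega
  · have hpair : ∀ (a b : Fin 3) (u : ℝ), a ≠ b →
        Module.finrank ℂ (Module.End.eigenspace A (u : ℂ)) = 1 →
        A (e a) = (u : ℂ) • e a → A (e b) = (u : ℂ) • e b → False := by
      intro a b u hab h1 ha hb
      have := key ![a, b] u (by
        intro x y hxy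
        fin_cases x <;> fin_cases y <;> simp_all) h1 one_ne_zero (by
        intro x
        fin_cases x
        · exact ha
        · exact hb)
      omega
    obtain ⟨h1, h2⟩ := hsimple hne
    have hc : ∀ a, A (e a) = (lam : ℂ) • e a ∨ A (e a) = (nu : ℂ) • e a := by
      intro a
      obtain ⟨u, rfl | rfl, hu2⟩ := hu a
      · exact Or.inl hu2
      · exact Or.inr hu2
    have h01 : (0 : Fin 3) ≠ 1 := by decide
    have h02 : (0 : Fin 3) ≠ 2 := by decide
    have h12 : (1 : Fin 3) ≠ 2 := by decide
    rcases hc 0 with a | a <;> rcases hc 1 with b | b <;> rcases hc 2 with c | c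
    all_goals first
      | exact hpair 0 1 _ h01 h1 a b
      | exact hpair 0 1 _ h01 h2 a b
      | exact hpair 0 2 _ h02 h1 a c
      | exact hpair 0 2 _ h02 h2 a c
      | exact hpair 1 2 _ h12 h1 b c
      | exact hpair 1 2 _ h12 h2 b c

variable [CompleteSpace H] {R : B →L[ℂ] H} {S : ℕ → H →L[ℂ] B} {S₀ : H →L[ℂ] B} {C₀ : ℝ}
  {Hd : ℕ → ℕ → Type*} [∀ k N, NormedAddCommGroup (Hd k N)]
  [∀ k N, InnerProductSpace ℂ (Hd k N)] [∀ k N, CompleteSpace (Hd k N)]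
  {Rd : ∀ k N, B →L[ℂ] Hd k N} {Sd : ∀ k N, Hd k N →L[ℂ] B} {C : ℕ → ℝ}

/-- If the operators `Rd k N ∘ Sd k N` converge to `R ∘ S k` as `N → ∞`, and these converge to
`R ∘ S₀` as `k → ∞`, then pairs of eigenfunctions for the `l`-th and `j`-th eigenvalue converge in
the iterated limit after a sign change and a rotation. The intermediate pairs `(f k, g k)` are any
limit points in `N`; both alignments, of the data with `(f k, g k)` and of `(f k, g k)` with
`(f₀, g₀)`, contribute to the sign and the phase. -/
theorem exists_aligned_iterated (hS : SpectralConv atTop (fun _ => R) S R S₀ C₀) (hC₀ : 0 ≤ C₀)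
    (hSd : ∀ k, SpectralConv atTop (Rd k) (Sd k) R (S k) (C k)) (hC : ∀ k, 0 ≤ C k)
    (hsym₀ : (R.comp S₀ : H →ₗ[ℂ] H).IsSymmetric)
    (hsym : ∀ k, (R.comp (S k) : H →ₗ[ℂ] H).IsSymmetric)
    (hsymd : ∀ k N, ((Rd k N).comp (Sd k N) : Hd k N →ₗ[ℂ] Hd k N).IsSymmetric)
    (hcpt : ∀ k, IsCompactOperator (R.comp (S k)))
    (hcptd : ∀ k N, IsCompactOperator ((Rd k N).comp (Sd k N))) {Re : Set B} (hRc : IsClosed Re)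
    (hneg : ∀ f ∈ Re, -f ∈ Re) (hRe : ∀ f ∈ Re, ∀ g ∈ Re, (inner ℂ (R f) (R g)).im = 0)
    {j l : ℕ} (hjl : j ≤ l) {lam nu : ℝ} (hlam : 0 < lam)
    (hl : IsNthOrtho (R.comp S₀ : H →ₗ[ℂ] H) l lam) (hj : IsNthOrtho (R.comp S₀ : H →ₗ[ℂ] H) j nu)
    (hno : ¬ HasOrthoEig (R.comp S₀ : H →ₗ[ℂ] H) 3 (fun u => u = lam ∨ u = nu))
    {f₀ g₀ : B} (h₀ : EigPair R S₀ Re lam nu f₀ g₀) {lamd nud : ℕ → ℕ → ℝ} {fd gd : ℕ → ℕ → B}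
    (hld : ∀ k, ∀ᶠ N in atTop,
      IsNthOrtho ((Rd k N).comp (Sd k N) : Hd k N →ₗ[ℂ] Hd k N) l (lamd k N))
    (hjd : ∀ k, ∀ᶠ N in atTop,
      IsNthOrtho ((Rd k N).comp (Sd k N) : Hd k N →ₗ[ℂ] Hd k N) j (nud k N))
    (hd : ∀ k, ∀ᶠ N in atTop, 0 < lamd k N → 0 < nud k N →
      EigPair (Rd k N) (Sd k N) Re (lamd k N) (nud k N) (fd k N) (gd k N)) :
    (∀ᶠ k in atTop, ∀ᶠ N in atTop, 0 < lamd k N ∧ 0 < nud k N) ∧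
    ∃ (s : ℕ → ℕ → ℝ) (c : ℕ → ℕ → ℂ), (∀ k N, s k N = 1 ∨ s k N = -1) ∧ (∀ k N, ‖c k N‖ = 1) ∧
      (lam ≠ nu → ∀ k N, c k N = 1 ∨ c k N = -1) ∧
      ∃ (e : ℕ → ℂ) (f g : ℕ → B), (∀ k, ‖e k‖ = 1) ∧
        (∀ᶠ k in atTop, ∃ r r' : ℝ, lam / 2 ≤ r ∧ lam / 2 ≤ r' ∧ EigPair R (S k) Re r r' (f k) (g k)) ∧
        (∀ᶠ k in atTop, Tendsto (fun N => c k N • (fd k N + Complex.I • ((s k N : ℂ) • gd k N))) atTop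
          (𝓝 (e k • (f k + Complex.I • g k)))) ∧
        Tendsto (fun k => e k • (f k + Complex.I • g k)) atTop (𝓝 (f₀ + Complex.I • g₀)) := by
  have hlam2 : 0 < lam / 2 := by positivity
  -- the level `lam / 2` lies strictly below the first `l + 1` eigenvalues of the limit; the indices
  -- `k` for which it does so for `R ∘ S k` are the good ones, and the others are finitely many
  have hK : HasOrthoEig (R.comp S₀ : H →ₗ[ℂ] H) (l + 1) (lam / 2 < ·) :=
    hl.2.imp fun u hu => lt_of_lt_of_le (by linarith) hu
  have hK' : HasOrthoEig (R.comp S₀ : H →ₗ[ℂ] H) (j + 1) (lam / 2 < ·) := hK.mono (by omega)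
  have hgood := hS.eventually_hasOrthoEig hC₀ hsym hcpt hlam2 hK
  -- the limits of the data-driven eigenvalues
  have hex : ∀ k, ∃ r r' : ℝ, HasOrthoEig (R.comp (S k) : H →ₗ[ℂ] H) (l + 1) (lam / 2 < ·) →
      (lam / 2 ≤ r ∧ IsNthOrtho (R.comp (S k) : H →ₗ[ℂ] H) l r ∧
        Tendsto (lamd k) atTop (𝓝 r)) ∧
      (lam / 2 ≤ r' ∧ IsNthOrtho (R.comp (S k) : H →ₗ[ℂ] H) j r' ∧
        Tendsto (nud k) atTop (𝓝 r')) := by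
    intro k
    by_cases hk : HasOrthoEig (R.comp (S k) : H →ₗ[ℂ] H) (l + 1) (lam / 2 < ·)
    · obtain ⟨r, hr⟩ :=
        (hSd k).exists_tendsto_eigenvalue (hC k) (hsymd k) (hcptd k) hlam2 hk (hld k)
      obtain ⟨r', hr'⟩ :=
        (hSd k).exists_tendsto_eigenvalue (hC k) (hsymd k) (hcptd k) hlam2
          (hk.mono (by omega : j + 1 ≤ l + 1)) (hjd k)
      exact ⟨r, r', fun _ => ⟨hr, hr'⟩⟩
    · exact ⟨0, 0, fun h => absurd h hk⟩
  choose lq nq hq using hex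
  have hlq : Tendsto lq atTop (𝓝 lam) := by
    obtain ⟨r, -, hr, ht⟩ := hS.exists_tendsto_eigenvalue hC₀ hsym hcpt hlam2 hK (r := lq)
      (hgood.mono fun k hk => (hq k hk).1.2.1)
    rwa [hr.eq hl] at ht
  obtain ⟨hnu2, hnq⟩ : lam / 2 ≤ nu ∧ Tendsto nq atTop (𝓝 nu) := by
    obtain ⟨r, hr0, hr, ht⟩ := hS.exists_tendsto_eigenvalue hC₀ hsym hcpt hlam2 hK' (r := nq)
      (hgood.mono fun k hk => (hq k hk).2.2.1)
    rw [hr.eq hj] at ht hr0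
    exact ⟨hr0, ht⟩
  have hpos : ∀ k, HasOrthoEig (R.comp (S k) : H →ₗ[ℂ] H) (l + 1) (lam / 2 < ·) →
      ∀ᶠ N in atTop, 0 < lamd k N ∧ 0 < nud k N := fun k hk => by
    obtain ⟨⟨a1, -, a3⟩, b1, -, b3⟩ := hq k hk
    exact (a3.eventually_const_lt (hlam2.trans_le a1)).and
      (b3.eventually_const_lt (hlam2.trans_le b1))
  have hpair : ∀ k, HasOrthoEig (R.comp (S k) : H →ₗ[ℂ] H) (l + 1) (lam / 2 < ·) →
      ∀ᶠ N in atTop, EigPair (Rd k N) (Sd k N) Re (lamd k N) (nud k N) (fd k N) (gd k N) :=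
    fun k hk => by
      filter_upwards [hpos k hk, hd k] with N h1 h2
      exact h2 h1.1 h1.2
  -- three orthonormal eigenvectors for infinitely many `k` would have a limit, contradicting `hno`
  have hno' : ∀ᶠ k in atTop, ¬ HasOrthoEig (R.comp (S k) : H →ₗ[ℂ] H) 3
      (fun u => u = lq k ∨ u = nq k) := by
    rw [Filter.Eventually, mem_iff_ultrafilter]
    intro U hU
    change ∀ᶠ k in (U : Filter ℕ), _
    rw [Ultrafilter.eventually_not]
    intro hU3
    refine hno (hS.hasOrthoEig_limit hC₀ hU hU3 fun u hu => ?_)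
    rcases Ultrafilter.eventually_or.1 (hu.mono fun k hk => hk.1) with h | h
    · exact ⟨lam, hlam.ne', Or.inl rfl, (hlq.mono_left hU).congr' (h.mono fun k hk => hk.symm)⟩
    · exact ⟨nu, (hlam2.trans_le hnu2).ne', Or.inr rfl,
        (hnq.mono_left hU).congr' (h.mono fun k hk => hk.symm)⟩
  have hne : ∀ᶠ k in atTop, lam ≠ nu → lq k ≠ nq k := by
    by_cases h : lam = nu
    · exact Eventually.of_forall fun k hk => absurd h hk
    · exact ((hlq.sub hnq).eventually_ne (sub_ne_zero.2 h)).mono fun k hk _ => sub_ne_zero.1 hk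
  -- the intermediate pairs
  have hex : ∀ k, ∃ f g : B, HasOrthoEig (R.comp (S k) : H →ₗ[ℂ] H) (l + 1) (lam / 2 < ·) →
      EigPair R (S k) Re (lq k) (nq k) f g := by
    intro k
    by_cases hk : HasOrthoEig (R.comp (S k) : H →ₗ[ℂ] H) (l + 1) (lam / 2 < ·)
    · obtain ⟨⟨a1, -, a3⟩, b1, -, b3⟩ := hq k hk
      have hU : ↑(Ultrafilter.of (atTop : Filter ℕ)) ≤ (atTop : Filter ℕ) := Ultrafilter.of_le _
      obtain ⟨f, g, -, -, hfg⟩ := (hSd k).exists_pair_limit (hC k) hRc hU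
        ((hpair k hk).filter_mono hU) (a3.mono_left hU) (b3.mono_left hU)
        (hlam2.trans_le a1).ne' (hlam2.trans_le b1).ne'
      exact ⟨f, g, fun _ => hfg⟩
    · exact ⟨0, 0, fun h => absurd h hk⟩
  choose f g hfg using hex
  -- `σ k` and `e k` align `(f k, g k)` with `(f₀, g₀)`
  obtain ⟨σ, e, hσ, he, he', hte⟩ := hS.exists_aligned hC₀ hRc hRe hsym₀ hno (f := f) (g := g)
    (hgood.mono hfg) hlq hnq hlam.ne' (hlam2.trans_le hnu2).ne' h₀
  have hex : ∀ k, ∃ (s : ℕ → ℝ) (c : ℕ → ℂ), (∀ N, s N = 1 ∨ s N = -1) ∧ (∀ N, ‖c N‖ = 1) ∧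
      (lam ≠ nu → ∀ N, c N = 1 ∨ c N = -1) ∧
      (HasOrthoEig (R.comp (S k) : H →ₗ[ℂ] H) (l + 1) (lam / 2 < ·) →
        ¬ HasOrthoEig (R.comp (S k) : H →ₗ[ℂ] H) 3 (fun u => u = lq k ∨ u = nq k) →
        (lam ≠ nu → lq k ≠ nq k) →
        Tendsto (fun N => c N • (fd k N + Complex.I • ((s N : ℂ) • gd k N))) atTop
          (𝓝 (e k • (f k + Complex.I • ((σ k : ℂ) • g k))))) := by
    intro k
    by_cases hk : HasOrthoEig (R.comp (S k) : H →ₗ[ℂ] H) (l + 1) (lam / 2 < ·) ∧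
        ¬ HasOrthoEig (R.comp (S k) : H →ₗ[ℂ] H) 3 (fun u => u = lq k ∨ u = nq k) ∧
        (lam ≠ nu → lq k ≠ nq k)
    · obtain ⟨h1, h2, h3⟩ := hk
      obtain ⟨⟨a1, -, a3⟩, b1, -, b3⟩ := hq k h1
      obtain ⟨s, c, hs, hc, hc', ht⟩ := (hSd k).exists_aligned (hC k) hRc hRe (hsym k) h2
        (hpair k h1) a3 b3 (hlam2.trans_le a1).ne' (hlam2.trans_le b1).ne'
        ((hfg k h1).sign_smul hneg (hσ k))
      -- the data are aligned with `(f k, σ k g k)`, so that the signs are already composed and only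
      -- the phases remain to be multiplied
      refine ⟨s, fun N => e k * c N, hs, fun N => by rw [norm_mul, he, hc, one_mul], ?_, ?_⟩
      · intro hln N
        rcases he' hln k with h | h <;> rcases hc' (h3 hln) N with h' | h' <;> simp [h, h']
      · intro _ _ _
        simp only [mul_smul]
        exact ht.const_smul (e k)
    · -- for the finitely many other `k` any choice will do
      exact ⟨fun _ => 1, fun _ => 1, fun _ => Or.inl rfl, fun _ => norm_one,
        fun _ _ => Or.inl rfl, fun h1 h2 h3 => absurd ⟨h1, h2, h3⟩ hk⟩
  choose s c hs hc hc' ht using hex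
  refine ⟨hgood.mono hpos, s, c, hs, hc, fun h k => hc' k h, e, f, fun k => (σ k : ℂ) • g k, he,
    ?_, ?_, hte⟩
  · filter_upwards [hgood] with k hk
    exact ⟨lq k, nq k, (hq k hk).1.1, (hq k hk).2.1, (hfg k hk).sign_smul hneg (hσ k)⟩
  · filter_upwards [hgood, hno', hne] with k h1 h2 h3
    exact ht k h1 h2 h3

end Iterated

/-! ### Real functions and real parts -/

section RealParts

variable {K : Type*} [TopologicalSpace K]

/-- The real-valued functions in `C(K, ℂ)`. -/
def realFns (K : Type*) [TopologicalSpace K] : Set C(K, ℂ) := {f | ∀ x, (f x).im = 0}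

/-- The real part of a continuous function, as a complex-valued function. -/
def rePart (f : C(K, ℂ)) : C(K, ℂ) :=
  (⟨fun z : ℂ => (z.re : ℂ), by fun_prop⟩ : C(ℂ, ℂ)).comp f

/-- The imaginary part of a continuous function, as a complex-valued function. -/
def imPart (f : C(K, ℂ)) : C(K, ℂ) :=
  (⟨fun z : ℂ => (z.im : ℂ), by fun_prop⟩ : C(ℂ, ℂ)).comp f

@[simp] theorem rePart_apply (f : C(K, ℂ)) (x : K) : rePart f x = ((f x).re : ℂ) := rfl

@[simp] theorem imPart_apply (f : C(K, ℂ)) (x : K) : imPart f x = ((f x).im : ℂ) := rfl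

theorem continuous_rePart : Continuous (rePart : C(K, ℂ) → C(K, ℂ)) :=
  ContinuousMap.continuous_postcomp _

theorem continuous_imPart : Continuous (imPart : C(K, ℂ) → C(K, ℂ)) :=
  ContinuousMap.continuous_postcomp _

theorem isClosed_realFns : IsClosed (realFns K) := by
  simp only [realFns, Set.ofPred_forall]
  exact isClosed_iInter fun x => isClosed_eq
    (Complex.continuous_im.comp (continuous_eval_const x)) continuous_const

theorem neg_mem_realFns {f : C(K, ℂ)} (hf : f ∈ realFns K) : -f ∈ realFns K := fun x => by
  simp [hf x]

theorem re_eq_self {f : C(K, ℂ)} (hf : f ∈ realFns K) (x : K) : ((f x).re : ℂ) = f x :=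
  Complex.ext (Complex.ofReal_re _) (by rw [Complex.ofReal_im, hf x])

theorem rePart_add_I_smul {f g : C(K, ℂ)} (hf : f ∈ realFns K) (hg : g ∈ realFns K) :
    rePart (f + Complex.I • g) = f := by
  ext x
  have h : ((f + Complex.I • g) x).re = (f x).re := by simp [hg x]
  rw [rePart_apply, h, re_eq_self hf]

theorem imPart_add_I_smul {f g : C(K, ℂ)} (hf : f ∈ realFns K) (hg : g ∈ realFns K) :
    imPart (f + Complex.I • g) = g := by
  ext x
  have h : ((f + Complex.I • g) x).im = (g x).re := by simp [hf x]
  rw [imPart_apply, h, re_eq_self hg]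

end RealParts

/-! ### Eigenfunctions along orbits -/

section OrbitRegularity

variable {Ω : Type*} [MetricSpace Ω] [MeasurableSpace Ω] [BorelSpace Ω] {Φ : Flow ℝ Ω}
  {μ : Measure Ω} [IsProbabilityMeasure μ] {M : Set Ω} [CompactSpace M]

theorem im_inner_restrictL2 {f g : C(M, ℂ)} (hf : f ∈ realFns M) (hg : g ∈ realFns M) :
    (inner ℂ (restrictL2 μ M f) (restrictL2 μ M g)).im = 0 := by
  have h : ∀ y, zeroExt (⇑(star f * g)) y = (((zeroExt (⇑(star f * g)) y).re : ℝ) : ℂ) := by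
    intro y
    by_cases hy : y ∈ M
    · rw [zeroExt_of_mem _ hy]
      refine (Complex.ext (Complex.ofReal_re _) ?_).symm
      simp [hf ⟨y, hy⟩, hg ⟨y, hy⟩]
    · simp [zeroExt, hy]
  rw [inner_restrictL2, integral_congr_ae (ae_of_all _ h), integral_complex_ofReal, Complex.ofReal_im]

/-- Eigenfunctions of an integral operator are Lipschitz along orbits if its kernel is. -/
theorem norm_eigenfunction_orbit_sub_le (hμM : μ Mᶜ = 0)
    (hM : ∀ t : ℝ, 0 ≤ t → MapsTo (Φ t) M M) {k : (Ω × Ω) →ᵇ ℝ} {K : ℝ}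
    (hk : ∀ x ∈ M, ∀ y ∈ M, ∀ τ, 0 ≤ τ → |k (Φ τ x, y) - k (x, y)| ≤ K * τ) {r : ℝ} (hr : 0 < r)
    {f : C(M, ℂ)} (hf : kernelInt μ k M (restrictL2 μ M f) = (r : ℂ) • f)
    (hn : ‖restrictL2 μ M f‖ = 1) {τ : ℝ} (hτ : 0 ≤ τ) (x : M) :
    ‖f (forwardMap hM hτ x) - f x‖ ≤ K / r * τ := by
  have e : ∀ y : M, (r : ℂ) * f y = ∫ z, (k (y, z) : ℂ) * restrictL2 μ M f z ∂μ := fun y => by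
    rw [← kernelInt_apply, hf]
    rfl
  have h1 := norm_kernel_integral_sub_le μ hμM k k
    (fun y hy => hk x x.2 y hy τ hτ) (restrictL2 μ M f)
  have h2 := e (forwardMap hM hτ x)
  change (r : ℂ) * f (forwardMap hM hτ x) = ∫ z, (k (Φ τ x, z) : ℂ) * restrictL2 μ M f z ∂μ at h2
  rw [← h2, ← e, ← mul_sub, norm_mul, Complex.norm_real, Real.norm_of_nonneg hr.le, hn,
    mul_one] at h1
  rw [div_mul_eq_mul_div, le_div_iff₀ hr, mul_comm]
  exact h1

/-- The bound is uniform over all pairs with eigenvalues above `r₀`, and insensitive to the phase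
`e`. -/
theorem norm_combination_orbit_sub_le (hμM : μ Mᶜ = 0)
    (hM : ∀ t : ℝ, 0 ≤ t → MapsTo (Φ t) M M) {k : (Ω × Ω) →ᵇ ℝ} {K : ℝ} (hK : 0 ≤ K)
    (hk : ∀ x ∈ M, ∀ y ∈ M, ∀ τ, 0 ≤ τ → |k (Φ τ x, y) - k (x, y)| ≤ K * τ) {r₀ r r' : ℝ}
    (hr₀ : 0 < r₀) (hr : r₀ ≤ r) (hr' : r₀ ≤ r') {f g : C(M, ℂ)}
    (h : EigPair (restrictL2 μ M) (kernelInt μ k M) (realFns M) r r' f g) {e : ℂ} (he : ‖e‖ = 1)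
    {τ : ℝ} (hτ : 0 ≤ τ) (x : M) :
    ‖(e • (f + Complex.I • g)) (forwardMap hM hτ x) - (e • (f + Complex.I • g)) x‖
      ≤ 2 * (K / r₀) * τ := by
  have h1 := norm_eigenfunction_orbit_sub_le hμM hM hk (hr₀.trans_le hr) h.eig_f h.norm_f hτ x
  have h2 := norm_eigenfunction_orbit_sub_le hμM hM hk (hr₀.trans_le hr') h.eig_g h.norm_g hτ x
  have h3 : K / r * τ ≤ K / r₀ * τ := by gcongr
  have h4 : K / r' * τ ≤ K / r₀ * τ := by gcongr
  have e1 : (e • (f + Complex.I • g)) (forwardMap hM hτ x) - (e • (f + Complex.I • g)) x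
      = e * ((f (forwardMap hM hτ x) - f x) + Complex.I * (g (forwardMap hM hτ x) - g x)) := by
    simp only [ContinuousMap.smul_apply, ContinuousMap.add_apply, smul_eq_mul]
    ring
  rw [e1, norm_mul, he, one_mul]
  refine (norm_add_le _ _).trans ?_
  rw [norm_mul, Complex.norm_I, one_mul]
  linarith

theorem norm_difference_koopman_le (hΦ : IsErgodicFlow Φ μ) (hμM : μ Mᶜ = 0)
    (hM : ∀ t : ℝ, 0 ≤ t → MapsTo (Φ t) M M) {f : C(M, ℂ)} {C τ : ℝ} (hC : 0 ≤ C) (hτ : 0 < τ)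
    (hf : ∀ x, ‖f (forwardMap hM hτ.le x) - f x‖ ≤ C * τ) :
    ‖τ⁻¹ • (koopman hΦ τ (restrictL2 μ M f) - restrictL2 μ M f)‖ ≤ C := by
  rw [koopman_restrictL2 hΦ hμM hM hτ.le, ← map_sub, norm_smul, norm_inv,
    Real.norm_of_nonneg hτ.le, inv_mul_le_iff₀ hτ, mul_comm]
  refine (norm_restrictL2_le μ _).trans ?_
  exact (ContinuousMap.norm_le _ (by positivity)).2 hf

/-- Eigenfunctions of a kernel that is Lipschitz along orbits lie in the domain of the generator. -/
theorem exists_hasDerivAt_eigenfunction (hΦ : IsErgodicFlow Φ μ) (hμM : μ Mᶜ = 0)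
    (hM : ∀ t : ℝ, 0 ≤ t → MapsTo (Φ t) M M) {k : (Ω × Ω) →ᵇ ℝ} {K : ℝ} (hK : 0 ≤ K)
    (hk : ∀ x ∈ M, ∀ y ∈ M, ∀ τ, 0 ≤ τ → |k (Φ τ x, y) - k (x, y)| ≤ K * τ) {r : ℝ} (hr : r ≠ 0)
    {φ : Lp ℂ 2 μ} (hφ : integralOp μ k φ = (r : ℂ) • φ) :
    ∃ χ : Lp ℂ 2 μ, HasDerivAt (fun t : ℝ => koopman hΦ t φ) χ 0 := by
  refine exists_hasDerivAt_koopman hΦ hμM hM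
    (p := fun x => (r : ℂ)⁻¹ * ∫ y, (k (x, y) : ℂ) * φ y ∂μ)
    ((continuous_kernel_integral μ k φ).const_mul _) (C := |r|⁻¹ * (K * ‖φ‖)) (by positivity) ?_ ?_
  · intro x hx τ hτ
    rw [← mul_sub, norm_mul, norm_inv, Complex.norm_real, Real.norm_eq_abs, mul_assoc]
    refine mul_le_mul_of_nonneg_left ?_ (by positivity)
    refine (norm_kernel_integral_sub_le μ hμM k k (fun y hy => hk x hx y hy τ hτ) φ).trans ?_
    rw [mul_right_comm]
  · have h1 : (integralOp μ k φ : Ω → ℂ) =ᵐ[μ] fun x => ∫ y, (k (x, y) : ℂ) * φ y ∂μ :=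
      (memLp_kernel_integral μ k φ).coeFn_toLp
    rw [hφ] at h1
    filter_upwards [h1, Lp.coeFn_smul (r : ℂ) φ] with x e1 e2
    rw [← e1, e2, Pi.smul_apply, smul_eq_mul, inv_mul_cancel_left₀ (by exact_mod_cast hr)]

/-- The generator is antisymmetric. -/
theorem inner_generator_antisymm (hΦ : IsErgodicFlow Φ μ) {φ ψ χ η : Lp ℂ 2 μ}
    (hφ : HasDerivAt (fun t : ℝ => koopman hΦ t φ) χ 0)
    (hψ : HasDerivAt (fun t : ℝ => koopman hΦ t ψ) η 0) :
    inner ℂ ψ χ = -(starRingEnd ℂ) (inner ℂ φ η) := by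
  have h1 := hψ.inner ℂ hφ
  simp only [LinearIsometry.inner_map_map, koopman_zero] at h1
  have h2 := h1.unique (hasDerivAt_const (0 : ℝ) (inner ℂ ψ φ))
  rw [inner_conj_symm]
  exact eq_neg_of_add_eq_zero_left h2

/-- The generator maps real functions to real functions, in the weak sense. -/
theorem im_inner_generator (hΦ : IsErgodicFlow Φ μ) (hμM : μ Mᶜ = 0)
    (hM : ∀ t : ℝ, 0 ≤ t → MapsTo (Φ t) M M) {f g : C(M, ℂ)} (hf : f ∈ realFns M)
    (hg : g ∈ realFns M) {η : Lp ℂ 2 μ}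
    (hη : HasDerivAt (fun t : ℝ => koopman hΦ t (restrictL2 μ M g)) η 0) :
    (inner ℂ (restrictL2 μ M f) η).im = 0 := by
  have h1 : Tendsto (fun t : ℝ => t⁻¹ • (koopman hΦ t (restrictL2 μ M g) - restrictL2 μ M g))
      (𝓝[>] 0) (𝓝 η) := by
    have := (hasDerivAt_iff_tendsto_slope_zero.1 hη).mono_left
      (nhdsWithin_mono (s := Ioi (0 : ℝ)) 0 fun t (ht : 0 < t) => ht.ne')
    simpa [koopman_zero] using this
  have h2 := (Complex.continuous_im.tendsto _).comp
    ((tendsto_const_nhds (x := restrictL2 μ M f)).inner h1 (𝕜 := ℂ))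
  refine tendsto_nhds_unique h2 (tendsto_const_nhds.congr' ?_)
  filter_upwards [self_mem_nhdsWithin] with t (ht : 0 < t)
  have hreal : g.comp (forwardMap hM ht.le) ∈ realFns M := fun x => hg _
  rw [Function.comp_apply, koopman_restrictL2 hΦ hμM hM ht.le,
    RCLike.real_smul_eq_coe_smul (K := ℂ), inner_smul_right, inner_sub_right]
  simp [im_inner_restrictL2 hf hreal, im_inner_restrictL2 hf hg]

end OrbitRegularity

/-! ### Iterated limits of frequencies and autocorrelations -/

section IteratedLimits

theorem IteratedLim.eventually_norm_sub_lt {E : Type*} [NormedAddCommGroup E] {a : ℕ → ℕ → E}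
    {L : E} (h : IteratedLim a L) {ε : ℝ} (hε : 0 < ε) :
    ∀ᶠ k in atTop, ∀ᶠ N in atTop, ‖a k N - L‖ < ε := by
  obtain ⟨b, hb, hL⟩ := h
  filter_upwards [hb, (hL.sub_const L).norm.eventually_lt_const (by simpa using hε)] with k h1 h2
  exact ((h1.sub_const L).norm).eventually_lt_const h2

theorem shift_zero {N : ℕ} (f : Fin N → ℂ) : shift 0 f = f := by
  ext n
  simp [shift]

theorem freqN_eq {N : ℕ} (τ : ℝ) (φ ψ : Fin N → ℂ) :
    freqN τ φ ψ = (τ : ℂ)⁻¹ * (innerN ψ (shift 1 φ) - innerN ψ (shift 0 φ)) := by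
  rw [shift_zero]
  simp only [freqN, innerN, finiteDiff, ← mul_sub, ← Finset.sum_sub_distrib, Finset.mul_sum]
  refine Finset.sum_congr rfl fun n _ => ?_
  rw [div_eq_mul_inv]
  ring

/-- The frequency of a pair that is rotated by the angle with cosine `p` and sine `-q`. -/
theorem freqN_rotation {N : ℕ} (τ p q : ℝ) (a b : Fin N → ℂ) :
    freqN τ (fun n => (p : ℂ) * a n + q * b n) (fun n => (p : ℂ) * b n - q * a n)
      = (p : ℂ) ^ 2 * freqN τ a b - (q : ℂ) ^ 2 * freqN τ b a
        + p * q * (freqN τ b b - freqN τ a a) := by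
  have hs : ∀ n, shift 1 (fun n => (p : ℂ) * a n + q * b n) n
      = (p : ℂ) * shift 1 a n + q * shift 1 b n := fun n => by
    simp only [shift]
    split_ifs <;> simp
  simp only [freqN, innerN, finiteDiff, hs, map_sub, map_mul, Complex.conj_ofReal, Finset.mul_sum,
    mul_sub, ← Finset.sum_sub_distrib, ← Finset.sum_add_distrib]
  exact Finset.sum_congr rfl fun n _ => by ring

theorem innerN_const_mul_shift {N : ℕ} (q : ℕ) (e : ℂ) (f : Fin N → ℂ) :
    innerN (fun n => e * f n) (shift q fun n => e * f n) = (‖e‖ ^ 2 : ℝ) * innerN f (shift q f) := by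
  have hs : ∀ n, shift q (fun n => e * f n) n = e * shift q f n := fun n => by
    simp only [shift]
    split_ifs <;> simp
  have he : (starRingEnd ℂ) e * e = ((‖e‖ ^ 2 : ℝ) : ℂ) := by
    rw [mul_comm, Complex.mul_conj, Complex.normSq_eq_norm_sq]
  simp only [innerN, hs, map_mul, Finset.mul_sum]
  refine Finset.sum_congr rfl fun n _ => ?_
  rw [← he]
  ring

variable {Ω : Type*} [MetricSpace Ω] [MeasurableSpace Ω] [BorelSpace Ω] {Φ : Flow ℝ Ω}
  {μ : Measure Ω} [IsProbabilityMeasure μ] {M : Set Ω} [CompactSpace M]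

/-- Convergence of empirical frequencies. The intermediate limits `a' k` need to be Lipschitz along
orbits, uniformly in `k`, for the limits of `a' k` and of the difference quotient to commute. -/
theorem iteratedLim_freqN (hΦ : IsErgodicFlow Φ μ) (hμM : μ Mᶜ = 0)
    (hM : ∀ t : ℝ, 0 ≤ t → MapsTo (Φ t) M M) {x₀ : Ω} (hx₀ : x₀ ∈ M) {τ : ℕ → ℝ}
    (hτ : ∀ k, 0 < τ k) (hτl : Tendsto τ atTop (𝓝 0)) (hconv : ∀ k, SamplesConverge Φ μ x₀ (τ k))
    {a b : ℕ → ℕ → C(M, ℂ)} {a' b' : ℕ → C(M, ℂ)} {a₀ b₀ : C(M, ℂ)}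
    (ha : ∀ᶠ k in atTop, Tendsto (a k) atTop (𝓝 (a' k))) (ha' : Tendsto a' atTop (𝓝 a₀))
    (hb : ∀ᶠ k in atTop, Tendsto (b k) atTop (𝓝 (b' k))) (hb' : Tendsto b' atTop (𝓝 b₀)) {C : ℝ}
    (hC : 0 ≤ C) (hl : ∀ᶠ k in atTop, ∀ x,
      ‖a' k (forwardMap hM (hτ k).le x) - a' k x‖ ≤ C * τ k) {χ η : Lp ℂ 2 μ}
    (hχ : HasDerivAt (fun t : ℝ => koopman hΦ t (restrictL2 μ M a₀)) χ 0)
    (hη : HasDerivAt (fun t : ℝ => koopman hΦ t (restrictL2 μ M b₀)) η 0) :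
    IteratedLim (fun k N => freqN (τ k) (fun n : Fin N => a k N (sampleM hM hx₀ (hτ k).le n))
      (fun n : Fin N => b k N (sampleM hM hx₀ (hτ k).le n))) (inner ℂ (restrictL2 μ M b₀) χ) := by
  refine ⟨fun k => inner ℂ (restrictL2 μ M (b' k))
    ((τ k)⁻¹ • (koopman hΦ (τ k) (restrictL2 μ M (a' k)) - restrictL2 μ M (a' k))), ?_, ?_⟩
  · filter_upwards [ha, hb] with k hak hbk
    have h1 := tendsto_innerN_shift hΦ hμM hM hx₀ (hτ k).le (hconv k) hbk hak 1
    have h0 := tendsto_innerN_shift hΦ hμM hM hx₀ (hτ k).le (hconv k) hbk hak 0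
    have h2 := (h1.sub h0).const_mul ((τ k : ℂ)⁻¹)
    simp only [← freqN_eq, Nat.cast_one, one_mul, Nat.cast_zero, zero_mul, koopman_zero] at h2
    rw [RCLike.real_smul_eq_coe_smul (K := ℂ), inner_smul_right, inner_sub_right]
    simpa using h2
  · refine tendsto_inner_difference hΦ hχ hη hτl (fun k => (hτ k).ne')
      (((restrictL2 μ M).continuous.tendsto _).comp ha')
      (((restrictL2 μ M).continuous.tendsto _).comp hb') (C := C) ?_
    filter_upwards [hl] with k hk
    exact norm_difference_koopman_le hΦ hμM hM hC (hτ k) hk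

theorem norm_inner_koopman_sub_le (hΦ : IsErgodicFlow Φ μ) (t : ℝ) (f g : Lp ℂ 2 μ) :
    ‖inner ℂ f (koopman hΦ t f) - inner ℂ g (koopman hΦ t g)‖ ≤ ‖f - g‖ * (‖f‖ + ‖g‖) := by
  have e : inner ℂ f (koopman hΦ t f) - inner ℂ g (koopman hΦ t g)
      = inner ℂ (f - g) (koopman hΦ t f) + inner ℂ g (koopman hΦ t (f - g)) := by
    rw [map_sub, inner_sub_left, inner_sub_right]
    ring
  rw [e, mul_add]
  refine (norm_add_le _ _).trans (add_le_add ?_ ?_)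
  · exact (norm_inner_le_norm _ _).trans_eq (by rw [LinearIsometry.norm_map])
  · exact (norm_inner_le_norm _ _).trans_eq (by rw [LinearIsometry.norm_map, mul_comm])

theorem norm_sq_inv_sqrt_two : ‖((1 / √2 : ℝ) : ℂ)‖ ^ 2 = 1 / 2 := by
  rw [Complex.norm_real, Real.norm_eq_abs, sq_abs, div_pow, Real.sq_sqrt (by norm_num)]
  norm_num

theorem autocorr_eq (hΦ : IsErgodicFlow Φ μ) (f g : C(M, ℂ)) (t : ℝ) :
    autocorr hΦ (restrictL2 μ M f) (restrictL2 μ M g) t = (1 / 2 : ℝ) *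
      inner ℂ (restrictL2 μ M (f + Complex.I • g))
        (koopman hΦ t (restrictL2 μ M (f + Complex.I • g))) := by
  have e : restrictL2 μ M (f + Complex.I • g)
      = restrictL2 μ M f + Complex.I • restrictL2 μ M g := by rw [map_add, map_smul]
  rw [e, autocorr, zL2, map_smul, inner_smul_left, inner_smul_right, ← mul_assoc, mul_comm
    ((starRingEnd ℂ) _), Complex.mul_conj, Complex.normSq_eq_norm_sq, norm_sq_inv_sqrt_two]

end IteratedLimits

/-! ### Extension of eigenvectors to continuous functions -/

section Nystrom

variable {Ω : Type*} [MetricSpace Ω] {M : Set Ω} [CompactSpace M]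

/-- The Nyström extension `lam⁻¹ N⁻¹ ∑_n k(·, x_n) φ_n` of an eigenvector `φ` of the data-driven
operator to a continuous function on `M`; it is `0` if `lam = 0`. -/
def dataExt (k : (Ω × Ω) →ᵇ ℝ) (x : ℕ → M) {N : ℕ} (lam : ℝ) (φ : Fin N → ℂ) : C(M, ℂ) :=
  (lam : ℂ)⁻¹ • sampleInt k x N (scaled φ)

theorem dataExt_apply (k : (Ω × Ω) →ᵇ ℝ) (x : ℕ → M) {N : ℕ} (lam : ℝ) (φ : Fin N → ℂ) (y : M) :
    dataExt k x lam φ y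
      = (lam : ℂ)⁻¹ * ((N : ℂ)⁻¹ * ∑ n : Fin N, (k (y, x n) : ℂ) * φ n) := by
  rw [dataExt, ContinuousMap.smul_apply, sampleInt_scaled, smul_eq_mul]

theorem dataExt_sample {k : (Ω × Ω) →ᵇ ℝ} {x : ℕ → M} {N : ℕ} {lam : ℝ} {φ : Fin N → ℂ}
    (hlam : lam ≠ 0) (h : dataOp k (fun n => x n) N φ = (lam : ℂ) • φ) (n : Fin N) :
    dataExt k x lam φ (x n) = φ n := by
  have h1 : dataOp k (fun n => x n) N φ n = (N : ℂ)⁻¹ * ∑ m : Fin N, (k (x n, x m) : ℂ) * φ m := by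
    rw [dataOp, Matrix.toLin'_apply, Matrix.mulVec, dotProduct, Finset.mul_sum]
    exact Finset.sum_congr rfl fun m _ => by simp only [Matrix.of_apply]; ring
  rw [dataExt_apply, ← h1, h, Pi.smul_apply, smul_eq_mul,
    inv_mul_cancel_left₀ (by exact_mod_cast hlam)]

theorem dataExt_mem_realFns (k : (Ω × Ω) →ᵇ ℝ) (x : ℕ → M) {N : ℕ} (lam : ℝ) {φ : Fin N → ℂ}
    (hφ : ∀ n, (φ n).im = 0) : dataExt k x lam φ ∈ realFns M := by
  intro y
  have h : ∀ n, φ n = ((φ n).re : ℂ) := fun n => Complex.ext (Complex.ofReal_re _).symm (hφ n)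
  have e : dataExt k x lam φ y
      = ((lam⁻¹ * ((N : ℝ)⁻¹ * ∑ n : Fin N, k (y, x n) * (φ n).re) : ℝ) : ℂ) := by
    rw [dataExt_apply]
    push_cast
    simp only [← h]
  rw [e, Complex.ofReal_im]

/-- The Nyström extensions of a data-driven pair form an `EigPair` of continuous functions on `M`.
-/
theorem IsDataEigenPair.eigPair {k : (Ω × Ω) →ᵇ ℝ} {x : ℕ → M} {N j l : ℕ} {lam nu : ℝ}
    {φ ψ : Fin N → ℂ} (h : IsDataEigenPair (dataOp k (fun n => x n) N) j l lam nu φ ψ)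
    (hlam : lam ≠ 0) (hnu : nu ≠ 0) :
    EigPair (sampleRestrict x N) (sampleInt k x N) (realFns M) lam nu (dataExt k x lam φ)
      (dataExt k x nu ψ) := by
  have hR : ∀ {r : ℝ} {θ : Fin N → ℂ}, r ≠ 0 → dataOp k (fun n => x n) N θ = (r : ℂ) • θ →
      sampleRestrict x N (dataExt k x r θ) = scaled θ := fun hr hθ => by
    rw [sampleRestrict_apply]
    congr 1
    ext n
    exact dataExt_sample hr hθ n
  have hnorm : ∀ θ : Fin N → ℂ, innerN θ θ = 1 → ‖scaled θ‖ = 1 := fun θ hθ => by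
    have h2 : ‖scaled θ‖ ^ 2 = 1 := by
      rw [← inner_self_eq_norm_sq (𝕜 := ℂ), inner_scaled, hθ, RCLike.one_re]
    exact (pow_eq_one_iff_of_nonneg (norm_nonneg _) two_ne_zero).1 h2
  have hf := hR hlam h.eig_φ
  have hg := hR hnu h.eig_ψ
  refine ⟨?_, ?_, dataExt_mem_realFns k x lam h.real_φ, dataExt_mem_realFns k x nu h.real_ψ,
    by rw [hf, hnorm _ h.norm_φ], by rw [hg, hnorm _ h.norm_ψ],
    by rw [hf, hg, inner_scaled, h.orthogonal]⟩
  · rw [hf, dataExt, smul_inv_smul₀ (by exact_mod_cast hlam)]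
  · rw [hg, dataExt, smul_inv_smul₀ (by exact_mod_cast hnu)]

theorem featureN_eq (k : (Ω × Ω) →ᵇ ℝ) (x : ℕ → M) {N : ℕ} (lam nu s : ℝ) (φ ψ : Fin N → ℂ)
    (y : M) : featureN k (fun n => x n) lam nu φ ((s : ℂ) • ψ) y = ((1 / √2 : ℝ) : ℂ) *
      (dataExt k x lam φ + Complex.I • ((s : ℂ) • dataExt k x nu ψ)) y := by
  rw [featureN, ContinuousMap.add_apply, ContinuousMap.smul_apply, ContinuousMap.smul_apply,
    dataExt_apply, dataExt_apply]
  simp only [smul_eq_mul, Pi.smul_apply, Finset.mul_sum, ← Finset.sum_add_distrib]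
  exact Finset.sum_congr rfl fun n _ => by rw [div_eq_mul_inv, div_eq_mul_inv]; ring

variable [MeasurableSpace Ω] [BorelSpace Ω] {μ : Measure Ω} [IsProbabilityMeasure μ]

/-- The extension `r⁻¹ ∫ k(·, y) φ(y) dμ(y)` of an eigenfunction `φ ∈ L²(μ)` to a continuous
function on `M`. -/
def eigExt (k : (Ω × Ω) →ᵇ ℝ) (M : Set Ω) [CompactSpace M] (r : ℝ) (φ : Lp ℂ 2 μ) : C(M, ℂ) :=
  (r : ℂ)⁻¹ • kernelInt μ k M φ

theorem restrictL2_eigExt (hμM : μ Mᶜ = 0) {k : (Ω × Ω) →ᵇ ℝ} {r : ℝ} (hr : r ≠ 0) {φ : Lp ℂ 2 μ}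
    (hφ : integralOp μ k φ = (r : ℂ) • φ) : restrictL2 μ M (eigExt k M r φ) = φ := by
  have h1 : restrictL2 μ M (kernelInt μ k M φ) = integralOp μ k φ := by
    rw [← restrictL2_kernelInt μ k hμM]
    rfl
  rw [eigExt, map_smul, h1, hφ, inv_smul_smul₀ (by exact_mod_cast hr)]

theorem eigExt_mem_realFns (k : (Ω × Ω) →ᵇ ℝ) (r : ℝ) {φ : Lp ℂ 2 μ}
    (hφ : ∀ᵐ x ∂μ, (φ x).im = 0) : eigExt k M r φ ∈ realFns M := by
  intro y
  have e : kernelInt μ k M φ y = ((∫ z, k (y, z) * (φ z).re ∂μ : ℝ) : ℂ) := by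
    rw [kernelInt_apply, ← integral_complex_ofReal]
    refine integral_congr_ae ?_
    filter_upwards [hφ] with z hz
    rw [Complex.ofReal_mul]
    congr 1
    exact Complex.ext (Complex.ofReal_re _).symm hz
  rw [eigExt, ContinuousMap.smul_apply, e, smul_eq_mul, ← Complex.ofReal_inv, ← Complex.ofReal_mul,
    Complex.ofReal_im]

/-- The continuous representatives of a pair in `L²(μ)` form an `EigPair`. -/
theorem IsEigenPair.eigPair (hμM : μ Mᶜ = 0) {k : (Ω × Ω) →ᵇ ℝ} {j l : ℕ} {lam nu : ℝ}
    {φ ψ : Lp ℂ 2 μ} (h : IsEigenPair (integralOp μ k) j l lam nu φ ψ) (hlam : lam ≠ 0)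
    (hnu : nu ≠ 0) :
    EigPair (restrictL2 μ M) (kernelInt μ k M) (realFns M) lam nu (eigExt k M lam φ)
      (eigExt k M nu ψ) := by
  have hf := restrictL2_eigExt hμM (M := M) hlam h.eig_φ
  have hg := restrictL2_eigExt hμM (M := M) hnu h.eig_ψ
  refine ⟨?_, ?_, eigExt_mem_realFns k lam h.real_φ, eigExt_mem_realFns k nu h.real_ψ,
    by rw [hf, h.norm_φ], by rw [hg, h.norm_ψ], by rw [hf, hg, h.orthogonal]⟩
  · rw [hf, eigExt, smul_inv_smul₀ (by exact_mod_cast hlam)]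
  · rw [hg, eigExt, smul_inv_smul₀ (by exact_mod_cast hnu)]

theorem feature_eq (k : (Ω × Ω) →ᵇ ℝ) (lam nu : ℝ) (φ ψ : Lp ℂ 2 μ) (y : M) :
    feature k lam nu φ ψ y
      = ((1 / √2 : ℝ) : ℂ) * (eigExt k M lam φ + Complex.I • eigExt k M nu ψ) y := by
  have e : ∀ z, (k (y, z) : ℂ) * (φ z / (lam : ℂ) + Complex.I * (ψ z / (nu : ℂ)))
      = (lam : ℂ)⁻¹ * ((k (y, z) : ℂ) * φ z)
        + Complex.I * (nu : ℂ)⁻¹ * ((k (y, z) : ℂ) * ψ z) := fun z => by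
    rw [div_eq_mul_inv, div_eq_mul_inv]
    ring
  rw [feature, ContinuousMap.add_apply, ContinuousMap.smul_apply, eigExt, eigExt,
    ContinuousMap.smul_apply, ContinuousMap.smul_apply, kernelInt_apply, kernelInt_apply]
  simp only [e, smul_eq_mul]
  rw [integral_add ((integrable_kernel_mul μ k φ y).const_mul _)
    ((integrable_kernel_mul μ k ψ y).const_mul _), integral_const_mul, integral_const_mul]
  ring

/-- The supremum over `x ∈ M` that expresses uniform convergence on `M` is the norm of `C(M, ℂ)`. -/
theorem iSup_enorm_eq_enorm {M : Set Ω} [CompactSpace M] {w : Ω → ℂ} {f : C(M, ℂ)}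
    (h : ∀ x : M, w x = f x) : ⨆ x ∈ M, ‖w x‖ₑ = ‖f‖ₑ := by
  rw [ContinuousMap.enorm_eq_iSup_enorm, iSup_subtype']
  exact iSup_congr fun x => by rw [h]

end Nystrom

/-! ### Rotated pairs -/

section Rotation

variable {N : ℕ}

theorem rotFst_eq_re (c : ℂ) {φ ψ : Fin N → ℂ} (hφ : ∀ n, (φ n).im = 0) (hψ : ∀ n, (ψ n).im = 0)
    (n : Fin N) : rotFst c φ ψ n = ((c * (φ n + Complex.I * ψ n)).re : ℂ) := by
  refine Complex.ext ?_ ?_ <;> simp [rotFst, hφ n, hψ n]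

theorem rotSnd_eq_im (c : ℂ) {φ ψ : Fin N → ℂ} (hφ : ∀ n, (φ n).im = 0) (hψ : ∀ n, (ψ n).im = 0)
    (n : Fin N) : rotSnd c φ ψ n = ((c * (φ n + Complex.I * ψ n)).im : ℂ) := by
  refine Complex.ext ?_ ?_ <;> simp [rotSnd, hφ n, hψ n]
  ring

theorem re_sq_add_im_sq {c : ℂ} (hc : ‖c‖ = 1) : c.re ^ 2 + c.im ^ 2 = 1 := by
  have h := Complex.normSq_eq_norm_sq c
  rw [hc, Complex.normSq_apply] at h
  linarith

/-- The frequency of an unrotated pair is controlled by the frequencies of the rotated pair: for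
antisymmetric real bilinear forms, frequencies are invariant under rotations. -/
theorem norm_freqN_sub_le {c : ℂ} (hc : ‖c‖ = 1) (τ : ℝ) (φ ψ : Fin N → ℂ) (ω : ℂ) :
    ‖freqN τ φ ψ - ω‖ ≤ ‖freqN τ (rotFst c φ ψ) (rotSnd c φ ψ) - ω‖
      + ‖freqN τ (rotSnd c φ ψ) (rotFst c φ ψ) - -ω‖
      + ‖freqN τ (rotSnd c φ ψ) (rotSnd c φ ψ) - 0‖
      + ‖freqN τ (rotFst c φ ψ) (rotFst c φ ψ) - 0‖ := by
  have h1 := re_sq_add_im_sq hc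
  have h2 : (c.re : ℂ) ^ 2 + (c.im : ℂ) ^ 2 = 1 := by exact_mod_cast h1
  have hφ : φ = fun n => (c.re : ℂ) * rotFst c φ ψ n + c.im * rotSnd c φ ψ n := by
    ext n
    simp only [rotFst, rotSnd]
    linear_combination -φ n * h2
  have hψ : ψ = fun n => (c.re : ℂ) * rotSnd c φ ψ n - c.im * rotFst c φ ψ n := by
    ext n
    simp only [rotFst, rotSnd]
    linear_combination -ψ n * h2
  have h3 := freqN_rotation τ c.re c.im (rotFst c φ ψ) (rotSnd c φ ψ)
  rw [← hφ, ← hψ] at h3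
  set ab := freqN τ (rotFst c φ ψ) (rotSnd c φ ψ)
  set ba := freqN τ (rotSnd c φ ψ) (rotFst c φ ψ)
  set bb := freqN τ (rotSnd c φ ψ) (rotSnd c φ ψ)
  set aa := freqN τ (rotFst c φ ψ) (rotFst c φ ψ)
  have e : freqN τ φ ψ - ω = (c.re : ℂ) ^ 2 * (ab - ω) + -((c.im : ℂ) ^ 2 * (ba - -ω))
      + c.re * c.im * (bb - 0) + -(c.re * c.im * (aa - 0)) := by
    rw [h3]
    linear_combination ω * h2
  have hle : ∀ (t : ℂ) (z : ℂ), ‖t‖ ≤ 1 → ‖t * z‖ ≤ ‖z‖ := fun t z ht => by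
    rw [norm_mul]
    exact mul_le_of_le_one_left (norm_nonneg _) ht
  have hre : ‖(c.re : ℂ)‖ ≤ 1 := by
    rw [Complex.norm_real]
    exact (Complex.abs_re_le_norm c).trans_eq hc
  have him : ‖(c.im : ℂ)‖ ≤ 1 := by
    rw [Complex.norm_real]
    exact (Complex.abs_im_le_norm c).trans_eq hc
  have hri : ‖(c.re : ℂ) * c.im‖ ≤ 1 := (hle _ _ hre).trans him
  rw [e]
  refine (norm_add_le _ _).trans (add_le_add ((norm_add_le _ _).trans (add_le_add
    ((norm_add_le _ _).trans (add_le_add (hle _ _ ?_) ?_)) (hle _ _ hri))) ?_)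
  · rw [norm_pow]
    exact pow_le_one₀ (norm_nonneg _) hre
  · rw [norm_neg]
    refine hle _ _ ?_
    rw [norm_pow]
    exact pow_le_one₀ (norm_nonneg _) him
  · rw [norm_neg]
    exact hle _ _ hri

/-- The autocorrelation does not depend on the phase `c`. -/
theorem autocorrN_eq {c : ℂ} (hc : ‖c‖ = 1) {φ ψ w : Fin N → ℂ}
    (hw : ∀ n, w n = c * (φ n + Complex.I * ψ n)) (q : ℕ) :
    autocorrN φ ψ q = (1 / 2 : ℝ) * innerN w (shift q w) := by
  have hc0 : c ≠ 0 := fun h => by simp [h] at hc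
  have hz : zN φ ψ = fun n => (((1 / √2 : ℝ) : ℂ) * c⁻¹) * w n := by
    ext n
    rw [zN, hw, mul_assoc, inv_mul_cancel_left₀ hc0]
  rw [autocorrN, hz, innerN_const_mul_shift, norm_mul, norm_inv, hc, inv_one, mul_one,
    norm_sq_inv_sqrt_two]

theorem IteratedLim.congr' {E : Type*} [TopologicalSpace E] {a a' : ℕ → ℕ → E} {L : E}
    (h : IteratedLim a L) (ha : ∀ᶠ k in atTop, ∀ᶠ N in atTop, a k N = a' k N) :
    IteratedLim a' L := by
  obtain ⟨b, hb, hL⟩ := h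
  exact ⟨b, by filter_upwards [hb, ha] with k h1 h2 using h1.congr' h2, hL⟩

theorem norm_rePart_sub_le {K : Type*} [TopologicalSpace K] (f : C(K, ℂ)) (x y : K) :
    ‖rePart f x - rePart f y‖ ≤ ‖f x - f y‖ := by
  rw [rePart_apply, rePart_apply, ← Complex.ofReal_sub, ← Complex.sub_re, Complex.norm_real]
  exact Complex.abs_re_le_norm _

theorem norm_imPart_sub_le {K : Type*} [TopologicalSpace K] (f : C(K, ℂ)) (x y : K) :
    ‖imPart f x - imPart f y‖ ≤ ‖f x - f y‖ := by
  rw [imPart_apply, imPart_apply, ← Complex.ofReal_sub, ← Complex.sub_im, Complex.norm_real]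
  exact Complex.abs_im_le_norm _

end Rotation

end DelayCoherence

end

open DelayCoherence in
theorem mainTheorem4
    {Ω : Type*} [MetricSpace Ω] [MeasurableSpace Ω] [BorelSpace Ω]
    {Y : Type*} [NormedAddCommGroup Y] [NormedSpace ℝ Y] [CompleteSpace Y]
    {E : Type*} [NormedAddCommGroup E] [NormedSpace ℝ E] [FiniteDimensional ℝ E]
    {H : Type*} [TopologicalSpace H] (I : ModelWithCorners ℝ E H)
    -- the flow and its ergodic invariant probability measure, carried by the compact set `X`
    (Φ : Flow ℝ Ω) (μ : Measure Ω) [IsProbabilityMeasure μ] (hΦ : IsErgodicFlow Φ μ)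
    (X : Set Ω) (hX : IsCompact X) (hXμ : μ Xᶜ = 0)
    -- the forward-invariant compact `C¹` manifold `M`, on which the flow is `C¹` and generated by
    -- the continuous vector field `v`
    (M : Set Ω) [ChartedSpace H M] [IsManifold I 1 M] (hMc : IsCompact M) (hXM : X ⊆ M)
    (hM : ∀ t : ℝ, 0 ≤ t → MapsTo (Φ t) M M)
    (hΦM : ∀ t : ℝ, 0 ≤ t → ContMDiff I I 1 (fun x : M => forwardOrbit Φ hM x t))
    (v : (x : M) → TangentSpace I x)
    (hv : Continuous (fun x : M => (⟨x, v x⟩ : TangentBundle I M)))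
    (hvΦ : ∀ x : M, IsMIntegralCurveOn (I := I) (forwardOrbit Φ hM x) v (Ici 0))
    -- the observation map, the shape function and the embedding window
    (F : C(Ω, Y)) (hF : ContMDiff I 𝓘(ℝ, Y) 1 (fun x : M => F x))
    (h : ShapeFunction) (T : ℝ) (hT : 0 < T)
    -- the sampling intervals `Δt_k = T / Q k → 0` and the initial state
    (Q : ℕ → ℕ) (hQ0 : ∀ k, 0 < Q k) (hQ : Tendsto Q atTop atTop)
    (x₀ : Ω) (hx₀ : x₀ ∈ M) (hconv : ∀ k, SamplesConverge Φ μ x₀ (T / Q k))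
    -- the eigenfunctions `φ`, `ψ` of `K_T`; the eigenvalues are simple if distinct, and twofold
    -- degenerate if equal
    (j l : ℕ) (hjl : j < l) (lam nu : ℝ) (hlam : 0 < lam) (φ ψ : Lp ℂ 2 μ)
    (hpair : IsEigenPair (integralOp μ (kernel h Φ F T)) j l lam nu φ ψ)
    (hsimple : lam ≠ nu →
      Module.finrank ℂ (Module.End.eigenspace (integralOp μ (kernel h Φ F T)) (lam : ℂ)) = 1 ∧
      Module.finrank ℂ (Module.End.eigenspace (integralOp μ (kernel h Φ F T)) (nu : ℂ)) = 1)
    (hdouble : lam = nu →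
      Module.finrank ℂ (Module.End.eigenspace (integralOp μ (kernel h Φ F T)) (lam : ℂ)) = 2)
    -- arbitrary eigenvectors `φd k N`, `ψd k N` of the data-driven operators `K_{T,Δt_k,N}`
    (lamd nud : ℕ → ℕ → ℝ) (φd ψd : (k N : ℕ) → Fin N → ℂ)
    (hdata : ∀ k N : ℕ, l < N →
      IsDataEigenPair (dataOp (kernelDisc h Φ F T (Q k)) (sample Φ x₀ (T / Q k)) N) j l
        (lamd k N) (nud k N) (φd k N) (ψd k N)) :
    -- the data-driven eigenvalues are eventually positive
    (∀ᶠ k in atTop, ∀ᶠ N in atTop, 0 < lamd k N ∧ 0 < nud k N) ∧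
    -- `φ` lies in the domain of the generator, so that `ω = ⟨ψ, V φ⟩` is defined
    ∃ hφ : φ ∈ (koopmanGenerator hΦ).domain,
    -- orientation signs `s` and phases `c`, which are signs in the case of simple eigenvalues
    ∃ s : ℕ → ℕ → ℝ, ∃ c : ℕ → ℕ → ℂ,
      (∀ k N, s k N = 1 ∨ s k N = -1) ∧ (∀ k N, ‖c k N‖ = 1) ∧
      (lam ≠ nu → ∀ k N, c k N = 1 ∨ c k N = -1) ∧
      -- (i) uniform convergence of the coherent features on `M`
      IteratedLim (fun k N => ⨆ x ∈ M,
        ‖c k N * featureN (kernelDisc h Φ F T (Q k)) (sample Φ x₀ (T / Q k))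
            (lamd k N) (nud k N) (φd k N) ((s k N : ℂ) • ψd k N) x
          - feature (kernel h Φ F T) lam nu φ ψ x‖ₑ) 0 ∧
      -- (ii) convergence of the autocorrelations, uniformly in `q`
      (∃ a : ℕ → ℕ → ℂ,
        (∀ᶠ k in atTop, ∀ q : ℕ, Tendsto
          (fun N => autocorrN (φd k N) ((s k N : ℂ) • ψd k N) q) atTop (𝓝 (a k q))) ∧
        ∀ ε > 0, ∀ᶠ k in atTop, ∀ q : ℕ,
          ‖a k q - autocorr hΦ φ ψ (q * (T / Q k))‖ < ε) ∧
      -- (iii) convergence of the frequencies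
      IteratedLim (fun k N => freqN (T / Q k)
          (rotFst (c k N) (φd k N) ((s k N : ℂ) • ψd k N))
          (rotSnd (c k N) (φd k N) ((s k N : ℂ) • ψd k N)))
        (inner ℂ ψ (koopmanGenerator hΦ ⟨φ, hφ⟩)) ∧
      ∀ ε > 0, ∀ᶠ k in atTop, ∀ᶠ N in atTop,
        ‖freqN (T / Q k) (φd k N) ((s k N : ℂ) • ψd k N)
          - inner ℂ ψ (koopmanGenerator hΦ ⟨φ, hφ⟩)‖ < ε := by
  have : CompactSpace M := isCompact_iff_compactSpace.1 hMc
  have hμM : μ Mᶜ = 0 := measure_mono_null (compl_subset_compl.2 hXM) hXμ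
  obtain ⟨L, hL0, hL⟩ := exists_observable_lipschitz I Φ M hM v hv hvΦ F hF
  obtain ⟨K, hK, hk, hkd, hkc⟩ := exists_kernel_estimates h Φ F hT hM hL0 hL
  have hτ : ∀ k, 0 < T / Q k := fun k => div_pos hT (by exact_mod_cast hQ0 k)
  have hτl : Tendsto (fun k => T / (Q k : ℝ)) atTop (𝓝 0) :=
    tendsto_const_nhds.div_atTop (tendsto_natCast_atTop_atTop.comp hQ)
  let x : ∀ k, ℕ → M := fun k => sampleM hM hx₀ (hτ k).le
  -- the operators and their convergence
  have hRS : ∀ k : (Ω × Ω) →ᵇ ℝ, ((restrictL2 μ M).comp (kernelInt μ k M) :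
      Lp ℂ 2 μ →ₗ[ℂ] Lp ℂ 2 μ) = integralOp μ k := fun k => restrictL2_kernelInt μ k hμM
  have hcpt : ∀ k : (Ω × Ω) →ᵇ ℝ, IsCompactOperator ((restrictL2 μ M).comp (kernelInt μ k M)) :=
    fun k => by
      rw [ContinuousLinearMap.coe_comp]
      exact (isCompactOperator_kernelInt μ k hμM).clm_comp _
  have hsym₀ : ((restrictL2 μ M).comp (kernelInt μ (kernel h Φ F T) M) :
      Lp ℂ 2 μ →ₗ[ℂ] Lp ℂ 2 μ).IsSymmetric := by
    rw [hRS]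
    exact isSymmetric_integralOp μ _ (kernel_comm h Φ F T) hμM
  have hsym : ∀ k, ((restrictL2 μ M).comp (kernelInt μ (kernelDisc h Φ F T (Q k)) M) :
      Lp ℂ 2 μ →ₗ[ℂ] Lp ℂ 2 μ).IsSymmetric := fun k => by
    rw [hRS]
    exact isSymmetric_integralOp μ _ (kernelDisc_comm h Φ F T (Q k)) hμM
  have hC0 : 0 ≤ h.bounded.choose := (norm_nonneg _).trans (norm_kernelDisc_le h Φ F T 0)
  have hS := spectralConv_kernel μ hμM (M := M) (ks := fun k => kernelDisc h Φ F T (Q k))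
    (k := kernel h Φ F T) (fun k => norm_kernelDisc_le h Φ F T (Q k))
    (δ := fun k => K * (T / Q k)) (fun k => mul_nonneg hK (hτ k).le)
    (fun k => hkc (Q k) (hQ0 k)) (by simpa using hτl.const_mul K)
  have hSd := fun k => spectralConv_sample (x := x k) hμM (hconv k) (kernelDisc h Φ F T (Q k))
  -- the eigenvalues of the limit operator
  have hnth : ∀ {i : ℕ} {r : ℝ}, IsNthEigenvalue (integralOp μ (kernel h Φ F T)) i r →
      IsNthOrtho ((restrictL2 μ M).comp (kernelInt μ (kernel h Φ F T) M) :
        Lp ℂ 2 μ →ₗ[ℂ] Lp ℂ 2 μ) i r := fun hi => by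
    rw [← hRS] at hi
    exact hi.isNthOrtho hsym₀
  have hl := hnth hpair.nth_lam
  have hj := hnth hpair.nth_nu
  have hnu : 0 < nu := hlam.trans_le (hl.anti hj hjl.le)
  have hno : ¬ HasOrthoEig ((restrictL2 μ M).comp (kernelInt μ (kernel h Φ F T) M) :
      Lp ℂ 2 μ →ₗ[ℂ] Lp ℂ 2 μ) 3 (fun u => u = lam ∨ u = nu) := by
    rw [hRS]
    exact not_hasOrthoEig_three hsimple hdouble
  have h₀ := hpair.eigPair (M := M) hμM hlam.ne' hnu.ne'
  obtain ⟨hpos, s, c, hs, hc, hc', e, f, g, he, hfg, hu, hu₀⟩ := exists_aligned_iterated hS hC0 hSd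
    (fun k => norm_nonneg _) hsym₀ hsym
    (fun k N => isSymmetric_sample _ (kernelDisc_comm h Φ F T (Q k)) (x k) N)
    (fun k => hcpt _) (fun k N => isCompactOperator_of_locallyCompactSpace_dom _)
    isClosed_realFns (fun f hf => neg_mem_realFns hf) (fun f hf g hg => im_inner_restrictL2 hf hg)
    hjl.le hlam hl hj hno h₀ (lamd := lamd) (nud := nud)
    (fd := fun k N => dataExt (kernelDisc h Φ F T (Q k)) (x k) (lamd k N) (φd k N))
    (gd := fun k N => dataExt (kernelDisc h Φ F T (Q k)) (x k) (nud k N) (ψd k N))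
    (fun k => (eventually_gt_atTop l).mono fun N hN => IsNthEigenvalue.isNthOrtho_sample
      (kernelDisc_comm h Φ F T (Q k)) (x k) (hdata k N hN).nth_lam)
    (fun k => (eventually_gt_atTop l).mono fun N hN => IsNthEigenvalue.isNthOrtho_sample
      (kernelDisc_comm h Φ F T (Q k)) (x k) (hdata k N hN).nth_nu)
    (fun k => (eventually_gt_atTop l).mono fun N hN h1 h2 =>
      (hdata k N hN).eigPair (x := x k) h1.ne' h2.ne')
  -- the generator on the eigenfunctions
  obtain ⟨χ, hχ⟩ := exists_hasDerivAt_eigenfunction hΦ hμM hM hK hk hlam.ne' hpair.eig_φ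
  obtain ⟨η, hη⟩ := exists_hasDerivAt_eigenfunction hΦ hμM hM hK hk hnu.ne' hpair.eig_ψ
  have hφ : φ ∈ (koopmanGenerator hΦ).domain := hχ.differentiableAt
  have hV : koopmanGenerator hΦ ⟨φ, hφ⟩ = χ := hχ.deriv
  have hRf : restrictL2 μ M (eigExt (kernel h Φ F T) M lam φ) = φ :=
    restrictL2_eigExt hμM hlam.ne' hpair.eig_φ
  have hRg : restrictL2 μ M (eigExt (kernel h Φ F T) M nu ψ) = ψ :=
    restrictL2_eigExt hμM hnu.ne' hpair.eig_ψ
  have hχ' := hχ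
  have hη' := hη
  rw [← hRf] at hχ'
  rw [← hRg] at hη'
  -- the form `(a, b) ↦ ⟨a, V b⟩` is real and antisymmetric on real functions
  have hφη : inner ℂ φ η = -inner ℂ ψ χ := by
    have h1 := im_inner_generator hΦ hμM hM h₀.real_f h₀.real_g hη'
    rw [hRf] at h1
    rw [inner_generator_antisymm hΦ hχ hη, Complex.conj_eq_iff_im.2 h1, neg_neg]
  have hzero : ∀ z : ℂ, z = -(starRingEnd ℂ) z → z.im = 0 → z = 0 := fun z h1 h2 => by
    rw [Complex.conj_eq_iff_im.2 h2] at h1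
    exact self_eq_neg.1 h1
  have hφχ : inner ℂ φ χ = 0 := by
    have h1 := im_inner_generator hΦ hμM hM h₀.real_f h₀.real_f hχ'
    rw [hRf] at h1
    exact hzero _ (inner_generator_antisymm hΦ hχ hχ) h1
  have hψη : inner ℂ ψ η = 0 := by
    have h1 := im_inner_generator hΦ hμM hM h₀.real_g h₀.real_g hη'
    rw [hRg] at h1
    exact hzero _ (inner_generator_antisymm hΦ hη hη) h1
  -- the aligned continuous extensions of the data-driven eigenvectors, and their limits
  set ud : ℕ → ℕ → C(M, ℂ) := fun k N =>
    c k N • (dataExt (kernelDisc h Φ F T (Q k)) (x k) (lamd k N) (φd k N) + Complex.I •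
      ((s k N : ℂ) • dataExt (kernelDisc h Φ F T (Q k)) (x k) (nud k N) (ψd k N))) with hud
  set u : ℕ → C(M, ℂ) := fun k => e k • (f k + Complex.I • g k) with hudef
  set u₀ : C(M, ℂ) :=
    eigExt (kernel h Φ F T) M lam φ + Complex.I • eigExt (kernel h Φ F T) M nu ψ with hu₀def
  have hre₀ : rePart u₀ = eigExt (kernel h Φ F T) M lam φ :=
    rePart_add_I_smul h₀.real_f h₀.real_g
  have him₀ : imPart u₀ = eigExt (kernel h Φ F T) M nu ψ :=
    imPart_add_I_smul h₀.real_f h₀.real_g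
  -- the eigenvalues stay above `lam / 2`, whence a Lipschitz constant that does not depend on `k`
  have hlip : ∀ᶠ k in atTop, ∀ y, ‖u k (forwardMap hM (hτ k).le y) - u k y‖
      ≤ 2 * (K / (lam / 2)) * (T / Q k) := by
    filter_upwards [hfg] with k ⟨r, r', hr, hr', hE⟩ y
    exact norm_combination_orbit_sub_le hμM hM hK (hkd (Q k) (hQ0 k)) (half_pos hlam) hr hr' hE
      (he k) (hτ k).le y
  have hval : ∀ᶠ k in atTop, ∀ᶠ N in atTop, ∀ n : Fin N,
      ud k N (x k n) = c k N * (φd k N n + Complex.I * ((s k N : ℂ) • ψd k N) n) := by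
    filter_upwards [hpos] with k hk
    filter_upwards [hk, eventually_gt_atTop l] with N h1 h2 n
    have hD := hdata k N h2
    simp only [hud, ContinuousMap.smul_apply, ContinuousMap.add_apply, smul_eq_mul, Pi.smul_apply]
    rw [dataExt_sample (x := x k) h1.1.ne' hD.eig_φ, dataExt_sample (x := x k) h1.2.ne' hD.eig_ψ]
  have hreal : ∀ k N, l < N → (∀ n, (φd k N n).im = 0) ∧
      ∀ n, (((s k N : ℂ) • ψd k N) n).im = 0 := fun k N hN => by
    refine ⟨(hdata k N hN).real_φ, fun n => ?_⟩
    simp [(hdata k N hN).real_ψ n]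
  have hA : ∀ᶠ k in atTop, ∀ᶠ N in atTop, rotFst (c k N) (φd k N) ((s k N : ℂ) • ψd k N)
      = fun n : Fin N => rePart (ud k N) (sampleM hM hx₀ (hτ k).le n) := by
    filter_upwards [hval] with k hk
    filter_upwards [hk, eventually_gt_atTop l] with N h1 h2
    ext n
    rw [rotFst_eq_re _ (hreal k N h2).1 (hreal k N h2).2, ← h1 n]
    rfl
  have hB : ∀ᶠ k in atTop, ∀ᶠ N in atTop, rotSnd (c k N) (φd k N) ((s k N : ℂ) • ψd k N)
      = fun n : Fin N => imPart (ud k N) (sampleM hM hx₀ (hτ k).le n) := by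
    filter_upwards [hval] with k hk
    filter_upwards [hk, eventually_gt_atTop l] with N h1 h2
    ext n
    rw [rotSnd_eq_im _ (hreal k N h2).1 (hreal k N h2).2, ← h1 n]
    rfl
  have hre := hu.mono fun k hk => (continuous_rePart.tendsto _).comp hk
  have him := hu.mono fun k hk => (continuous_imPart.tendsto _).comp hk
  have hre' := (continuous_rePart.tendsto _).comp hu₀
  have him' := (continuous_imPart.tendsto _).comp hu₀
  rw [hre₀] at hre'
  rw [him₀] at him'
  have hC : 0 ≤ 2 * (K / (lam / 2)) := by positivity
  have hlre := hlip.mono fun k hk y => (norm_rePart_sub_le _ _ _).trans (hk y)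
  have hlim := hlip.mono fun k hk y => (norm_imPart_sub_le _ _ _).trans (hk y)
  have hAB : IteratedLim (fun k N => freqN (T / Q k)
      (rotFst (c k N) (φd k N) ((s k N : ℂ) • ψd k N))
      (rotSnd (c k N) (φd k N) ((s k N : ℂ) • ψd k N))) (inner ℂ ψ χ) := by
    rw [← hRg]
    refine (iteratedLim_freqN hΦ hμM hM hx₀ hτ hτl hconv hre hre' him him' hC hlre hχ' hη').congr' ?_
    filter_upwards [hA, hB] with k h1 h2
    filter_upwards [h1, h2] with N h3 h4
    rw [h3, h4]
    rfl
  have hBA : IteratedLim (fun k N => freqN (T / Q k)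
      (rotSnd (c k N) (φd k N) ((s k N : ℂ) • ψd k N))
      (rotFst (c k N) (φd k N) ((s k N : ℂ) • ψd k N))) (-inner ℂ ψ χ) := by
    rw [← hφη, ← hRf]
    refine (iteratedLim_freqN hΦ hμM hM hx₀ hτ hτl hconv him him' hre hre' hC hlim hη' hχ').congr' ?_
    filter_upwards [hA, hB] with k h1 h2
    filter_upwards [h1, h2] with N h3 h4
    rw [h3, h4]
    rfl
  have hAA : IteratedLim (fun k N => freqN (T / Q k)
      (rotFst (c k N) (φd k N) ((s k N : ℂ) • ψd k N))
      (rotFst (c k N) (φd k N) ((s k N : ℂ) • ψd k N))) 0 := by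
    rw [← hφχ, ← hRf]
    refine (iteratedLim_freqN hΦ hμM hM hx₀ hτ hτl hconv hre hre' hre hre' hC hlre hχ' hχ').congr' ?_
    filter_upwards [hA] with k h1
    filter_upwards [h1] with N h3
    rw [h3]
    rfl
  have hBB : IteratedLim (fun k N => freqN (T / Q k)
      (rotSnd (c k N) (φd k N) ((s k N : ℂ) • ψd k N))
      (rotSnd (c k N) (φd k N) ((s k N : ℂ) • ψd k N))) 0 := by
    rw [← hψη, ← hRg]
    refine (iteratedLim_freqN hΦ hμM hM hx₀ hτ hτl hconv him him' him him' hC hlim hη' hη').congr' ?_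
    filter_upwards [hB] with k h1
    filter_upwards [h1] with N h3
    rw [h3]
    rfl
  refine ⟨hpos, hφ, s, c, hs, hc, hc', ?_, ?_, ?_, ?_⟩
  · have hfeat : ∀ k N, ⨆ y ∈ M, ‖c k N * featureN (kernelDisc h Φ F T (Q k))
        (sample Φ x₀ (T / Q k)) (lamd k N) (nud k N) (φd k N) ((s k N : ℂ) • ψd k N) y
          - feature (kernel h Φ F T) lam nu φ ψ y‖ₑ
        = ‖((1 / √2 : ℝ) : ℂ) • (ud k N - u₀)‖ₑ := fun k N =>
      iSup_enorm_eq_enorm fun y => by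
        have h1 := featureN_eq (kernelDisc h Φ F T (Q k)) (x k) (lamd k N) (nud k N) (s k N)
          (φd k N) (ψd k N) y
        change featureN (kernelDisc h Φ F T (Q k)) (sample Φ x₀ (T / Q k)) (lamd k N) (nud k N)
          (φd k N) ((s k N : ℂ) • ψd k N) y = _ at h1
        rw [h1, feature_eq]
        simp only [hud, hu₀def, ContinuousMap.smul_apply, ContinuousMap.sub_apply, smul_eq_mul]
        ring
    simp only [hfeat]
    refine ⟨fun k => ‖((1 / √2 : ℝ) : ℂ) • (u k - u₀)‖ₑ, hu.mono fun k hk => ?_, ?_⟩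
    · exact ((hk.sub_const u₀).const_smul _).enorm
    · simpa using ((hu₀.sub_const u₀).const_smul ((1 / √2 : ℝ) : ℂ)).enorm
  · refine ⟨fun k q => (1 / 2 : ℝ) * inner ℂ (restrictL2 μ M (u k))
      (koopman hΦ (q * (T / Q k)) (restrictL2 μ M (u k))), ?_, ?_⟩
    · filter_upwards [hu, hval] with k h1 h2 q
      refine ((tendsto_innerN_shift hΦ hμM hM hx₀ (hτ k).le (hconv k) h1 h1 q).const_mul
        ((1 / 2 : ℝ) : ℂ)).congr' ?_
      filter_upwards [h2] with N h3
      exact (autocorrN_eq (hc k N) h3 q).symm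
    · intro ε hε
      have h1 : Tendsto (fun k => ‖u k - u₀‖ * (‖u k‖ + ‖u₀‖)) atTop (𝓝 0) := by
        simpa using (hu₀.sub_const u₀).norm.mul (hu₀.norm.add_const ‖u₀‖)
      filter_upwards [h1.eventually_lt_const hε] with k hk q
      have h2 := autocorr_eq hΦ (eigExt (kernel h Φ F T) M lam φ) (eigExt (kernel h Φ F T) M nu ψ)
        (q * (T / Q k))
      rw [hRf, hRg, ← hu₀def] at h2
      rw [h2, ← mul_sub, norm_mul, Complex.norm_real, Real.norm_of_nonneg (by norm_num)]
      refine lt_of_le_of_lt ?_ hk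
      refine (mul_le_of_le_one_left (norm_nonneg _) (by norm_num)).trans ?_
      refine (norm_inner_koopman_sub_le hΦ _ _ _).trans ?_
      rw [← map_sub]
      exact mul_le_mul (norm_restrictL2_le μ _)
        (add_le_add (norm_restrictL2_le μ _) (norm_restrictL2_le μ _)) (by positivity)
        (norm_nonneg _)
  · rw [hV]
    exact hAB
  · intro ε hε
    have hε4 : 0 < ε / 4 := by positivity
    rw [hV]
    filter_upwards [hAB.eventually_norm_sub_lt hε4, hBA.eventually_norm_sub_lt hε4,
      hBB.eventually_norm_sub_lt hε4, hAA.eventually_norm_sub_lt hε4] with k h1 h2 h3 h4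
    filter_upwards [h1, h2, h3, h4] with N h5 h6 h7 h8
    have := norm_freqN_sub_le (hc k N) (T / Q k) (φd k N) ((s k N : ℂ) • ψd k N) (inner ℂ ψ χ)
    linarith
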